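/- Let $p$ be a prime, $n\ge 1$, and let $\mathbb{Q}_p^n$ carry the norm $|x|_p=\max_j|x_j|_p$ and the Haar measure $|\cdot|_h$ (also written $dx$) normalized so that the closed unit ball has measure $1$. For $\gamma\in\mathbb{Z}$ put $B_\gamma(x)=\{y:|y-x|_p\le p^\gamma\}$. All functions are real-valued, and locally integrable functions are identified when they agree almost everywhere. Notation. For $0\le\alpha<n$, a measurable $f$ and a ball $B$, $$\mathcal{M}_\alpha^p(f)(x)=\sup_{\gamma\in\mathbb{Z}}\frac{1}{|B_\gamma(x)|_h^{1-\alpha/n}}\int_{B_\gamma(x)}|f(y)|\,dy\in[0,\infty],$$ and $\mathcal{M}_{\alpha,B}^p(f)(x)$ is the same supremum restricted to those $\gamma$ with $B_\gamma(x)\subset B$. The nonlinear commutator is $[b,\mathcal{M}_\alpha^p](f)=b\,\mathcal{M}_\alpha^p(f)-\mathcal{M}_\alpha^p(bf)$. $\Lambda_\beta(\mathbb{Q}_p^n)$ is the set of measurable $f$ with $\sup_{x\ne y}|f(x)-f(y)|/|x-y|_p^\beta<\infty$. For a measurable $q:\mathbb{Q}_p^n\to\mathbb{R}$ let $q_-,q_+$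 be its essential infimum and supremum, and $q_\pm(B)$ those over a ball $B$. Let $\mathscr{P}$ be the set of measurable $q(\cdot)$ with $1<q_-\le q(x)\le q_+<\infty$ for all $x$, and $\mathscr{C}^{\log}$ the set of $q(\cdot)\in\mathscr{P}$ for which there is $C>0$ such that $\gamma\,(q_-(B_\gamma(x))-q_+(B_\gamma(x)))\le C$ for all $\gamma\in\mathbb{Z}$, $x\in\mathbb{Q}_p^n$, and $|q(x)-q(y)|\le C/\log_p(p+\min\{|x|_p,|y|_p\})$ for all $x,y\in\mathbb{Q}_p^n$. The space $L^{q(\cdot)}(\mathbb{Q}_p^n)$ consists of the measurable $f$ with $\int(|f(x)|/\eta)^{q(x)}dx<\infty$ for some $\eta>0$, with the norm $\|f\|_{L^{q(\cdot)}}=\inf\{\eta>0:\int(|f(x)|/\eta)^{q(x)}dx\le1\}$. The commutator $[b,\mathcal{M}_\alpha^p]$ is bounded from $L^{r(\cdot)}$ to $L^{q(\cdot)}$ if there is a constant $C$ such that, for every $f\in L^{r(\cdot)}$, both $\mathcal{M}_\alpha^p(f)$ and $\mathcal{M}_\alpha^p(bf)$ are finite almost everywhere, $[b,\mathcal{M}_\alpha^p](f)\in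 L^{q(\cdot)}$, and $\|[b,\mathcal{M}_\alpha^p](f)\|_{L^{q(\cdot)}}\le C\|f\|_{L^{r(\cdot)}}$. Theorem. Let $0<\beta<1$, $0<\alpha<\alpha+\beta<n$, and let $b$ be a locally integrable function on $\mathbb{Q}_p^n$. Call a pair $(r(\cdot),q(\cdot))$ admissible if $r(\cdot),q(\cdot)\in\mathscr{C}^{\log}$, $r(\cdot)\in\mathscr{P}$, $r_+<\frac{n}{\alpha+\beta}$ and $1/q(\cdot)=1/r(\cdot)-(\alpha+\beta)/n$. The following assertions are equivalent: (A.1) $b\in\Lambda_\beta(\mathbb{Q}_p^n)$ and $b\ge0$ (that is, $b$ agrees almost everywhere with a nonnegative function in $\Lambda_\beta(\mathbb{Q}_p^n)$). (A.2) $[b,\mathcal{M}_\alpha^p]$ is bounded from $L^{r(\cdot)}(\mathbb{Q}_p^n)$ to $L^{q(\cdot)}(\mathbb{Q}_p^n)$ for all admissible pairs $(r(\cdot),q(\cdot))$. (A.3) $[b,\mathcal{M}_\alpha^p]$ is bounded from $L^{r(\cdot)}(\mathbb{Q}_p^n)$ to $L^{q(\cdot)}(\mathbb{Q}_p^n)$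 for some admissible pair $(r(\cdot),q(\cdot))$. (A.4) For some admissible pair $(r(\cdot),q(\cdot))$, $$\sup_{\gamma\in\mathbb{Z},\,x\in\mathbb{Q}_p^n}\frac{1}{|B_\gamma(x)|_h^{\beta/n}}\,\frac{\big\|\big(b-|B_\gamma(x)|_h^{-\alpha/n}\mathcal{M}_{\alpha,B_\gamma(x)}^p(b)\big)\chi_{B_\gamma(x)}\big\|_{L^{q(\cdot)}(\mathbb{Q}_p^n)}}{\|\chi_{B_\gamma(x)}\|_{L^{q(\cdot)}(\mathbb{Q}_p^n)}}<\infty.$$ (A.5) The inequality in (A.4) holds for all admissible pairs $(r(\cdot),q(\cdot))$. -/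

import Mathlib

open MeasureTheory
open scoped ENNReal NNReal

noncomputable section

namespace PadicVar

/-- `ℚ_[p]` carries its Borel σ-algebra. -/
instance instMeasurableSpacePadic (p : ℕ) [Fact p.Prime] : MeasurableSpace ℚ_[p] := borel ℚ_[p]

instance instBorelSpacePadic (p : ℕ) [Fact p.Prime] : BorelSpace ℚ_[p] := ⟨rfl⟩

/-- The space `ℚ_p^n`; its norm is `|x|_p = max_j |x_j|_p`. -/
abbrev Qpn (p : ℕ) [Fact p.Prime] (n : ℕ) : Type := Fin n → ℚ_[p]

section Basic

variable {p : ℕ} [Fact p.Prime] {n : ℕ}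

/-- The ball `B_γ(a) = {x : |x - a|_p ≤ p ^ γ}`. -/
def pball (γ : ℤ) (a : Qpn p n) : Set (Qpn p n) := Metric.closedBall a ((p : ℝ) ^ γ)

variable (p n) in
/-- The unit ball of `ℚ_p^n` as a compact set with non-empty interior. -/
def unitBall : TopologicalSpace.PositiveCompacts (Qpn p n) where
  carrier := Metric.closedBall 0 1
  isCompact' := isCompact_closedBall 0 1
  interior_nonempty' :=
    ⟨0, Metric.ball_subset_interior_closedBall (Metric.mem_ball_self one_pos)⟩

variable (p n) in
/-- The Haar measure on `ℚ_p^n` with `|B_0(0)| = 1`. -/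
def haar : Measure (Qpn p n) := Measure.addHaarMeasure (unitBall p n)

/-! ### Fractional maximal functions and the nonlinear commutator -/

/-- `M_α f (x) = sup_γ |B_γ(x)|^{-(1 - α/n)} ∫_{B_γ(x)} |f|`, with values in `[0, ∞]`. -/
def fracMax (α : ℝ) (f : Qpn p n → ℝ) (x : Qpn p n) : ℝ≥0∞ :=
  ⨆ γ : ℤ, (∫⁻ y in pball γ x, ‖f y‖ₑ ∂(haar p n)) / (haar p n (pball γ x)) ^ (1 - α / n)

/-- `M_{α,S} f (x)`: the supremum is over those balls `B_γ(x)` that are contained in `S`. -/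
def fracMaxOn (α : ℝ) (S : Set (Qpn p n)) (f : Qpn p n → ℝ) (x : Qpn p n) : ℝ≥0∞ :=
  ⨆ (γ : ℤ) (_ : pball γ x ⊆ S),
    (∫⁻ y in pball γ x, ‖f y‖ₑ ∂(haar p n)) / (haar p n (pball γ x)) ^ (1 - α / n)

/-- `[b, M_α] f (x) = b(x) M_α f (x) - M_α (b f) (x)`, meaningful where both maximal functions
are finite (this is demanded almost everywhere in `CommutatorBounded`). -/
def commutator (α : ℝ) (b f : Qpn p n → ℝ) (x : Qpn p n) : ℝ :=
  b x * (fracMax α f x).toReal - (fracMax α (fun y => b y * f y) x).toReal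

/-! ### Variable exponents and variable exponent Lebesgue spaces -/

/-- The class of measurable exponents with `1 < q₋ ≤ q(x) ≤ q₊ < ∞` for all `x`, where `q₋`, `q₊`
are the essential infimum and supremum. (Real-valued `essInf` and `essSup` are `0` for functions
that are not essentially bounded below, respectively above; these are excluded by the bounds.) -/
structure MemP (q : Qpn p n → ℝ) : Prop where
  measurable : Measurable q
  one_lt : 1 < essInf q (haar p n)
  le_apply : ∀ x, essInf q (haar p n) ≤ q x
  apply_le : ∀ x, q x ≤ essSup q (haar p n)

/-- The local log-Hölder condition `γ (q₋(B_γ(x)) - q₊(B_γ(x))) ≤ C`. -/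
def LogHolderZero (q : Qpn p n → ℝ) : Prop :=
  ∃ C : ℝ, 0 < C ∧ ∀ (γ : ℤ) (x : Qpn p n),
    (γ : ℝ) * (essInf q ((haar p n).restrict (pball γ x)) -
      essSup q ((haar p n).restrict (pball γ x))) ≤ C

/-- The log-Hölder condition at infinity. -/
def LogHolderInfty (q : Qpn p n → ℝ) : Prop :=
  ∃ C : ℝ, 0 < C ∧ ∀ x y : Qpn p n,
    |q x - q y| ≤ C / Real.logb p (p + min ‖x‖ ‖y‖)

/-- The class `C^log` of globally log-Hölder continuous exponents. -/
structure MemClog (q : Qpn p n → ℝ) : Prop where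
  memP : MemP q
  zero : LogHolderZero q
  infty : LogHolderInfty q

/-- The modular `F_q(f / η) = ∫ (|f(x)| / η)^{q(x)} dx`. -/
def modular (q f : Qpn p n → ℝ) (η : ℝ) : ℝ≥0∞ :=
  ∫⁻ x, ENNReal.ofReal ((|f x| / η) ^ q x) ∂(haar p n)

/-- Membership in `L^{q(·)}`. -/
def MemLvar (q f : Qpn p n → ℝ) : Prop :=
  AEStronglyMeasurable f (haar p n) ∧ ∃ η : ℝ, 0 < η ∧ modular q f η < ∞

/-- The Luxemburg norm `inf {η > 0 : F_q(f / η) ≤ 1}` (equal to `∞` if there is no such `η`). -/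
def luxNorm (q f : Qpn p n → ℝ) : ℝ≥0∞ :=
  ⨅ (η : ℝ) (_ : 0 < η ∧ modular q f η ≤ 1), ENNReal.ofReal η

/-- Boundedness of `[b, M_α]` from `L^{r(·)}` to `L^{q(·)}`: for each `f` in `L^{r(·)}` the
commutator is defined almost everywhere, lies in `L^{q(·)}`, and has norm at most `C ‖f‖`. -/
def CommutatorBounded (α : ℝ) (b r q : Qpn p n → ℝ) : Prop :=
  ∃ C : ℝ≥0, ∀ f : Qpn p n → ℝ, MemLvar r f →
    (∀ᵐ x ∂(haar p n), fracMax α f x < ∞ ∧ fracMax α (fun y => b y * f y) x < ∞) ∧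
    MemLvar q (commutator α b f) ∧
    luxNorm q (commutator α b f) ≤ C * luxNorm r f

/-- The pairs of exponents with `r, q ∈ C^log`, `r ∈ P`, `r₊ < n / s` and
`1 / q(·) = 1 / r(·) - s / n`. -/
structure AdmissiblePair (s : ℝ) (r q : Qpn p n → ℝ) : Prop where
  r_mem_Clog : MemClog r
  q_mem_Clog : MemClog q
  r_mem_P : MemP r
  r_lt : essSup r (haar p n) < n / s
  rel : ∀ x, 1 / q x = 1 / r x - s / n

/-! ### The oscillation condition -/

/-- The function `(b - |B|^{-α/n} M_{α,B}(b)) χ_B`. For locally integrable `b` and `α > 0` the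
maximal function is finite almost everywhere on the ball `B`, by Lebesgue differentiation. -/
def oscFun (α : ℝ) (b : Qpn p n → ℝ) (B : Set (Qpn p n)) : Qpn p n → ℝ :=
  B.indicator fun y => b y - (haar p n B).toReal ^ (-α / n) * (fracMaxOn α B b y).toReal

/-- The supremum over all balls `B` of
`|B|^{-β/n} ‖(b - |B|^{-α/n} M_{α,B}(b)) χ_B‖_{q(·)} / ‖χ_B‖_{q(·)}`. -/
def oscSup (α β : ℝ) (b q : Qpn p n → ℝ) : ℝ≥0∞ :=
  ⨆ (γ : ℤ) (x : Qpn p n),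
    1 / (haar p n (pball γ x)) ^ (β / n) *
      (luxNorm q (oscFun α b (pball γ x)) / luxNorm q ((pball γ x).indicator fun _ => 1))

/-! ### Lipschitz spaces -/

/-- The norm `sup_{x ≠ y} |f(x) - f(y)| / |x - y|_p^β`. -/
def lipNorm (β : ℝ) (f : Qpn p n → ℝ) : ℝ≥0∞ :=
  ⨆ (x : Qpn p n) (y : Qpn p n) (_ : x ≠ y), ENNReal.ofReal (|f x - f y| / ‖x - y‖ ^ β)

/-- Membership in the homogeneous Lipschitz space `Λ_β`. -/
def MemLip (β : ℝ) (f : Qpn p n → ℝ) : Prop :=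
  Measurable f ∧ lipNorm β f < ∞

end Basic

end PadicVar

end

/-!
In the ultrametric space `ℚ_p^n` two balls are nested or disjoint, so averages over balls of a fixed
radius are locally constant. Maximal disjoint stopping balls give the weak `(1, 1)` bound of the
maximal function, hence its strong `(t, t)` bounds. Hedberg's inequality and the log-Hölder
conditions then bound the fractional maximal operator `M_{α+β}` from `L^{r(·)}` to `L^{q(·)}`: on
small balls an exponent is compared with its essential infimum, on large balls with its limit at
infinity.

If `b ≥ 0` is in `Λ_β`, then `|[b, M_α] f| ≤ ‖b‖ M_{α+β} f` pointwise. Conversely, for `x` in a ball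
`B`, `M_α χ_B (x) = |B|^{α/n}` and `M_α (b χ_B) (x) = M_{α,B} b (x)`, so a bounded commutator,
tested on `χ_B`, controls the oscillation function of `b` on `B`. That function dominates
`(⟨|b|⟩_B - b)⁺`, because `⟨|b|⟩_B ≤ |B|^{-α/n} M_{α,B} b`, and
`⟨|b - ⟨|b|⟩_B|⟩_B ≤ 2 ⟨(⟨|b|⟩_B - b)⁺⟩_B`. Thus `⟨|b - ⟨|b|⟩_B|⟩_B ≲ |B|^{β/n}`; by Campanato's
argument the means `⟨|b|⟩_B` converge as `B` shrinks, and their limit is a nonnegative element of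
`Λ_β` equal to `b` almost everywhere.
-/

namespace PadicVar

open Filter Topology

variable {p : ℕ} [Fact p.Prime] {n : ℕ}

/-! ### Balls and their measure -/

lemma one_lt_prime_real (p : ℕ) [Fact p.Prime] : (1 : ℝ) < p := by
  exact_mod_cast (Fact.out : p.Prime).one_lt

lemma prime_real_pos (p : ℕ) [Fact p.Prime] : (0 : ℝ) < p :=
  zero_lt_one.trans (one_lt_prime_real p)

lemma prime_ne_zero (p : ℕ) [Fact p.Prime] : (p : ℝ≥0∞) ≠ 0 := by
  exact_mod_cast (Fact.out : p.Prime).ne_zero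

lemma one_le_prime (p : ℕ) [Fact p.Prime] : 1 ≤ (p : ℝ≥0∞) := by
  exact_mod_cast (Fact.out : p.Prime).one_lt.le

lemma zpow_prime_pos (γ : ℤ) : 0 < (p : ℝ) ^ γ := zpow_pos (prime_real_pos p) γ

lemma mem_pball {γ : ℤ} {x y : Qpn p n} : y ∈ pball γ x ↔ ‖y - x‖ ≤ (p : ℝ) ^ γ := by
  rw [pball, Metric.mem_closedBall, dist_eq_norm]

lemma mem_pball_comm {γ : ℤ} {x y : Qpn p n} : y ∈ pball γ x ↔ x ∈ pball γ y :=
  Metric.mem_closedBall_comm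

lemma pball_eq_of_mem {γ : ℤ} {x y : Qpn p n} (h : y ∈ pball γ x) : pball γ y = pball γ x :=
  (IsUltrametricDist.closedBall_eq_of_mem h).symm

lemma pball_mono {γ γ' : ℤ} (h : γ ≤ γ') (x : Qpn p n) : pball γ x ⊆ pball γ' x :=
  Metric.closedBall_subset_closedBall (zpow_le_zpow_right₀ (one_lt_prime_real p).le h)

lemma isCompact_pball (γ : ℤ) (x : Qpn p n) : IsCompact (pball γ x) := isCompact_closedBall _ _

lemma measurableSet_pball (γ : ℤ) (x : Qpn p n) : MeasurableSet (pball γ x) :=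
  Metric.isClosed_closedBall.measurableSet

lemma pball_mem_nhds (γ : ℤ) (x : Qpn p n) : pball γ x ∈ 𝓝 x :=
  Metric.closedBall_mem_nhds x (zpow_prime_pos γ)

lemma norm_zpow_mul_le_zpow_iff {γ : ℤ} {u : ℚ_[p]} :
    ‖(p : ℚ_[p]) ^ (-(γ + 1)) * u‖ ≤ (p : ℝ) ^ γ ↔ ‖u‖ < 1 := by
  rw [Padic.norm_le_pow_iff_norm_lt_pow_add_one, norm_mul, Padic.norm_p_zpow, neg_neg,
    mul_lt_iff_lt_one_right (zpow_prime_pos _)]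

lemma exists_norm_sub_zpow_mul_le {γ : ℤ} {t : ℚ_[p]} (ht : ‖t‖ ≤ (p : ℝ) ^ (γ + 1)) :
    ∃ i : Fin p, ‖t - (p : ℚ_[p]) ^ (-(γ + 1)) * ((i : ℕ) : ℚ_[p])‖ ≤ (p : ℝ) ^ γ := by
  have hp0 : (p : ℚ_[p]) ≠ 0 := by exact_mod_cast (Fact.out : p.Prime).ne_zero
  have hunit : ‖(p : ℚ_[p]) ^ (γ + 1) * t‖ ≤ 1 := by
    rwa [norm_mul, Padic.norm_p_zpow, zpow_neg, inv_mul_le_iff₀ (zpow_prime_pos _), mul_one]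
  let z : ℤ_[p] := ⟨_, hunit⟩
  have hdigit : ‖z - (z.zmodRepr : ℤ_[p])‖ < 1 := PadicInt.mem_nonunits.1 z.sub_zmodRepr_mem
  refine ⟨⟨z.zmodRepr, z.zmodRepr_lt_p⟩, ?_⟩
  have ht_eq : t = (p : ℚ_[p]) ^ (-(γ + 1)) * (z : ℚ_[p]) := by
    rw [← mul_assoc, ← zpow_add₀ hp0, neg_add_cancel, zpow_zero, one_mul]
  rw [ht_eq, ← mul_sub, norm_zpow_mul_le_zpow_iff]
  simpa only [PadicInt.norm_def, PadicInt.coe_sub, PadicInt.coe_natCast] using hdigit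

lemma eq_of_norm_zpow_mul_sub_le {γ : ℤ} {i j : Fin p}
    (h : ‖(p : ℚ_[p]) ^ (-(γ + 1)) * ((i : ℕ) : ℚ_[p])
      - (p : ℚ_[p]) ^ (-(γ + 1)) * ((j : ℕ) : ℚ_[p])‖ ≤ (p : ℝ) ^ γ) : i = j := by
  rw [← mul_sub, norm_zpow_mul_le_zpow_iff] at h
  have hdigits : ‖((((i : ℕ) : ℤ) - ((j : ℕ) : ℤ) : ℤ) : ℚ_[p])‖ < 1 := by
    simpa only [Int.cast_sub, Int.cast_natCast] using h
  rw [Padic.norm_intCast_lt_one_iff] at hdigits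
  have hmod : (j : ℕ) ≡ (i : ℕ) [MOD p] := Int.natCast_modEq_iff.1 (Int.modEq_iff_dvd.2 hdigits)
  exact Fin.ext (hmod.eq_of_lt_of_lt j.2 i.2).symm

/-- The centres of the `p ^ n` balls of radius `p ^ γ` that make up `pball (γ + 1) a`; they are
indexed by the leading `p`-adic digits of the coordinates of a point relative to `a`. -/
noncomputable def subcenter (γ : ℤ) (a : Qpn p n) (i : Fin n → Fin p) : Qpn p n :=
  a + fun j => (p : ℚ_[p]) ^ (-(γ + 1)) * ((i j : ℕ) : ℚ_[p])

lemma pball_succ_eq_iUnion (γ : ℤ) (a : Qpn p n) :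
    pball (γ + 1) a = ⋃ i : Fin n → Fin p, pball γ (subcenter γ a i) := by
  ext y
  rw [Set.mem_iUnion]
  constructor
  · intro hy
    rw [mem_pball, pi_norm_le_iff_of_nonneg (zpow_prime_pos _).le] at hy
    choose i hi using fun j => exists_norm_sub_zpow_mul_le (hy j)
    refine ⟨i, mem_pball.2 ((pi_norm_le_iff_of_nonneg (zpow_prime_pos _).le).2 fun j => ?_)⟩
    simpa only [subcenter, Pi.sub_apply, Pi.add_apply, sub_sub] using hi j
  · rintro ⟨i, hi⟩
    have hcenter : subcenter γ a i ∈ pball (γ + 1) a := by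
      rw [mem_pball, subcenter, add_sub_cancel_left,
        pi_norm_le_iff_of_nonneg (zpow_prime_pos _).le]
      intro j
      rw [norm_mul, Padic.norm_p_zpow, neg_neg]
      refine mul_le_of_le_one_right (zpow_prime_pos _).le ?_
      exact_mod_cast Padic.norm_int_le_one (p := p) ((i j : ℕ) : ℤ)
    rw [← pball_eq_of_mem hcenter]
    exact pball_mono (by lia) _ hi

lemma pairwise_disjoint_pball_subcenter (γ : ℤ) (a : Qpn p n) :
    Pairwise (Function.onFun Disjoint fun i => pball γ (subcenter γ a i)) := by
  intro i i' hne
  rw [Function.onFun, Set.disjoint_left]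
  refine fun y hy hy' => hne (funext fun j => ?_)
  have hcenters := mem_pball.1 (pball_eq_of_mem hy' ▸ mem_pball_comm.1 hy)
  rw [subcenter, subcenter, add_sub_add_left_eq_sub,
    pi_norm_le_iff_of_nonneg (zpow_prime_pos _).le] at hcenters
  exact eq_of_norm_zpow_mul_sub_le (hcenters j)

instance instIsAddHaarMeasureHaar : (haar p n).IsAddHaarMeasure :=
  inferInstanceAs (Measure.addHaarMeasure (unitBall p n)).IsAddHaarMeasure

lemma haar_pball_eq_center (γ : ℤ) (x : Qpn p n) :
    haar p n (pball γ x) = haar p n (pball γ 0) :=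
  Measure.addHaar_closedBall_center _ x _

lemma haar_pball_succ (γ : ℤ) (x : Qpn p n) :
    haar p n (pball (γ + 1) x) = (p : ℝ≥0∞) ^ (n : ℝ) * haar p n (pball γ x) := by
  rw [pball_succ_eq_iUnion, measure_iUnion (pairwise_disjoint_pball_subcenter γ x)
    fun i => measurableSet_pball _ _, tsum_fintype]
  simp_rw [haar_pball_eq_center γ]
  simp

/-- The number `p ^ (n γ)`, the measure of a ball of radius `p ^ γ`. It is written as a real power
because it is mostly raised to real exponents. -/
noncomputable def ballVol (p n : ℕ) (γ : ℤ) : ℝ≥0∞ := (p : ℝ≥0∞) ^ ((n : ℝ) * γ)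

lemma ballVol_zero (p n : ℕ) : ballVol p n 0 = 1 := by simp [ballVol]

lemma ballVol_succ (γ : ℤ) : ballVol p n (γ + 1) = (p : ℝ≥0∞) ^ (n : ℝ) * ballVol p n γ := by
  rw [ballVol, ballVol, ← ENNReal.rpow_add _ _ (prime_ne_zero p) (ENNReal.natCast_ne_top p)]
  congr 1
  push_cast
  ring

lemma haar_pball (γ : ℤ) (x : Qpn p n) : haar p n (pball γ x) = ballVol p n γ := by
  rw [haar_pball_eq_center]
  induction γ using Int.induction_on with
  | zero =>
    have hunit : pball 0 (0 : Qpn p n) = (unitBall p n : Set (Qpn p n)) := by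
      rw [pball, zpow_zero]
      rfl
    rw [hunit, ballVol_zero]
    exact Measure.addHaarMeasure_self
  | succ k ih => rw [haar_pball_succ, ih, ballVol_succ]
  | pred k ih =>
    have hstep := haar_pball_succ (-(k : ℤ) - 1) (0 : Qpn p n)
    have hvol := ballVol_succ (p := p) (n := n) (-(k : ℤ) - 1)
    rw [sub_add_cancel] at hstep hvol
    rw [ih, hvol] at hstep
    have hc0 : (p : ℝ≥0∞) ^ (n : ℝ) ≠ 0 := by simp [(Fact.out : p.Prime).ne_zero]
    have hct : (p : ℝ≥0∞) ^ (n : ℝ) ≠ ∞ := by simp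
    exact ((ENNReal.mul_right_inj hc0 hct).1 hstep).symm

variable (p n) in
lemma ballVol_ne_zero (γ : ℤ) : ballVol p n γ ≠ 0 :=
  (ENNReal.rpow_pos (pos_iff_ne_zero.2 (prime_ne_zero p)) (ENNReal.natCast_ne_top p)).ne'

variable (p n) in
lemma ballVol_ne_top (γ : ℤ) : ballVol p n γ ≠ ∞ :=
  ENNReal.rpow_ne_top_of_ne_zero (prime_ne_zero p) (ENNReal.natCast_ne_top p)

variable (p n) in
lemma ballVol_rpow_ne_zero (γ : ℤ) (s : ℝ) : ballVol p n γ ^ s ≠ 0 :=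
  (ENNReal.rpow_pos (pos_iff_ne_zero.2 (ballVol_ne_zero p n γ)) (ballVol_ne_top p n γ)).ne'

variable (p n) in
lemma ballVol_rpow_ne_top (γ : ℤ) (s : ℝ) : ballVol p n γ ^ s ≠ ∞ :=
  ENNReal.rpow_ne_top_of_ne_zero (ballVol_ne_zero p n γ) (ballVol_ne_top p n γ)

variable (p n) in
lemma ballVol_mono {γ γ' : ℤ} (h : γ ≤ γ') : ballVol p n γ ≤ ballVol p n γ' := by
  apply ENNReal.rpow_le_rpow_of_exponent_le (one_le_prime p)
  gcongr

lemma natCast_le_ballVol (hn : 0 < n) (k : ℕ) : (k : ℝ≥0∞) ≤ ballVol p n k := by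
  have hvol : ballVol p n k = ((p ^ (n * k) : ℕ) : ℝ≥0∞) := by
    rw [ballVol, Int.cast_natCast, ← Nat.cast_mul, ENNReal.rpow_natCast, Nat.cast_pow]
  rw [hvol]
  exact_mod_cast (Nat.le_mul_of_pos_left k hn).trans
    (Nat.lt_pow_self (Fact.out : p.Prime).one_lt).le

/-! ### Averages over balls and the Hardy–Littlewood maximal function -/

/-- The average of `F` over the ball `B_γ(x)`. -/
noncomputable def ballAvg (γ : ℤ) (F : Qpn p n → ℝ≥0∞) (x : Qpn p n) : ℝ≥0∞ :=
  (∫⁻ y in pball γ x, F y ∂(haar p n)) / ballVol p n γ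

/-- The Hardy–Littlewood maximal function over balls centred at the point. -/
noncomputable def hlMax (F : Qpn p n → ℝ≥0∞) (x : Qpn p n) : ℝ≥0∞ := ⨆ γ : ℤ, ballAvg γ F x

lemma ballAvg_le_hlMax (γ : ℤ) (F : Qpn p n → ℝ≥0∞) (x : Qpn p n) :
    ballAvg γ F x ≤ hlMax F x := le_iSup (fun γ => ballAvg γ F x) γ

lemma ballAvg_mul_ballVol (γ : ℤ) (F : Qpn p n → ℝ≥0∞) (x : Qpn p n) :
    ballAvg γ F x * ballVol p n γ = ∫⁻ y in pball γ x, F y ∂(haar p n) :=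
  ENNReal.div_mul_cancel (ballVol_ne_zero p n γ) (ballVol_ne_top p n γ)

lemma ballAvg_eq_of_mem {γ γ' : ℤ} (h : γ ≤ γ') (F : Qpn p n → ℝ≥0∞) {x y : Qpn p n}
    (hy : y ∈ pball γ x) : ballAvg γ' F y = ballAvg γ' F x := by
  rw [ballAvg, ballAvg, pball_eq_of_mem (pball_mono h x hy)]

lemma isLocallyConstant_ballAvg (γ : ℤ) (F : Qpn p n → ℝ≥0∞) :
    IsLocallyConstant (ballAvg γ F) := by
  rw [IsLocallyConstant.iff_eventually_eq]
  intro x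
  filter_upwards [pball_mem_nhds γ x] with y hy
  exact ballAvg_eq_of_mem le_rfl F hy

lemma measurable_ballAvg (γ : ℤ) (F : Qpn p n → ℝ≥0∞) : Measurable (ballAvg γ F) :=
  (isLocallyConstant_ballAvg γ F).continuous.measurable

lemma measurable_hlMax (F : Qpn p n → ℝ≥0∞) : Measurable (hlMax F) :=
  Measurable.iSup fun γ => measurable_ballAvg γ F

lemma ballAvg_mono_ae {γ : ℤ} {F G : Qpn p n → ℝ≥0∞} {x : Qpn p n}
    (h : ∀ᵐ y ∂((haar p n).restrict (pball γ x)), F y ≤ G y) : ballAvg γ F x ≤ ballAvg γ G x :=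
  ENNReal.div_le_div_right (lintegral_mono_ae h) _

lemma ballAvg_mono {F G : Qpn p n → ℝ≥0∞} (h : F ≤ G) (γ : ℤ) (x : Qpn p n) :
    ballAvg γ F x ≤ ballAvg γ G x := ballAvg_mono_ae (Eventually.of_forall h)

lemma ballAvg_congr_ae {F G : Qpn p n → ℝ≥0∞} (h : F =ᵐ[haar p n] G) (γ : ℤ) (x : Qpn p n) :
    ballAvg γ F x = ballAvg γ G x := by
  rw [ballAvg, ballAvg, lintegral_congr_ae (ae_restrict_of_ae h)]

lemma ballAvg_add {F G : Qpn p n → ℝ≥0∞} (hF : AEMeasurable F (haar p n)) (γ : ℤ) (x : Qpn p n) :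
    ballAvg γ (fun y => F y + G y) x = ballAvg γ F x + ballAvg γ G x := by
  rw [ballAvg, lintegral_add_left' hF.restrict, ENNReal.add_div]
  rfl

lemma ballAvg_const (c : ℝ≥0∞) (γ : ℤ) (x : Qpn p n) : ballAvg γ (fun _ => c) x = c := by
  rw [ballAvg, setLIntegral_const, haar_pball]
  exact ENNReal.mul_div_cancel_right (ballVol_ne_zero p n γ) (ballVol_ne_top p n γ)

lemma ballAvg_le_lintegral_div (γ : ℤ) (F : Qpn p n → ℝ≥0∞) (x : Qpn p n) :
    ballAvg γ F x ≤ (∫⁻ y, F y ∂(haar p n)) / ballVol p n γ :=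
  ENNReal.div_le_div_right (setLIntegral_le_lintegral _ _) _

lemma hlMax_mono {F G : Qpn p n → ℝ≥0∞} (h : F ≤ G) (x : Qpn p n) : hlMax F x ≤ hlMax G x :=
  iSup_mono fun γ => ballAvg_mono h γ x

lemma hlMax_add_const_le {F : Qpn p n → ℝ≥0∞} (c : ℝ≥0∞) (x : Qpn p n) :
    hlMax (fun y => c + F y) x ≤ c + hlMax F x := by
  refine iSup_le fun γ => ?_
  rw [ballAvg_add aemeasurable_const, ballAvg_const]
  gcongr
  exact ballAvg_le_hlMax γ F x

lemma ballAvg_rpow_le {F : Qpn p n → ℝ≥0∞} (hF : AEMeasurable F (haar p n)) {t : ℝ} (ht : 1 ≤ t)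
    (γ : ℤ) (x : Qpn p n) : ballAvg γ F x ^ t ≤ ballAvg γ (fun y => F y ^ t) x := by
  have ht0 : 0 < t := zero_lt_one.trans_le ht
  let ν : Measure (Qpn p n) := (ballVol p n γ)⁻¹ • (haar p n).restrict (pball γ x)
  have : IsProbabilityMeasure ν := ⟨by
    simp only [ν, Measure.smul_apply, Measure.restrict_apply_univ, haar_pball, smul_eq_mul]
    exact ENNReal.inv_mul_cancel (ballVol_ne_zero p n γ) (ballVol_ne_top p n γ)⟩
  have hν : ∀ G : Qpn p n → ℝ≥0∞, ∫⁻ y, G y ∂ν = ballAvg γ G x := fun G => by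
    rw [lintegral_smul_measure, smul_eq_mul, mul_comm]
    rfl
  have hjensen := eLpNorm'_le_eLpNorm'_of_exponent_le zero_lt_one ht ν
    (hF.restrict.smul_measure _).aestronglyMeasurable
  simp only [eLpNorm', enorm_eq_self, ENNReal.rpow_one, div_one, hν] at hjensen
  rwa [one_div, ENNReal.le_rpow_inv_iff ht0] at hjensen

lemma lintegral_ballAvg {F : Qpn p n → ℝ≥0∞} (hF : AEMeasurable F (haar p n)) (γ : ℤ) :
    ∫⁻ x, ballAvg γ F x ∂(haar p n) = ∫⁻ x, F x ∂(haar p n) := by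
  have hclosed : IsClosed {z : Qpn p n × Qpn p n | z.2 ∈ pball γ z.1} := by
    simp only [mem_pball]
    exact isClosed_le (by fun_prop) continuous_const
  have hmeas : AEMeasurable (Function.uncurry fun x y => (pball γ x).indicator F y)
      ((haar p n).prod (haar p n)) := hF.comp_snd.indicator hclosed.measurableSet
  have hsymm : ∀ x y, (pball γ x).indicator F y = (pball γ y).indicator (fun _ => F y) x := by
    intro x y
    by_cases h : y ∈ pball γ x
    · rw [Set.indicator_of_mem h, Set.indicator_of_mem (mem_pball_comm.1 h)]
    · rw [Set.indicator_of_notMem h, Set.indicator_of_notMem (mt mem_pball_comm.1 h)]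
  refine (ENNReal.mul_left_inj (ballVol_ne_zero p n γ) (ballVol_ne_top p n γ)).1 ?_
  calc (∫⁻ x, ballAvg γ F x ∂(haar p n)) * ballVol p n γ
      = ∫⁻ x, ∫⁻ y, (pball γ x).indicator F y ∂(haar p n) ∂(haar p n) := by
        rw [← lintegral_mul_const' _ _ (ballVol_ne_top p n γ)]
        refine lintegral_congr fun x => ?_
        rw [ballAvg_mul_ballVol, lintegral_indicator (measurableSet_pball γ x)]
    _ = ∫⁻ y, ∫⁻ x, (pball γ y).indicator (fun _ => F y) x ∂(haar p n) ∂(haar p n) := by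
        rw [lintegral_lintegral_swap hmeas]
        simp only [hsymm]
    _ = (∫⁻ y, F y ∂(haar p n)) * ballVol p n γ := by
        rw [← lintegral_mul_const' _ _ (ballVol_ne_top p n γ)]
        refine lintegral_congr fun y => ?_
        rw [lintegral_indicator_const (measurableSet_pball γ y), haar_pball]

lemma setLIntegral_ballAvg {F : Qpn p n → ℝ≥0∞} (hF : AEMeasurable F (haar p n)) {γ : ℤ}
    {E : Set (Qpn p n)} (hE : MeasurableSet E) (hinv : ∀ x ∈ E, pball γ x ⊆ E) :
    ∫⁻ x in E, ballAvg γ F x ∂(haar p n) = ∫⁻ x in E, F x ∂(haar p n) := by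
  have hindicator : E.indicator (ballAvg γ F) = ballAvg γ (E.indicator F) := by
    funext x
    rw [ballAvg, setLIntegral_indicator hE]
    by_cases hx : x ∈ E
    · rw [Set.indicator_of_mem hx, Set.inter_eq_right.2 (hinv x hx)]
      rfl
    · have hempty : E ∩ pball γ x = ∅ := Set.disjoint_iff_inter_eq_empty.1 <|
        Set.disjoint_left.2 fun y hy hyx => hx (hinv y hy (mem_pball_comm.1 hyx))
      rw [Set.indicator_of_notMem hx, hempty, setLIntegral_empty, ENNReal.zero_div]
  rw [← lintegral_indicator hE, hindicator, lintegral_ballAvg (hF.indicator hE),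
    lintegral_indicator hE]

/-- The points at which `γ` is the largest scale whose average of `F` exceeds `l`. These sets are
the analogue of the stopping cubes of a Calderón–Zygmund decomposition. -/
def stoppingSet (F : Qpn p n → ℝ≥0∞) (l : ℝ≥0∞) (γ : ℤ) : Set (Qpn p n) :=
  {x | l < ballAvg γ F x ∧ ∀ γ' > γ, ballAvg γ' F x ≤ l}

lemma measurableSet_stoppingSet (F : Qpn p n → ℝ≥0∞) (l : ℝ≥0∞) (γ : ℤ) :
    MeasurableSet (stoppingSet F l γ) := by
  have h : stoppingSet F l γ
      = {x | l < ballAvg γ F x} ∩ ⋂ γ' > γ, {x | ballAvg γ' F x ≤ l} := by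
    ext x
    simp [stoppingSet]
  rw [h]
  exact (measurableSet_lt measurable_const (measurable_ballAvg γ F)).inter
    (MeasurableSet.iInter fun γ' => MeasurableSet.iInter fun _ =>
      measurableSet_le (measurable_ballAvg γ' F) measurable_const)

lemma pball_subset_stoppingSet {F : Qpn p n → ℝ≥0∞} {l : ℝ≥0∞} {γ : ℤ} {x : Qpn p n}
    (hx : x ∈ stoppingSet F l γ) : pball γ x ⊆ stoppingSet F l γ := by
  refine fun y hy => ⟨?_, fun γ' hγ' => ?_⟩
  · rw [ballAvg_eq_of_mem le_rfl F hy]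
    exact hx.1
  · rw [ballAvg_eq_of_mem (le_of_lt hγ') F hy]
    exact hx.2 γ' hγ'

lemma pairwise_disjoint_stoppingSet (F : Qpn p n → ℝ≥0∞) (l : ℝ≥0∞) :
    Pairwise (Function.onFun Disjoint (stoppingSet F l)) := by
  intro γ γ' hne
  rw [Function.onFun, Set.disjoint_left]
  intro x hx hx'
  rcases lt_or_gt_of_ne hne with h | h
  · exact (hx.2 γ' h).not_gt hx'.1
  · exact (hx'.2 γ h).not_gt hx.1

lemma setOf_lt_hlMax_subset_iUnion_stoppingSet (hn : 0 < n) {F : Qpn p n → ℝ≥0∞}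
    (hF : ∫⁻ x, F x ∂(haar p n) ≠ ∞) {l : ℝ≥0∞} (hl : l ≠ 0) :
    {x | l < hlMax F x} ⊆ ⋃ γ, stoppingSet F l γ := by
  intro x hx
  obtain ⟨γ₀, hγ₀⟩ := lt_iSup_iff.1 (show l < ⨆ γ, ballAvg γ F x from hx)
  obtain ⟨N, hN⟩ := ENNReal.exists_nat_gt (ENNReal.div_ne_top hF hl)
  have hbdd : ∀ γ : ℤ, l < ballAvg γ F x → γ ≤ N := fun γ hγ => by
    by_contra! hlt
    have hvol : (∫⁻ x, F x ∂(haar p n)) / l ≤ ballVol p n γ :=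
      hN.le.trans ((natCast_le_ballVol hn N).trans (ballVol_mono p n hlt.le))
    refine (hγ.trans_le (ballAvg_le_lintegral_div γ F x)).not_ge (ENNReal.div_le_of_le_mul ?_)
    rw [mul_comm]
    exact (ENNReal.div_le_iff_le_mul (Or.inl hl) (Or.inr (ballVol_ne_zero p n γ))).1 hvol
  obtain ⟨γ, hγ, hmax⟩ := Int.exists_greatest_of_bdd ⟨N, hbdd⟩ ⟨γ₀, hγ₀⟩
  refine Set.mem_iUnion.2 ⟨γ, hγ, fun γ' hγ' => ?_⟩
  by_contra! h
  exact (hmax γ' h).not_gt hγ'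

lemma mul_haar_lt_hlMax_le (hn : 0 < n) {F : Qpn p n → ℝ≥0∞} (hF : AEMeasurable F (haar p n))
    {l : ℝ≥0∞} (hl : l ≠ 0) :
    l * haar p n {x | l < hlMax F x} ≤ ∫⁻ x, F x ∂(haar p n) := by
  rcases eq_or_ne (∫⁻ x, F x ∂(haar p n)) ∞ with hI | hI
  · exact hI ▸ le_top
  calc l * haar p n {x | l < hlMax F x} ≤ l * ∑' γ, haar p n (stoppingSet F l γ) := by
        gcongr
        exact (measure_mono (setOf_lt_hlMax_subset_iUnion_stoppingSet hn hI hl)).trans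
          (measure_iUnion_le _)
    _ = ∑' γ, l * haar p n (stoppingSet F l γ) := ENNReal.tsum_mul_left.symm
    _ ≤ ∑' γ, ∫⁻ x in stoppingSet F l γ, F x ∂(haar p n) := by
        refine ENNReal.tsum_le_tsum fun γ => ?_
        have hE := measurableSet_stoppingSet F l γ
        rw [← setLIntegral_ballAvg hF hE fun _ => pball_subset_stoppingSet, ← setLIntegral_const]
        exact setLIntegral_mono' hE fun x hx => hx.1.le
    _ = ∫⁻ x in ⋃ γ, stoppingSet F l γ, F x ∂(haar p n) :=
        (lintegral_iUnion (measurableSet_stoppingSet F l)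
          (pairwise_disjoint_stoppingSet F l) F).symm
    _ ≤ ∫⁻ x, F x ∂(haar p n) := setLIntegral_le_lintegral _ _

lemma ae_hlMax_lt_top (hn : 0 < n) {F : Qpn p n → ℝ≥0∞} (hF : AEMeasurable F (haar p n))
    (hI : ∫⁻ x, F x ∂(haar p n) ≠ ∞) : ∀ᵐ x ∂(haar p n), hlMax F x < ∞ := by
  rw [ae_iff]
  refine le_antisymm (ENNReal.le_of_forall_pos_le_add fun ε hε _ => ?_) zero_le
  have hε0 : (ε : ℝ≥0∞) ≠ 0 := by exact_mod_cast hε.ne'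
  obtain ⟨N, hN⟩ := ENNReal.exists_nat_gt (ENNReal.div_ne_top hI hε0)
  have hN0 : (N : ℝ≥0∞) ≠ 0 := (zero_le.trans_lt hN).ne'
  have hsubset : {x | ¬ hlMax F x < ∞} ⊆ {x | (N : ℝ≥0∞) < hlMax F x} := fun x hx =>
    (ENNReal.natCast_lt_top N).trans_le (not_lt.1 hx)
  have hmul : N * haar p n {x | (N : ℝ≥0∞) < hlMax F x} ≤ N * ε :=
    (mul_haar_lt_hlMax_le hn hF hN0).trans
      ((ENNReal.div_le_iff_le_mul (Or.inl hε0) (Or.inr hN0)).1 hN.le)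
  rw [zero_add]
  exact (measure_mono hsubset).trans
    ((ENNReal.mul_le_mul_iff_right hN0 (ENNReal.natCast_ne_top N)).1 hmul)

section Marcinkiewicz

variable {X : Type*} [MeasurableSpace X] {μ : Measure X}

lemma setLIntegral_ofReal_rpow_le {a : ℝ} (ha : -1 < a) (c : ℝ≥0∞) :
    ∫⁻ l in Set.Ioi (0 : ℝ) ∩ {l | ENNReal.ofReal l < c}, ENNReal.ofReal (l ^ a) ≤
      ENNReal.ofReal (a + 1)⁻¹ * c ^ (a + 1) := by
  have ha1 : 0 < a + 1 := by linarith
  rcases eq_or_ne c ∞ with rfl | hc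
  · rw [ENNReal.top_rpow_of_pos ha1, ENNReal.mul_top (by simpa using ha1)]
    exact le_top
  lift c to ℝ≥0 using hc
  have hset : Set.Ioi (0 : ℝ) ∩ {l | ENNReal.ofReal l < c} = Set.Ioo 0 (c : ℝ) := by
    ext l
    refine and_congr_right fun hl => ?_
    rw [Set.mem_ofPred_eq, ← ENNReal.ofReal_coe_nnreal, ENNReal.ofReal_lt_ofReal_iff']
    exact and_iff_left_of_imp fun h => lt_trans hl h
  have hrpow : IntegrableOn (fun l : ℝ => l ^ a) (Set.Ioo 0 c) := by
    rw [← intervalIntegrable_iff_integrableOn_Ioo_of_le c.coe_nonneg]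
    exact intervalIntegral.intervalIntegrable_rpow' ha
  have hnonneg : ∀ᵐ l ∂volume.restrict (Set.Ioo (0 : ℝ) c), 0 ≤ l ^ a := by
    filter_upwards [ae_restrict_mem measurableSet_Ioo] with l hl
    exact Real.rpow_nonneg hl.1.le _
  rw [hset, ← ofReal_integral_eq_lintegral_ofReal hrpow hnonneg, ← integral_Ioc_eq_integral_Ioo,
    ← intervalIntegral.integral_of_le c.coe_nonneg, integral_rpow (Or.inl ha),
    Real.zero_rpow ha1.ne', sub_zero, div_eq_inv_mul, ENNReal.ofReal_mul (by positivity),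
    ← ENNReal.ofReal_rpow_of_nonneg c.coe_nonneg ha1.le, ENNReal.ofReal_coe_nnreal]

lemma lintegral_rpow_eq_lintegral_meas_ofReal_lt_mul {g : X → ℝ≥0∞} (hg : AEMeasurable g μ)
    (hfin : ∀ᵐ x ∂μ, g x < ∞) {t : ℝ} (ht : 0 < t) :
    ∫⁻ x, g x ^ t ∂μ = ENNReal.ofReal t *
      ∫⁻ l in Set.Ioi (0 : ℝ), μ {x | ENNReal.ofReal l < g x} * ENNReal.ofReal (l ^ (t - 1)) := by
  have htoReal : ∫⁻ x, g x ^ t ∂μ = ∫⁻ x, ENNReal.ofReal ((g x).toReal ^ t) ∂μ := by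
    refine lintegral_congr_ae ?_
    filter_upwards [hfin] with x hx
    rw [← ENNReal.ofReal_rpow_of_nonneg ENNReal.toReal_nonneg ht.le, ENNReal.ofReal_toReal hx.ne]
  rw [htoReal, lintegral_rpow_eq_lintegral_meas_lt_mul _
    (Eventually.of_forall fun x => ENNReal.toReal_nonneg) hg.ennreal_toReal ht]
  congr 1
  refine setLIntegral_congr_fun measurableSet_Ioi fun l hl => ?_
  congr 1
  refine measure_congr ?_
  filter_upwards [hfin] with x hx
  exact propext (ENNReal.ofReal_lt_iff_lt_toReal (le_of_lt hl) hx.ne).symm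

lemma lintegral_rpow_mul_setLIntegral_le [SFinite μ] {F : X → ℝ≥0∞} (hF : AEMeasurable F μ) {t : ℝ}
    (ht : 1 < t) (c : ℝ≥0∞) :
    ∫⁻ l in Set.Ioi (0 : ℝ),
        ENNReal.ofReal (l ^ (t - 2)) * ∫⁻ x in {x | ENNReal.ofReal l < c * F x}, F x ∂μ ≤
      ENNReal.ofReal (t - 1)⁻¹ * c ^ (t - 1) * ∫⁻ x, F x ^ t ∂μ := by
  have ht1 : 0 < t - 1 := sub_pos.2 ht
  let k : ℝ × X → ℝ≥0∞ := {z | ENNReal.ofReal z.1 < c * F z.2}.indicator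
    fun z => ENNReal.ofReal (z.1 ^ (t - 2)) * F z.2
  have hk : AEMeasurable k ((volume.restrict (Set.Ioi 0)).prod μ) :=
    ((by fun_prop : Measurable fun z : ℝ × X =>
      ENNReal.ofReal (z.1 ^ (t - 2))).aemeasurable.mul hF.comp_snd).indicator₀
        (nullMeasurableSet_lt (by fun_prop) (hF.comp_snd.const_mul c))
  have hinner : ∀ x, ∫⁻ l in Set.Ioi (0 : ℝ), k (l, x) ≤
      ENNReal.ofReal (t - 1)⁻¹ * c ^ (t - 1) * F x ^ t := fun x => by
    have hkx : ∀ l, k (l, x) = {l : ℝ | ENNReal.ofReal l < c * F x}.indicator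
        (fun l => ENNReal.ofReal (l ^ (t - 2)) * F x) l := fun l => rfl
    have hmeas : MeasurableSet {l : ℝ | ENNReal.ofReal l < c * F x} :=
      measurableSet_lt (by fun_prop) measurable_const
    have hFt : F x ^ t = F x ^ (t - 1) * F x := by
      conv_lhs => rw [← sub_add_cancel t 1]
      rw [ENNReal.rpow_add_of_nonneg _ _ ht1.le zero_le_one, ENNReal.rpow_one]
    have hpow := setLIntegral_ofReal_rpow_le (a := t - 2) (by linarith) (c * F x)
    rw [show t - 2 + 1 = t - 1 by ring, ENNReal.mul_rpow_of_nonneg _ _ ht1.le] at hpow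
    simp_rw [hkx]
    rw [setLIntegral_indicator hmeas, Set.inter_comm, lintegral_mul_const _ (by fun_prop), hFt,
      ← mul_assoc, mul_assoc (ENNReal.ofReal _)]
    gcongr
  calc ∫⁻ l in Set.Ioi (0 : ℝ),
        ENNReal.ofReal (l ^ (t - 2)) * ∫⁻ x in {x | ENNReal.ofReal l < c * F x}, F x ∂μ
      = ∫⁻ l in Set.Ioi (0 : ℝ), ∫⁻ x, k (l, x) ∂μ := by
        refine lintegral_congr fun l => ?_
        rw [← lintegral_const_mul' _ _ ENNReal.ofReal_ne_top, ← lintegral_indicator₀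
          (nullMeasurableSet_lt aemeasurable_const (hF.const_mul c))]
        rfl
    _ = ∫⁻ x, (∫⁻ l in Set.Ioi (0 : ℝ), k (l, x)) ∂μ :=
        lintegral_lintegral_swap (f := fun l x => k (l, x)) hk
    _ ≤ ∫⁻ x, ENNReal.ofReal (t - 1)⁻¹ * c ^ (t - 1) * F x ^ t ∂μ := lintegral_mono hinner
    _ = ENNReal.ofReal (t - 1)⁻¹ * c ^ (t - 1) * ∫⁻ x, F x ^ t ∂μ :=
        lintegral_const_mul'' _ (hF.pow_const t)

lemma lintegral_rpow_le_of_weak_type [SFinite μ] {g F : X → ℝ≥0∞} (hg : AEMeasurable g μ)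
    (hF : AEMeasurable F μ) (hfin : ∀ᵐ x ∂μ, g x < ∞) {c : ℝ≥0∞} (hc : c ≠ ∞)
    (hweak : ∀ l ≠ 0, l * μ {x | l < g x} ≤ c * ∫⁻ x in {x | l < c * F x}, F x ∂μ)
    {t : ℝ} (ht : 1 < t) :
    ∫⁻ x, g x ^ t ∂μ ≤
      ENNReal.ofReal t * c * (ENNReal.ofReal (t - 1)⁻¹ * c ^ (t - 1)) * ∫⁻ x, F x ^ t ∂μ := by
  have hlevel : ∀ l ∈ Set.Ioi (0 : ℝ), μ {x | ENNReal.ofReal l < g x} * ENNReal.ofReal (l ^ (t - 1))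
      ≤ c * (ENNReal.ofReal (l ^ (t - 2)) * ∫⁻ x in {x | ENNReal.ofReal l < c * F x}, F x ∂μ) := by
    intro l hl
    have hl0 : 0 < l := hl
    have hsplit : ENNReal.ofReal (l ^ (t - 1))
        = ENNReal.ofReal (l ^ (t - 2)) * ENNReal.ofReal l := by
      rw [← ENNReal.ofReal_mul (Real.rpow_nonneg hl0.le _), ← Real.rpow_add_one hl0.ne']
      congr 2
      ring
    calc μ {x | ENNReal.ofReal l < g x} * ENNReal.ofReal (l ^ (t - 1))
        = ENNReal.ofReal (l ^ (t - 2)) * (ENNReal.ofReal l * μ {x | ENNReal.ofReal l < g x}) := by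
          rw [hsplit, mul_comm, mul_assoc]
      _ ≤ ENNReal.ofReal (l ^ (t - 2)) *
          (c * ∫⁻ x in {x | ENNReal.ofReal l < c * F x}, F x ∂μ) := by
          gcongr ENNReal.ofReal (l ^ (t - 2)) * ?_
          exact hweak _ (ENNReal.ofReal_pos.2 hl0).ne'
      _ = _ := mul_left_comm _ _ _
  rw [lintegral_rpow_eq_lintegral_meas_ofReal_lt_mul hg hfin (zero_lt_one.trans ht), mul_assoc,
    mul_assoc]
  gcongr
  refine (setLIntegral_mono' measurableSet_Ioi hlevel).trans ?_
  rw [lintegral_const_mul' _ _ hc]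
  gcongr
  exact lintegral_rpow_mul_setLIntegral_le hF ht c

end Marcinkiewicz

section StrongType

lemma mul_haar_lt_hlMax_le_setLIntegral (hn : 0 < n) {F : Qpn p n → ℝ≥0∞}
    (hF : AEMeasurable F (haar p n)) {l : ℝ≥0∞} (hl : l ≠ 0) :
    l * haar p n {x | l < hlMax F x} ≤ 2 * ∫⁻ x in {x | l < 2 * F x}, F x ∂(haar p n) := by
  have hlarge : NullMeasurableSet {x | l < 2 * F x} (haar p n) :=
    nullMeasurableSet_lt aemeasurable_const (hF.const_mul 2)
  have hF_le : F ≤ fun x => l / 2 + {x | l < 2 * F x}.indicator F x := fun x => by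
    by_cases hx : x ∈ {x | l < 2 * F x}
    · simp only [Set.indicator_of_mem hx]
      exact le_add_self
    · refine le_add_right ?_
      rw [ENNReal.le_div_iff_mul_le (by simp) (by simp), mul_comm]
      exact not_lt.1 hx
  have hsubset : {x | l < hlMax F x} ⊆ {x | l / 2 < hlMax ({x | l < 2 * F x}.indicator F) x} := by
    intro x hx
    by_contra h
    have hlt : l < l / 2 + l / 2 := calc
      l < hlMax F x := hx
      _ ≤ l / 2 + hlMax ({x | l < 2 * F x}.indicator F) x :=
        (hlMax_mono hF_le x).trans (hlMax_add_const_le _ x)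
      _ ≤ l / 2 + l / 2 := by
        gcongr
        exact not_lt.1 h
    exact hlt.ne (ENNReal.add_halves l).symm
  calc l * haar p n {x | l < hlMax F x}
      ≤ 2 * (l / 2 * haar p n {x | l / 2 < hlMax ({x | l < 2 * F x}.indicator F) x}) := by
        rw [← mul_assoc, ENNReal.mul_div_cancel (by simp) (by simp)]
        gcongr
    _ ≤ 2 * ∫⁻ x, {x | l < 2 * F x}.indicator F x ∂(haar p n) := by
        gcongr
        exact mul_haar_lt_hlMax_le hn (hF.indicator₀ hlarge) (by simp [hl])
    _ = 2 * ∫⁻ x in {x | l < 2 * F x}, F x ∂(haar p n) := by rw [lintegral_indicator₀ hlarge]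

lemma rpow_le_one_add_rpow (u : ℝ≥0∞) {c d : ℝ} (hc : 0 ≤ c) (hcd : c ≤ d) :
    u ^ c ≤ 1 + u ^ d := by
  rcases le_total u 1 with hu | hu
  · exact (ENNReal.rpow_le_one hu hc).trans le_self_add
  · exact (ENNReal.rpow_le_rpow_of_exponent_le hu hcd).trans le_add_self

lemma le_one_add_rpow (u : ℝ≥0∞) {t : ℝ} (ht : 1 ≤ t) : u ≤ 1 + u ^ t := by
  simpa only [ENNReal.rpow_one] using rpow_le_one_add_rpow u zero_le_one ht

lemma exists_lintegral_hlMax_rpow_le (hn : 0 < n) {t : ℝ} (ht : 1 < t) :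
    ∃ C : ℝ≥0∞, C ≠ ∞ ∧ ∀ F : Qpn p n → ℝ≥0∞, AEMeasurable F (haar p n) →
      ∫⁻ x, hlMax F x ^ t ∂(haar p n) ≤ C * ∫⁻ x, F x ^ t ∂(haar p n) := by
  have ht1 : 0 < t - 1 := sub_pos.2 ht
  let C : ℝ≥0∞ := ENNReal.ofReal t * 2 * (ENNReal.ofReal (t - 1)⁻¹ * 2 ^ (t - 1))
  have hC0 : C ≠ 0 := by simp [C, ht1, zero_lt_one.trans ht]
  have hCt : C ≠ ∞ := ENNReal.mul_ne_top (ENNReal.mul_ne_top ENNReal.ofReal_ne_top (by simp))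
    (ENNReal.mul_ne_top ENNReal.ofReal_ne_top (ENNReal.rpow_ne_top_of_nonneg ht1.le (by simp)))
  refine ⟨C, hCt, fun F hF => ?_⟩
  rcases eq_or_ne (∫⁻ x, F x ^ t ∂(haar p n)) ∞ with hI | hI
  · rw [hI, ENNReal.mul_top hC0]
    exact le_top
  have hfin : ∀ᵐ x ∂(haar p n), hlMax F x < ∞ := by
    filter_upwards [ae_hlMax_lt_top hn (hF.pow_const t) hI] with x hx
    exact ((hlMax_mono (fun y => le_one_add_rpow (F y) ht.le) x).trans
      (hlMax_add_const_le _ x)).trans_lt (ENNReal.add_lt_top.2 ⟨ENNReal.one_lt_top, hx⟩)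
  exact lintegral_rpow_le_of_weak_type (measurable_hlMax F).aemeasurable hF hfin (by simp)
    (fun l hl => mul_haar_lt_hlMax_le_setLIntegral hn hF hl) ht

end StrongType

/-! ### Log-Hölder continuous exponents -/

/-- The integrable weight `(p + |x|) ^ (-(n + 1))`, which absorbs the error made when a variable
exponent is replaced by its limit at infinity. -/
noncomputable def decay (x : Qpn p n) : ℝ≥0∞ := ENNReal.ofReal ((p + ‖x‖) ^ (-(n + 1) : ℝ))

lemma prime_add_norm_pos (x : Qpn p n) : 0 < (p : ℝ) + ‖x‖ :=
  add_pos_of_pos_of_nonneg (prime_real_pos p) (norm_nonneg x)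

lemma exists_mem_pball_rpow_le (x : Qpn p n) :
    ∃ k : ℕ, x ∈ pball (k : ℤ) 0 ∧ (p : ℝ) ^ ((k : ℝ) - 1) ≤ p + ‖x‖ := by
  classical
  have hex : ∃ k : ℕ, x ∈ pball (k : ℤ) (0 : Qpn p n) := by
    obtain ⟨k, hk⟩ := pow_unbounded_of_one_lt ‖x‖ (one_lt_prime_real p)
    exact ⟨k, by rw [mem_pball, sub_zero, zpow_natCast]; exact hk.le⟩
  refine ⟨Nat.find hex, Nat.find_spec hex, ?_⟩
  rcases Nat.eq_zero_or_pos (Nat.find hex) with hzero | hpos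
  · rw [hzero, Nat.cast_zero, zero_sub, Real.rpow_neg_one]
    have := inv_le_one_of_one_le₀ (one_lt_prime_real p).le
    linarith [one_lt_prime_real p, norm_nonneg x]
  · have hpred := Nat.find_min hex (Nat.sub_lt hpos one_pos)
    rw [mem_pball, sub_zero, not_le, zpow_natCast, ← Real.rpow_natCast, Nat.cast_pred hpos] at hpred
    linarith [prime_real_pos p]

lemma decay_le_tsum (x : Qpn p n) :
    decay x ≤ ∑' k : ℕ, (pball (k : ℤ) (0 : Qpn p n)).indicator
      (fun _ => (p : ℝ≥0∞) ^ (((k : ℝ) - 1) * (-(n + 1)))) x := by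
  obtain ⟨k, hx, hk⟩ := exists_mem_pball_rpow_le x
  refine le_trans ?_ (ENNReal.le_tsum k)
  rw [Set.indicator_of_mem hx, decay, ENNReal.rpow_mul, ← ENNReal.ofReal_natCast p,
    ENNReal.ofReal_rpow_of_pos (prime_real_pos p),
    ENNReal.ofReal_rpow_of_pos (Real.rpow_pos_of_pos (prime_real_pos p) _)]
  exact ENNReal.ofReal_le_ofReal <| Real.rpow_le_rpow_of_nonpos
    (Real.rpow_pos_of_pos (prime_real_pos p) _) hk (by linarith [n.cast_nonneg (α := ℝ)])

variable (p n) in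
lemma lintegral_decay_ne_top : ∫⁻ x : Qpn p n, decay x ∂(haar p n) ≠ ∞ := by
  have hgeom : ∫⁻ x : Qpn p n, decay x ∂(haar p n) ≤
      ∑' k : ℕ, (p : ℝ≥0∞) ^ ((n : ℝ) + 1) * ((p : ℝ≥0∞)⁻¹) ^ k := by
    refine (lintegral_mono decay_le_tsum).trans ?_
    rw [lintegral_tsum fun k => (measurable_const.indicator (measurableSet_pball _ _)).aemeasurable]
    refine ENNReal.tsum_le_tsum fun k => le_of_eq ?_
    rw [lintegral_indicator_const (measurableSet_pball _ _), haar_pball, ballVol,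
      ← ENNReal.rpow_natCast, ← ENNReal.rpow_neg_one, ← ENNReal.rpow_mul,
      ← ENNReal.rpow_add _ _ (prime_ne_zero p) (ENNReal.natCast_ne_top p),
      ← ENNReal.rpow_add _ _ (prime_ne_zero p) (ENNReal.natCast_ne_top p)]
    congr 1
    push_cast
    ring
  refine (hgeom.trans_lt ?_).ne
  rw [ENNReal.tsum_mul_left, ENNReal.tsum_geometric]
  refine ENNReal.mul_lt_top (ENNReal.rpow_lt_top_of_nonneg (by positivity) (by simp)) ?_
  rw [ENNReal.inv_lt_top, tsub_pos_iff_lt, ENNReal.inv_lt_one]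
  exact_mod_cast (Fact.out : p.Prime).one_lt

lemma one_le_logb_prime_add {t : ℝ} (ht : 0 ≤ t) : 1 ≤ Real.logb p (p + t) := by
  rw [Real.le_logb_iff_rpow_le (one_lt_prime_real p) (by linarith [prime_real_pos p]),
    Real.rpow_one]
  linarith

variable (p) in
lemma tendsto_logb_prime_add_atTop : Tendsto (fun t : ℝ => Real.logb p (p + t)) atTop atTop :=
  (Real.tendsto_logb_atTop (one_lt_prime_real p)).comp (tendsto_atTop_add_const_left _ _ tendsto_id)

/-- The exponent `q` approaches `L` at infinity at the log-Hölder rate with constant `C`. This is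
how the condition at infinity is used; `L` is the exponent `q_∞` of the literature. -/
def HasLogLimit (q : Qpn p n → ℝ) (L C : ℝ) : Prop :=
  ∀ x, |q x - L| ≤ C / Real.logb p (p + ‖x‖)

lemma HasLogLimit.tendsto {q : Qpn p n → ℝ} {L C : ℝ} (h : HasLogLimit q L C) :
    Tendsto q (Bornology.cobounded (Qpn p n)) (𝓝 L) := by
  rw [tendsto_iff_dist_tendsto_zero]
  exact squeeze_zero (fun _ => dist_nonneg) h
    (((tendsto_logb_prime_add_atTop p).comp tendsto_norm_cobounded_atTop).const_div_atTop C)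

lemma cobounded_neBot (hn : 0 < n) : (Bornology.cobounded (Qpn p n)).NeBot :=
  have : Nonempty (Fin n) := ⟨⟨0, hn⟩⟩
  NormedSpace.cobounded_neBot ℚ_[p] _

lemma LogHolderInfty.exists_hasLogLimit (hn : 0 < n) {q : Qpn p n → ℝ} (h : LogHolderInfty q) :
    ∃ L C : ℝ, HasLogLimit q L C := by
  obtain ⟨C, -, hq⟩ := h
  have := cobounded_neBot (p := p) hn
  have hcauchy : Cauchy (map q (Bornology.cobounded (Qpn p n))) := by
    refine cauchy_map_iff.2 ⟨inferInstance, tendsto_uniformity_iff_dist_tendsto_zero.2 ?_⟩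
    refine squeeze_zero (fun _ => dist_nonneg) (fun z => hq z.1 z.2)
      (((tendsto_logb_prime_add_atTop p).comp ?_).const_div_atTop C)
    exact tendsto_inf_atTop _ (tendsto_norm_cobounded_atTop.comp tendsto_fst)
      (tendsto_norm_cobounded_atTop.comp tendsto_snd)
  obtain ⟨L, hL⟩ := cauchy_map_iff_exists_tendsto.1 hcauchy
  refine ⟨L, C, fun x => le_of_tendsto (tendsto_const_nhds.sub hL).abs ?_⟩
  filter_upwards [tendsto_norm_cobounded_atTop.eventually_ge_atTop ‖x‖] with y hy
  simpa only [min_eq_left hy] using hq x y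

lemma decay_rpow_neg_le {C d : ℝ} {x : Qpn p n} (hd : d ≤ C / Real.logb p (p + ‖x‖)) :
    decay x ^ (-d) ≤ ENNReal.ofReal ((p : ℝ) ^ ((n + 1) * C)) := by
  have hP := prime_add_norm_pos x
  have hL : 0 < Real.logb p (p + ‖x‖) :=
    zero_lt_one.trans_le (one_le_logb_prime_add (norm_nonneg x))
  rw [le_div_iff₀ hL] at hd
  rw [decay, ENNReal.ofReal_rpow_of_pos (Real.rpow_pos_of_pos hP _), ← Real.rpow_mul hP.le]
  refine ENNReal.ofReal_le_ofReal ?_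
  calc ((p : ℝ) + ‖x‖) ^ (-(n + 1 : ℝ) * -d)
      = (p : ℝ) ^ ((n + 1) * (d * Real.logb p (p + ‖x‖))) := by
        conv_lhs => rw [← Real.rpow_logb (prime_real_pos p) (one_lt_prime_real p).ne' hP]
        rw [← Real.rpow_mul (prime_real_pos p).le]
        congr 1
        ring
    _ ≤ (p : ℝ) ^ ((n + 1) * C) := by
        gcongr
        exact (one_lt_prime_real p).le

-- Where `u` is below the weight the error term wins; elsewhere `u` is at least a fixed negative
-- power of `p + |x|`, so that changing the exponent by `C / log (p + |x|)` costs only a constant.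
lemma rpow_le_rpow_add_decay {C a b : ℝ} {x : Qpn p n} {u : ℝ≥0∞} (hu : u ≤ 1) (ha : 1 ≤ a)
    (hab : |a - b| ≤ C / Real.logb p (p + ‖x‖)) :
    u ^ a ≤ ENNReal.ofReal ((p : ℝ) ^ ((n + 1) * C)) * u ^ b + decay x := by
  rcases le_or_gt u (decay x) with h | h
  · refine le_add_left (le_trans ?_ h)
    simpa only [ENNReal.rpow_one] using ENNReal.rpow_le_rpow_of_exponent_ge hu ha
  · refine le_add_right ?_
    have hu0 : u ≠ 0 := (zero_le.trans_lt h).ne'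
    have hut : u ≠ ∞ := (hu.trans_lt ENNReal.one_lt_top).ne
    calc u ^ a = u ^ (a - b) * u ^ b := by
          rw [← ENNReal.rpow_add _ _ hu0 hut, sub_add_cancel]
      _ ≤ u ^ (-|a - b|) * u ^ b := by
          gcongr ?_ * _
          exact ENNReal.rpow_le_rpow_of_exponent_ge hu (neg_abs_le _)
      _ ≤ decay x ^ (-|a - b|) * u ^ b := by
          gcongr ?_ * _
          rw [ENNReal.rpow_neg, ENNReal.rpow_neg]
          gcongr
      _ ≤ ENNReal.ofReal ((p : ℝ) ^ ((n + 1) * C)) * u ^ b := by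
          gcongr ?_ * _
          exact decay_rpow_neg_le hab

lemma MemP.one_lt_apply {q : Qpn p n → ℝ} (h : MemP q) (x : Qpn p n) : 1 < q x :=
  h.one_lt.trans_le (h.le_apply x)

/-- The essential infimum `q₋(B_γ(x))`. -/
noncomputable def ballInf (q : Qpn p n → ℝ) (γ : ℤ) (x : Qpn p n) : ℝ :=
  essInf q ((haar p n).restrict (pball γ x))

instance neBot_ae_pball (γ : ℤ) (x : Qpn p n) :
    (ae ((haar p n).restrict (pball γ x))).NeBot := by
  rw [ae_neBot, Ne, Measure.restrict_eq_zero, haar_pball]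
  exact ballVol_ne_zero p n γ

lemma ballInf_eq_of_mem (q : Qpn p n → ℝ) {γ : ℤ} {x y : Qpn p n} (h : y ∈ pball γ x) :
    ballInf q γ y = ballInf q γ x := by rw [ballInf, ballInf, pball_eq_of_mem h]

lemma MemP.essInf_le_ballInf {q : Qpn p n → ℝ} (hq : MemP q) (γ : ℤ) (x : Qpn p n) :
    essInf q (haar p n) ≤ ballInf q γ x :=
  le_liminf_of_le (isBoundedUnder_of ⟨_, hq.apply_le⟩).isCoboundedUnder_ge
    (Eventually.of_forall hq.le_apply)

lemma ae_of_forall_ae_pball (γ : ℤ) {P : Qpn p n → Prop}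
    (h : ∀ x, ∀ᵐ y ∂((haar p n).restrict (pball γ x)), P y) : ∀ᵐ y ∂(haar p n), P y := by
  rw [ae_iff]
  refine measure_null_of_locally_null _ fun x _ =>
    ⟨{y | ¬ P y} ∩ pball γ x, inter_mem_nhdsWithin _ (pball_mem_nhds γ x), ?_⟩
  have hx := h x
  rwa [ae_iff, Measure.restrict_apply' (measurableSet_pball γ x)] at hx

lemma MemClog.exists_ae_pball_sub_ballInf_le {q : Qpn p n → ℝ} (hq : MemClog q) :
    ∃ C : ℝ, ∀ (k : ℕ) (x : Qpn p n),
      ∀ᵐ y ∂((haar p n).restrict (pball (-(k : ℤ)) x)),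
        ballInf q (-(k : ℤ)) x ≤ q y ∧ k * (q y - ballInf q (-(k : ℤ)) x) ≤ C := by
  obtain ⟨C, -, hC⟩ := hq.zero
  refine ⟨C, fun k x => ?_⟩
  filter_upwards [ae_essInf_le (isBoundedUnder_of ⟨_, hq.memP.le_apply⟩),
    ae_le_essSup (isBoundedUnder_of ⟨_, hq.memP.apply_le⟩)] with y hinf hsup
  refine ⟨hinf, le_trans ?_ (hC (-(k : ℤ)) x)⟩
  push_cast
  rw [neg_mul, ← mul_neg, neg_sub, ballInf]
  gcongr

lemma MemClog.exists_ae_sub_ballInf_le {q : Qpn p n → ℝ} (hq : MemClog q) :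
    ∃ C : ℝ, ∀ᵐ x ∂(haar p n), ∀ k : ℕ,
      ballInf q (-(k : ℤ)) x ≤ q x ∧ k * (q x - ballInf q (-(k : ℤ)) x) ≤ C ∧
      ∀ᵐ y ∂((haar p n).restrict (pball (-(k : ℤ)) x)), ballInf q (-(k : ℤ)) x ≤ q y := by
  obtain ⟨C, hC⟩ := hq.exists_ae_pball_sub_ballInf_le
  refine ⟨C, ae_all_iff.2 fun k => ae_of_forall_ae_pball (-(k : ℤ)) fun x => ?_⟩
  filter_upwards [hC k x, ae_restrict_mem (measurableSet_pball _ x)] with y hy hyx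
  rw [ballInf_eq_of_mem q hyx, pball_eq_of_mem hyx]
  exact ⟨hy.1, hy.2, (hC k x).mono fun z hz => hz.1⟩

/-! ### The fractional maximal operator on variable exponent spaces -/

/-- The fractional maximal function of a function with values in `[0, ∞]`. -/
noncomputable def fracMaxE (s : ℝ) (F : Qpn p n → ℝ≥0∞) (x : Qpn p n) : ℝ≥0∞ :=
  ⨆ γ : ℤ, ballVol p n γ ^ (s / n) * ballAvg γ F x

/-- The part of the fractional maximal function that comes from the balls of radius at most `1`. -/
noncomputable def fracMaxSmall (s : ℝ) (F : Qpn p n → ℝ≥0∞) (x : Qpn p n) : ℝ≥0∞ :=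
  ⨆ k : ℕ, ballVol p n (-(k : ℤ)) ^ (s / n) * ballAvg (-(k : ℤ)) F x

lemma setLIntegral_div_rpow_eq (s : ℝ) (γ : ℤ) (F : Qpn p n → ℝ≥0∞) (x : Qpn p n) :
    (∫⁻ y in pball γ x, F y ∂(haar p n)) / (haar p n (pball γ x)) ^ (1 - s / n) =
      ballVol p n γ ^ (s / n) * ballAvg γ F x := by
  have hV0 := ballVol_ne_zero p n γ
  have hVt := ballVol_ne_top p n γ
  rw [haar_pball, ballAvg, ENNReal.rpow_sub _ _ hV0 hVt, ENNReal.rpow_one]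
  simp only [div_eq_mul_inv]
  rw [ENNReal.mul_inv (Or.inl hV0) (Or.inl hVt), inv_inv]
  ring

lemma fracMax_eq_fracMaxE (s : ℝ) (f : Qpn p n → ℝ) (x : Qpn p n) :
    fracMax s f x = fracMaxE s (fun y => ‖f y‖ₑ) x :=
  iSup_congr fun γ => setLIntegral_div_rpow_eq s γ _ x

lemma measurable_fracMaxE (s : ℝ) (F : Qpn p n → ℝ≥0∞) : Measurable (fracMaxE s F) :=
  Measurable.iSup fun γ => (measurable_ballAvg γ F).const_mul _

lemma measurable_fracMaxSmall (s : ℝ) (F : Qpn p n → ℝ≥0∞) : Measurable (fracMaxSmall s F) :=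
  Measurable.iSup fun _ => (measurable_ballAvg _ F).const_mul _

lemma le_fracMaxE (s : ℝ) (γ : ℤ) (F : Qpn p n → ℝ≥0∞) (x : Qpn p n) :
    ballVol p n γ ^ (s / n) * ballAvg γ F x ≤ fracMaxE s F x :=
  le_iSup (fun γ => ballVol p n γ ^ (s / n) * ballAvg γ F x) γ

lemma le_fracMaxSmall (s : ℝ) (k : ℕ) (F : Qpn p n → ℝ≥0∞) (x : Qpn p n) :
    ballVol p n (-(k : ℤ)) ^ (s / n) * ballAvg (-(k : ℤ)) F x ≤ fracMaxSmall s F x :=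
  le_iSup (fun k : ℕ => ballVol p n (-(k : ℤ)) ^ (s / n) * ballAvg (-(k : ℤ)) F x) k

-- The averages of `F₁` over balls of radius at least `1` are those of its unit-ball averages.
lemma fracMaxE_add_le (s : ℝ) {F₁ F₂ : Qpn p n → ℝ≥0∞} (hF₁ : AEMeasurable F₁ (haar p n))
    (x : Qpn p n) :
    fracMaxE s (fun y => F₁ y + F₂ y) x ≤
      fracMaxSmall s F₁ x + fracMaxE s (ballAvg 0 F₁) x + fracMaxE s F₂ x := by
  refine iSup_le fun γ => ?_
  rw [ballAvg_add hF₁, mul_add]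
  refine add_le_add ?_ (le_fracMaxE s γ F₂ x)
  rcases le_total 0 γ with hγ | hγ
  · refine le_add_left (le_trans (le_of_eq ?_) (le_fracMaxE s γ _ x))
    congr 1
    rw [ballAvg, ballAvg, setLIntegral_ballAvg hF₁ (measurableSet_pball γ x)]
    intro y hy
    rw [← pball_eq_of_mem hy]
    exact pball_mono hγ y
  · obtain ⟨k, rfl⟩ := Int.exists_eq_neg_ofNat hγ
    exact le_add_right (le_fracMaxSmall s k F₁ x)

section Hedberg

lemma iSup_rpow_le {ι : Sort*} {a : ι → ℝ≥0∞} {c : ℝ≥0∞} {q : ℝ} (hq : 0 < q)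
    (h : ∀ i, a i ^ q ≤ c) : (⨆ i, a i) ^ q ≤ c := by
  rw [← ENNReal.le_rpow_inv_iff hq]
  exact iSup_le fun i => (ENNReal.le_rpow_inv_iff hq).2 (h i)

lemma rpow_mul_rpow_eq {V : ℝ≥0∞} {σ r q : ℝ} (hσ : 0 ≤ σ) (hr : 0 < r) (hq : 0 < q)
    (hrel : 1 / q = 1 / r - σ) (a : ℝ≥0∞) :
    (V ^ σ * a) ^ q = (V * a ^ r) ^ (q * σ) * a ^ r := by
  have hqσ : 0 ≤ q * σ := by positivity
  have hexp : q = r * (q * σ) + r := by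
    field_simp at hrel
    linarith
  rw [ENNReal.mul_rpow_of_nonneg _ _ hq.le, ENNReal.mul_rpow_of_nonneg _ _ hqσ,
    ← ENNReal.rpow_mul, ← ENNReal.rpow_mul, mul_assoc,
    ← ENNReal.rpow_add_of_nonneg _ _ (by positivity) hr.le, ← hexp, mul_comm σ q]

lemma ballVol_mul_ballAvg_rpow_le {G : Qpn p n → ℝ≥0∞} (hG : AEMeasurable G (haar p n)) {r : ℝ}
    (hr : 1 ≤ r) (γ : ℤ) (x : Qpn p n) :
    ballVol p n γ * ballAvg γ G x ^ r ≤ ∫⁻ y, G y ^ r ∂(haar p n) :=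
  calc ballVol p n γ * ballAvg γ G x ^ r ≤ ballVol p n γ * ballAvg γ (fun y => G y ^ r) x := by
        gcongr
        exact ballAvg_rpow_le hG hr γ x
    _ = ∫⁻ y in pball γ x, G y ^ r ∂(haar p n) := by rw [mul_comm, ballAvg_mul_ballVol]
    _ ≤ ∫⁻ y, G y ^ r ∂(haar p n) := setLIntegral_le_lintegral _ _

/-- Hedberg's inequality. -/
lemma fracMaxE_rpow_le {s r q : ℝ} (hs : 0 ≤ s) (hr : 1 ≤ r) (hq : 0 < q)
    (hrel : 1 / q = 1 / r - s / n) {G : Qpn p n → ℝ≥0∞} (hG : AEMeasurable G (haar p n))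
    (x : Qpn p n) :
    fracMaxE s G x ^ q ≤ (∫⁻ y, G y ^ r ∂(haar p n)) ^ (q * (s / n)) * hlMax G x ^ r := by
  have hr0 : 0 < r := zero_lt_one.trans_le hr
  refine iSup_rpow_le hq fun γ => ?_
  rw [rpow_mul_rpow_eq (by positivity) hr0 hq hrel]
  gcongr
  · exact ballVol_mul_ballAvg_rpow_le hG hr γ x
  · exact ballAvg_le_hlMax γ G x

end Hedberg

section Bounded

lemma hlMax_le_of_le {G : Qpn p n → ℝ≥0∞} {c : ℝ≥0∞} (hG : ∀ x, G x ≤ c) (x : Qpn p n) :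
    hlMax G x ≤ c :=
  iSup_le fun γ => (ballAvg_mono hG γ x).trans_eq (ballAvg_const c γ x)

lemma fracMaxE_le_of_le_one {s r q : ℝ} (hs : 0 ≤ s) (hr : 1 ≤ r) (hq : 0 < q)
    (hrel : 1 / q = 1 / r - s / n) {G : Qpn p n → ℝ≥0∞} (hG : AEMeasurable G (haar p n))
    (hG1 : ∀ x, G x ≤ 1) (x : Qpn p n) :
    fracMaxE s G x ≤ (∫⁻ y, G y ^ r ∂(haar p n)) ^ (s / n) := by
  rw [← ENNReal.rpow_le_rpow_iff hq, ← ENNReal.rpow_mul, mul_comm]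
  exact (fracMaxE_rpow_le hs hr hq hrel hG x).trans <| mul_le_of_le_one_right zero_le <|
    ENNReal.rpow_le_one (hlMax_le_of_le hG1 x) (zero_le_one.trans hr)

lemma rpow_le_rpow_mul_add_decay {C T a b : ℝ} {x : Qpn p n} {u A : ℝ≥0∞} (hu : u ≤ A)
    (hA1 : 1 ≤ A) (hAt : A ≠ ∞) (ha : 1 ≤ a) (haT : a ≤ T) (hb : 0 ≤ b)
    (hab : |a - b| ≤ C / Real.logb p (p + ‖x‖)) :
    u ^ a ≤ A ^ T * (ENNReal.ofReal ((p : ℝ) ^ ((n + 1) * C)) * u ^ b + decay x) := by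
  have hA0 : A ≠ 0 := (zero_lt_one.trans_le hA1).ne'
  have huA : u / A ≤ 1 := ENNReal.div_le_of_le_mul (by rwa [one_mul])
  have huu : u / A ≤ u := ENNReal.div_le_of_le_mul (le_mul_of_one_le_right zero_le hA1)
  calc u ^ a = A ^ a * (u / A) ^ a := by
        rw [← ENNReal.mul_rpow_of_nonneg _ _ (zero_le_one.trans ha),
          ENNReal.mul_div_cancel hA0 hAt]
    _ ≤ A ^ T * (ENNReal.ofReal ((p : ℝ) ^ ((n + 1) * C)) * (u / A) ^ b + decay x) := by
        gcongr
        exact rpow_le_rpow_add_decay huA ha hab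
    _ ≤ A ^ T * (ENNReal.ofReal ((p : ℝ) ^ ((n + 1) * C)) * u ^ b + decay x) := by gcongr

lemma lintegral_rpow_le_of_le_one {C a₀ : ℝ} {a : Qpn p n → ℝ} (ha₀ : 1 ≤ a₀)
    (ham : Measurable a) (hlim : HasLogLimit a a₀ C)
    {G : Qpn p n → ℝ≥0∞} (hG : AEMeasurable G (haar p n)) (hG1 : ∀ x, G x ≤ 1) :
    ∫⁻ x, G x ^ a₀ ∂(haar p n) ≤ ENNReal.ofReal ((p : ℝ) ^ ((n + 1) * C)) *
      ∫⁻ x, G x ^ a x ∂(haar p n) + ∫⁻ x : Qpn p n, decay x ∂(haar p n) := by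
  rw [← lintegral_const_mul' _ _ ENNReal.ofReal_ne_top,
    ← lintegral_add_left' ((hG.pow ham.aemeasurable).const_mul _)]
  exact lintegral_mono fun x => rpow_le_rpow_add_decay (hG1 x) ha₀ (by
    rw [abs_sub_comm]
    exact hlim x)

lemma AdmissiblePair.exists_hasLogLimit (hn : 0 < n) {s : ℝ} {r q : Qpn p n → ℝ}
    (h : AdmissiblePair s r q) :
    ∃ r₀ q₀ C C' : ℝ, 1 < r₀ ∧ 1 < q₀ ∧ 1 / q₀ = 1 / r₀ - s / n ∧
      HasLogLimit r r₀ C ∧ HasLogLimit q q₀ C' := by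
  have := cobounded_neBot (p := p) hn
  obtain ⟨r₀, C, hr⟩ := h.r_mem_Clog.infty.exists_hasLogLimit hn
  obtain ⟨q₀, C', hq⟩ := h.q_mem_Clog.infty.exists_hasLogLimit hn
  have hr₀ : 1 < r₀ := h.r_mem_P.one_lt.trans_le (ge_of_tendsto' hr.tendsto h.r_mem_P.le_apply)
  have hq₀ : 1 < q₀ := h.q_mem_Clog.memP.one_lt.trans_le
    (ge_of_tendsto' hq.tendsto h.q_mem_Clog.memP.le_apply)
  refine ⟨r₀, q₀, C, C', hr₀, hq₀, tendsto_nhds_unique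
    (tendsto_const_nhds.div hq.tendsto (zero_lt_one.trans hq₀).ne') ?_, hr, hq⟩
  exact ((tendsto_const_nhds.div hr.tendsto (zero_lt_one.trans hr₀).ne').sub_const _).congr
    fun x => (h.rel x).symm

lemma lintegral_fracMaxE_rpow_le_of_le_one {s r₀ q₀ C T : ℝ} (hs : 0 ≤ s) (hr₀ : 1 ≤ r₀)
    (hq₀ : 0 < q₀) (hrel : 1 / q₀ = 1 / r₀ - s / n) {q : Qpn p n → ℝ} (hq : ∀ x, 1 ≤ q x)
    (hqT : ∀ x, q x ≤ T) (hlim : HasLogLimit q q₀ C) {G : Qpn p n → ℝ≥0∞}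
    (hG : AEMeasurable G (haar p n)) (hG1 : ∀ x, G x ≤ 1) {D : ℝ≥0∞} (hD1 : 1 ≤ D) (hD : D ≠ ∞)
    (hGD : ∫⁻ x, G x ^ r₀ ∂(haar p n) ≤ D) :
    ∫⁻ x, fracMaxE s G x ^ q x ∂(haar p n) ≤
      (D ^ (s / n)) ^ T * (ENNReal.ofReal ((p : ℝ) ^ ((n + 1) * C)) * D ^ (q₀ * (s / n)) *
        ∫⁻ x, hlMax G x ^ r₀ ∂(haar p n) + ∫⁻ x : Qpn p n, decay x ∂(haar p n)) := by
  have hσ : 0 ≤ s / n := by positivity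
  have hA1 : 1 ≤ D ^ (s / n) := by
    simpa only [ENNReal.one_rpow] using ENNReal.rpow_le_rpow hD1 hσ
  have hAt : D ^ (s / n) ≠ ∞ := ENNReal.rpow_ne_top_of_nonneg hσ hD
  have hT : 0 ≤ T := zero_le_one.trans ((hq 0).trans (hqT 0))
  have hAT : (D ^ (s / n)) ^ T ≠ ∞ := ENNReal.rpow_ne_top_of_nonneg hT hAt
  have hpointwise : ∀ x, fracMaxE s G x ^ q x ≤ (D ^ (s / n)) ^ T *
      (ENNReal.ofReal ((p : ℝ) ^ ((n + 1) * C)) * D ^ (q₀ * (s / n)) * hlMax G x ^ r₀ +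
        decay x) := fun x => by
    refine (rpow_le_rpow_mul_add_decay
      ((fracMaxE_le_of_le_one hs hr₀ hq₀ hrel hG hG1 x).trans (by gcongr)) hA1 hAt
      (hq x) (hqT x) hq₀.le (hlim x)).trans ?_
    rw [mul_assoc (ENNReal.ofReal _)]
    gcongr _ * (_ * ?_ + _)
    exact (fracMaxE_rpow_le hs hr₀ hq₀ hrel hG x).trans (by gcongr)
  refine (lintegral_mono hpointwise).trans_eq ?_
  rw [lintegral_const_mul' _ _ hAT,
    lintegral_add_left (((measurable_hlMax G).pow_const _).const_mul _),
    lintegral_const_mul' _ _ (ENNReal.mul_ne_top ENNReal.ofReal_ne_top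
      (ENNReal.rpow_ne_top_of_nonneg (by positivity) hD))]

lemma AdmissiblePair.exists_lintegral_fracMaxE_le_of_le_one (hn : 0 < n) {s : ℝ} (hs : 0 ≤ s)
    {r q : Qpn p n → ℝ} (h : AdmissiblePair s r q) :
    ∃ K : ℝ≥0∞, K ≠ ∞ ∧ ∀ G : Qpn p n → ℝ≥0∞, AEMeasurable G (haar p n) → (∀ x, G x ≤ 1) →
      ∫⁻ x, G x ^ r x ∂(haar p n) ≤ 1 → ∫⁻ x, fracMaxE s G x ^ q x ∂(haar p n) ≤ K := by
  obtain ⟨r₀, q₀, C, C', hr₀, hq₀, hrel, hr, hq⟩ := h.exists_hasLogLimit hn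
  obtain ⟨H, hH, hmax⟩ := exists_lintegral_hlMax_rpow_le (p := p) hn hr₀
  have hσ : 0 ≤ s / n := by positivity
  have hqP := h.q_mem_Clog.memP
  set T := essSup q (haar p n)
  have hT : 0 ≤ T := (zero_lt_one.trans (hqP.one_lt_apply 0)).le.trans (hqP.apply_le 0)
  -- The summand `1` only serves to make `1 ≤ D`.
  let D : ℝ≥0∞ := ENNReal.ofReal ((p : ℝ) ^ ((n + 1) * C)) + ∫⁻ x, decay x ∂(haar p n) + 1
  have hD : D ≠ ∞ := ENNReal.add_ne_top.2 ⟨ENNReal.add_ne_top.2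
    ⟨ENNReal.ofReal_ne_top, lintegral_decay_ne_top p n⟩, ENNReal.one_ne_top⟩
  have hpow : ∀ {e : ℝ}, 0 ≤ e → D ^ e ≠ ∞ := fun he => ENNReal.rpow_ne_top_of_nonneg he hD
  refine ⟨(D ^ (s / n)) ^ T * (ENNReal.ofReal ((p : ℝ) ^ ((n + 1) * C')) * D ^ (q₀ * (s / n)) *
      (H * D) + ∫⁻ x, decay x ∂(haar p n)),
    ENNReal.mul_ne_top (ENNReal.rpow_ne_top_of_nonneg hT (hpow hσ)) <| ENNReal.add_ne_top.2
      ⟨ENNReal.mul_ne_top (ENNReal.mul_ne_top ENNReal.ofReal_ne_top (hpow (by positivity)))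
        (ENNReal.mul_ne_top hH hD), lintegral_decay_ne_top p n⟩,
    fun G hG hG1 hGr => ?_⟩
  have hGD : ∫⁻ x, G x ^ r₀ ∂(haar p n) ≤ D :=
    (lintegral_rpow_le_of_le_one hr₀.le h.r_mem_P.measurable hr hG hG1).trans <|
      le_add_right (add_le_add_left (mul_le_of_le_one_right zero_le hGr) _)
  refine (lintegral_fracMaxE_rpow_le_of_le_one hs hr₀.le (zero_lt_one.trans hq₀) hrel
    (fun x => (hqP.one_lt_apply x).le) hqP.apply_le hq hG hG1 le_add_self hD hGD).trans ?_
  gcongr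
  exact (hmax G hG).trans (by gcongr)

end Bounded

section SmallScales

lemma ballAvg_rpow_le_ballAvg_rpow_div {F : Qpn p n → ℝ≥0∞} (hF : AEMeasurable F (haar p n))
    (hF01 : ∀ x, F x = 0 ∨ 1 ≤ F x) {t e : ℝ} {r : Qpn p n → ℝ} (ht : 0 < t) (hte : t ≤ e)
    {γ : ℤ} {x : Qpn p n} (her : ∀ᵐ y ∂((haar p n).restrict (pball γ x)), e ≤ r y) :
    ballAvg γ F x ^ e ≤ ballAvg γ (fun y => F y ^ (r y / t)) x ^ t := by
  have he : 0 < e := ht.trans_le hte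
  have hjensen : ballAvg γ F x ^ (e / t) ≤ ballAvg γ (fun y => F y ^ (r y / t)) x := by
    refine (ballAvg_rpow_le hF ((one_le_div ht).2 hte) _ x).trans (ballAvg_mono_ae ?_)
    filter_upwards [her] with y hy
    rcases hF01 y with hzero | hone
    · rw [hzero, ENNReal.zero_rpow_of_pos (by positivity)]
      exact zero_le
    · exact ENNReal.rpow_le_rpow_of_exponent_le hone (by gcongr)
  calc ballAvg γ F x ^ e = (ballAvg γ F x ^ (e / t)) ^ t := by
        rw [← ENNReal.rpow_mul, div_mul_cancel₀ _ ht.ne']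
    _ ≤ ballAvg γ (fun y => F y ^ (r y / t)) x ^ t := by gcongr

lemma inv_ballVol_neg_rpow_le {k : ℕ} {δ C : ℝ} (h : k * δ ≤ C) :
    (ballVol p n (-(k : ℤ)))⁻¹ ^ δ ≤ (p : ℝ≥0∞) ^ (n * C) := by
  rw [ballVol, ← ENNReal.rpow_neg, ← ENNReal.rpow_mul]
  refine ENNReal.rpow_le_rpow_of_exponent_le (one_le_prime p) ?_
  push_cast
  calc -((n : ℝ) * -k) * δ = n * (k * δ) := by ring
    _ ≤ n * C := by gcongr

lemma rpow_le_mul_of_rpow_le {V a B K : ℝ≥0∞} {e r : ℝ} (he : 0 < e) (her : e ≤ r)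
    (haB : a ^ e ≤ B) (hVB : V * B ≤ 1) (hVK : V⁻¹ ^ ((r - e) / e) ≤ K) : a ^ r ≤ K * B := by
  have hδ : 0 ≤ (r - e) / e := div_nonneg (sub_nonneg.2 her) he.le
  have hBV : B ≤ V⁻¹ := by rwa [ENNReal.le_inv_iff_mul_le, mul_comm]
  calc a ^ r = (a ^ e) ^ ((r - e) / e + 1) := by
        rw [← ENNReal.rpow_mul]
        congr 1
        field_simp
        ring
    _ ≤ B ^ ((r - e) / e + 1) := by gcongr
    _ = B ^ ((r - e) / e) * B := by
        rw [ENNReal.rpow_add_of_nonneg _ _ hδ zero_le_one, ENNReal.rpow_one]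
    _ ≤ V⁻¹ ^ ((r - e) / e) * B := by gcongr
    _ ≤ K * B := by gcongr

lemma lintegral_rpow_div_rpow_eq {r : Qpn p n → ℝ} {t : ℝ} (ht : t ≠ 0) (F : Qpn p n → ℝ≥0∞) :
    ∫⁻ x, (F x ^ (r x / t)) ^ t ∂(haar p n) = ∫⁻ x, F x ^ r x ∂(haar p n) :=
  lintegral_congr fun x => by rw [← ENNReal.rpow_mul, div_mul_cancel₀ _ ht]

lemma mul_rpow_le_of_rpow_le_mul {V a B K : ℝ≥0∞} {σ r q T : ℝ} (hσ : 0 ≤ σ) (hr : 0 < r)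
    (hq : 0 < q) (hqT : q ≤ T) (hrel : 1 / q = 1 / r - σ) (haB : a ^ r ≤ K * B)
    (hVB : V * B ≤ 1) : (V ^ σ * a) ^ q ≤ (1 + K ^ (T * σ)) * K * B := by
  have hVa : V * a ^ r ≤ K := by
    calc V * a ^ r ≤ V * (K * B) := by gcongr
      _ = K * (V * B) := by ring
      _ ≤ K := mul_le_of_le_one_right zero_le hVB
  calc (V ^ σ * a) ^ q = (V * a ^ r) ^ (q * σ) * a ^ r := rpow_mul_rpow_eq hσ hr hq hrel a
    _ ≤ K ^ (q * σ) * (K * B) := by gcongr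
    _ ≤ (1 + K ^ (T * σ)) * (K * B) := by
        gcongr
        exact rpow_le_one_add_rpow K (by positivity) (by gcongr)
    _ = (1 + K ^ (T * σ)) * K * B := (mul_assoc _ _ _).symm

-- On small balls `r` may be replaced by its essential infimum over the ball: the local log-Hölder
-- condition bounds the resulting power of the volume.
lemma AdmissiblePair.exists_ae_fracMaxSmall_rpow_le {s : ℝ} (hs : 0 ≤ s) {r q : Qpn p n → ℝ}
    (h : AdmissiblePair s r q) :
    ∃ K : ℝ≥0∞, K ≠ ∞ ∧ ∀ F : Qpn p n → ℝ≥0∞, AEMeasurable F (haar p n) →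
      (∀ x, F x = 0 ∨ 1 ≤ F x) → ∫⁻ x, F x ^ r x ∂(haar p n) ≤ 1 →
      ∀ᵐ x ∂(haar p n), fracMaxSmall s F x ^ q x ≤
        K * hlMax (fun y => F y ^ (r y / essInf r (haar p n))) x ^ essInf r (haar p n) := by
  obtain ⟨C, hlocal⟩ := h.r_mem_Clog.exists_ae_sub_ballInf_le
  have hσ : 0 ≤ s / n := by positivity
  have hqP := h.q_mem_Clog.memP
  have ht1 : 1 < essInf r (haar p n) := h.r_mem_P.one_lt
  have hballInf := h.r_mem_P.essInf_le_ballInf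
  set t := essInf r (haar p n)
  set T := essSup q (haar p n)
  have ht0 : 0 < t := zero_lt_one.trans ht1
  have hT : 0 ≤ T := (zero_lt_one.trans (hqP.one_lt_apply 0)).le.trans (hqP.apply_le 0)
  let K₀ : ℝ≥0∞ := (p : ℝ≥0∞) ^ (n * C)
  have hK₀ : K₀ ≠ ∞ := ENNReal.rpow_ne_top_of_ne_zero (prime_ne_zero p) (ENNReal.natCast_ne_top p)
  refine ⟨(1 + K₀ ^ (T * (s / n))) * K₀, ENNReal.mul_ne_top (ENNReal.add_ne_top.2
    ⟨ENNReal.one_ne_top, ENNReal.rpow_ne_top_of_nonneg (by positivity) hK₀⟩) hK₀,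
    fun F hF hF01 hFr => ?_⟩
  filter_upwards [hlocal] with x hx
  have hq0 : 0 < q x := zero_lt_one.trans (hqP.one_lt_apply x)
  refine iSup_rpow_le hq0 fun k => ?_
  obtain ⟨her, hkC, hball⟩ := hx k
  have hte := hballInf (-(k : ℤ)) x
  set e := ballInf r (-(k : ℤ)) x
  set V := ballVol p n (-(k : ℤ))
  set a := ballAvg (-(k : ℤ)) F x
  set A := ballAvg (-(k : ℤ)) (fun y => F y ^ (r y / t)) x
  have hVA : V * A ^ t ≤ 1 :=
    (ballVol_mul_ballAvg_rpow_le (hF.pow (h.r_mem_P.measurable.div_const t).aemeasurable)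
      ht1.le _ x).trans ((lintegral_rpow_div_rpow_eq ht0.ne' F).trans_le hFr)
  have hkδ : k * ((r x - e) / e) ≤ C := by
    refine le_trans ?_ hkC
    gcongr
    exact div_le_self (sub_nonneg.2 her) (ht1.le.trans hte)
  have har : a ^ r x ≤ K₀ * A ^ t := rpow_le_mul_of_rpow_le (ht0.trans_le hte) her
    (ballAvg_rpow_le_ballAvg_rpow_div hF hF01 ht0 hte hball) hVA (inv_ballVol_neg_rpow_le hkδ)
  refine (mul_rpow_le_of_rpow_le_mul hσ (ht0.trans_le (hte.trans her)) hq0 (hqP.apply_le x)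
    (h.rel x) har hVA).trans ?_
  gcongr
  exact ballAvg_le_hlMax _ _ x

lemma AdmissiblePair.exists_lintegral_fracMaxSmall_le (hn : 0 < n) {s : ℝ} (hs : 0 ≤ s)
    {r q : Qpn p n → ℝ} (h : AdmissiblePair s r q) :
    ∃ K : ℝ≥0∞, K ≠ ∞ ∧ ∀ F : Qpn p n → ℝ≥0∞, AEMeasurable F (haar p n) →
      (∀ x, F x = 0 ∨ 1 ≤ F x) → ∫⁻ x, F x ^ r x ∂(haar p n) ≤ 1 →
      ∫⁻ x, fracMaxSmall s F x ^ q x ∂(haar p n) ≤ K := by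
  obtain ⟨K, hK, hpointwise⟩ := h.exists_ae_fracMaxSmall_rpow_le hs
  have ht : 1 < essInf r (haar p n) := h.r_mem_P.one_lt
  obtain ⟨H, hH, hmax⟩ := exists_lintegral_hlMax_rpow_le (p := p) hn ht
  refine ⟨K * H, ENNReal.mul_ne_top hK hH, fun F hF hF01 hFr => ?_⟩
  refine (lintegral_mono_ae (hpointwise F hF hF01 hFr)).trans ?_
  rw [lintegral_const_mul' _ _ hK]
  gcongr
  refine (hmax _ (hF.pow (h.r_mem_P.measurable.div_const _).aemeasurable)).trans ?_
  rw [lintegral_rpow_div_rpow_eq (zero_lt_one.trans ht).ne']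
  exact mul_le_of_le_one_right zero_le hFr

end SmallScales

lemma ballAvg_zero_le_lintegral (F : Qpn p n → ℝ≥0∞) (x : Qpn p n) :
    ballAvg 0 F x ≤ ∫⁻ y, F y ∂(haar p n) := by
  simpa only [ballVol_zero, div_one] using ballAvg_le_lintegral_div 0 F x

lemma AdmissiblePair.exists_lintegral_fracMaxE_ballAvg_le (hn : 0 < n) {s : ℝ} (hs : 0 ≤ s)
    {r q : Qpn p n → ℝ} (h : AdmissiblePair s r q) :
    ∃ K : ℝ≥0∞, K ≠ ∞ ∧ ∀ F : Qpn p n → ℝ≥0∞, AEMeasurable F (haar p n) →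
      (∀ x, F x = 0 ∨ 1 ≤ F x) → ∫⁻ x, F x ^ r x ∂(haar p n) ≤ 1 →
      ∫⁻ x, fracMaxE s (ballAvg 0 F) x ^ q x ∂(haar p n) ≤ K := by
  obtain ⟨K, hK, hbounded⟩ := h.exists_lintegral_fracMaxE_le_of_le_one hn hs
  refine ⟨K, hK, fun F hF hF01 hFr => ?_⟩
  have hr1 : ∀ x, 1 ≤ r x := fun x => (h.r_mem_P.one_lt_apply x).le
  have hF1 : ∫⁻ x, F x ∂(haar p n) ≤ 1 := by
    refine (lintegral_mono fun x => ?_).trans hFr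
    rcases hF01 x with hzero | hone
    · rw [hzero]
      exact zero_le
    · simpa only [ENNReal.rpow_one] using ENNReal.rpow_le_rpow_of_exponent_le hone (hr1 x)
  have havg : ∀ x, ballAvg 0 F x ≤ 1 := fun x => (ballAvg_zero_le_lintegral F x).trans hF1
  refine hbounded _ (measurable_ballAvg 0 F).aemeasurable havg ?_
  refine (lintegral_mono fun x => ?_).trans ((lintegral_ballAvg hF 0).trans_le hF1)
  simpa only [ENNReal.rpow_one] using ENNReal.rpow_le_rpow_of_exponent_ge (havg x) (hr1 x)

lemma add_add_rpow_le {q T : ℝ} (hq : 0 ≤ q) (hqT : q ≤ T) (a b c : ℝ≥0∞) :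
    (a + b + c) ^ q ≤ 3 ^ T * (a ^ q + b ^ q + c ^ q) := by
  have hsum : a + b + c ≤ 3 * max (max a b) c := by
    calc a + b + c ≤ max (max a b) c + max (max a b) c + max (max a b) c := by
          gcongr
          · exact (le_max_left a b).trans (le_max_left _ _)
          · exact (le_max_right a b).trans (le_max_left _ _)
          · exact le_max_right _ _
      _ = 3 * max (max a b) c := by ring
  have hmax : max (max a b) c ^ q ≤ a ^ q + b ^ q + c ^ q := by
    rw [(ENNReal.monotone_rpow_of_nonneg hq).map_max, (ENNReal.monotone_rpow_of_nonneg hq).map_max]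
    exact max_le (max_le (le_add_right le_self_add) (le_add_right le_add_self)) le_add_self
  calc (a + b + c) ^ q ≤ (3 * max (max a b) c) ^ q := by gcongr
    _ = 3 ^ q * max (max a b) c ^ q := ENNReal.mul_rpow_of_nonneg _ _ hq
    _ ≤ 3 ^ T * (a ^ q + b ^ q + c ^ q) := by
        gcongr
        norm_num

lemma lintegral_indicator_rpow_le {r : Qpn p n → ℝ} (hr : ∀ x, 0 ≤ r x) (S : Set (Qpn p n))
    (F : Qpn p n → ℝ≥0∞) :
    ∫⁻ x, S.indicator F x ^ r x ∂(haar p n) ≤ ∫⁻ x, F x ^ r x ∂(haar p n) :=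
  lintegral_mono fun x => ENNReal.rpow_le_rpow (Set.indicator_le_self S F x) (hr x)

theorem AdmissiblePair.exists_lintegral_fracMaxE_le (hn : 0 < n) {s : ℝ} (hs : 0 ≤ s)
    {r q : Qpn p n → ℝ} (h : AdmissiblePair s r q) :
    ∃ K : ℝ≥0∞, K ≠ ∞ ∧ ∀ F : Qpn p n → ℝ≥0∞, AEMeasurable F (haar p n) →
      ∫⁻ x, F x ^ r x ∂(haar p n) ≤ 1 → ∫⁻ x, fracMaxE s F x ^ q x ∂(haar p n) ≤ K := by
  obtain ⟨K₁, hK₁, hsmall⟩ := h.exists_lintegral_fracMaxSmall_le hn hs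
  obtain ⟨K₂, hK₂, hlarge⟩ := h.exists_lintegral_fracMaxE_ballAvg_le hn hs
  obtain ⟨K₃, hK₃, hbounded⟩ := h.exists_lintegral_fracMaxE_le_of_le_one hn hs
  have hqP := h.q_mem_Clog.memP
  have hq0 : ∀ x, 0 ≤ q x := fun x => (zero_lt_one.trans (hqP.one_lt_apply x)).le
  have hr0 : ∀ x, 0 ≤ r x := fun x => (zero_lt_one.trans (h.r_mem_P.one_lt_apply x)).le
  set T := essSup q (haar p n)
  have h3T : (3 : ℝ≥0∞) ^ T ≠ ∞ :=
    ENNReal.rpow_ne_top_of_nonneg ((hq0 0).trans (hqP.apply_le 0)) (by simp)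
  refine ⟨3 ^ T * (K₁ + K₂ + K₃), ENNReal.mul_ne_top h3T (ENNReal.add_ne_top.2
    ⟨ENNReal.add_ne_top.2 ⟨hK₁, hK₂⟩, hK₃⟩), fun F hF hFr => ?_⟩
  have hS : NullMeasurableSet {x | 1 < F x} (haar p n) := nullMeasurableSet_lt aemeasurable_const hF
  set F₁ : Qpn p n → ℝ≥0∞ := {x | 1 < F x}.indicator F
  set F₂ : Qpn p n → ℝ≥0∞ := {x | 1 < F x}ᶜ.indicator F
  have hF₁01 : ∀ x, F₁ x = 0 ∨ 1 ≤ F₁ x := fun x =>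
    Set.indicator_rel_indicator (r := fun a _ => a = 0 ∨ 1 ≤ a) (g := 0) (Or.inl rfl)
      fun hx => Or.inr (le_of_lt hx)
  have hF₂1 : ∀ x, F₂ x ≤ 1 :=
    Set.indicator_le' (fun y hy => not_lt.1 hy) fun _ _ => zero_le
  have hF₁r := (lintegral_indicator_rpow_le hr0 {x | 1 < F x} F).trans hFr
  have hF₂r := (lintegral_indicator_rpow_le hr0 {x | 1 < F x}ᶜ F).trans hFr
  calc ∫⁻ x, fracMaxE s F x ^ q x ∂(haar p n)
      ≤ ∫⁻ x, 3 ^ T * (fracMaxSmall s F₁ x ^ q x + fracMaxE s (ballAvg 0 F₁) x ^ q x +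
          fracMaxE s F₂ x ^ q x) ∂(haar p n) := by
        refine lintegral_mono fun x => le_trans (ENNReal.rpow_le_rpow ?_ (hq0 x))
          (add_add_rpow_le (hq0 x) (hqP.apply_le x) _ _ _)
        conv_lhs => rw [← Set.indicator_self_add_compl {x | 1 < F x} F]
        exact fracMaxE_add_le s (hF.indicator₀ hS) x
    _ ≤ 3 ^ T * (K₁ + K₂ + K₃) := by
        rw [lintegral_const_mul' _ _ h3T,
          lintegral_add_right _ ((measurable_fracMaxE s F₂).pow hqP.measurable),
          lintegral_add_left ((measurable_fracMaxSmall s F₁).pow hqP.measurable)]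
        gcongr
        · exact hsmall F₁ (hF.indicator₀ hS) hF₁01 hF₁r
        · exact hlarge F₁ (hF.indicator₀ hS) hF₁01 hF₁r
        · exact hbounded F₂ (hF.indicator₀ hS.compl) hF₂1 hF₂r

/-! ### Luxemburg norms -/

lemma modular_eq_lintegral {q : Qpn p n → ℝ} (hq : ∀ x, 0 ≤ q x) (f : Qpn p n → ℝ) {η : ℝ}
    (hη : 0 < η) :
    modular q f η = ∫⁻ x, (‖f x‖ₑ / ENNReal.ofReal η) ^ q x ∂(haar p n) := by
  refine lintegral_congr fun x => ?_
  rw [← ENNReal.ofReal_rpow_of_nonneg (by positivity) (hq x),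
    ENNReal.ofReal_div_of_pos hη, Real.enorm_eq_ofReal_abs]

lemma luxNorm_le {q f : Qpn p n → ℝ} {η : ℝ} (hη : 0 < η) (h : modular q f η ≤ 1) :
    luxNorm q f ≤ ENNReal.ofReal η := iInf₂_le η ⟨hη, h⟩

lemma luxNorm_le_mul {q r f g : Qpn p n → ℝ} {C : ℝ} (hC : 0 < C)
    (h : ∀ η, 0 < η → modular r f η ≤ 1 → modular q g (C * η) ≤ 1) :
    luxNorm q g ≤ ENNReal.ofReal C * luxNorm r f := by
  have hC0 : ENNReal.ofReal C ≠ 0 := by simpa using hC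
  rw [mul_comm, ← ENNReal.div_le_iff_le_mul (Or.inl hC0) (Or.inl ENNReal.ofReal_ne_top)]
  refine le_iInf₂ fun η hη => ?_
  rw [ENNReal.div_le_iff_le_mul (Or.inl hC0) (Or.inl ENNReal.ofReal_ne_top),
    mul_comm, ← ENNReal.ofReal_mul hC.le]
  exact luxNorm_le (mul_pos hC hη.1) (h η hη.1 hη.2)

lemma lintegral_div_rpow_le_one {X : Type*} [MeasurableSpace X] {μ : Measure X} {q : X → ℝ}
    (hq : ∀ x, 1 ≤ q x) {G : X → ℝ≥0∞} {K : ℝ≥0∞} (hK1 : 1 ≤ K) (hK : K ≠ ∞)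
    (h : ∫⁻ x, G x ^ q x ∂μ ≤ K) : ∫⁻ x, (G x / K) ^ q x ∂μ ≤ 1 := by
  have hK0 : K ≠ 0 := (zero_lt_one.trans_le hK1).ne'
  calc ∫⁻ x, (G x / K) ^ q x ∂μ ≤ ∫⁻ x, K⁻¹ * G x ^ q x ∂μ := by
        refine lintegral_mono fun x => ?_
        rw [div_eq_mul_inv, ENNReal.mul_rpow_of_nonneg _ _ (zero_le_one.trans (hq x)), mul_comm]
        gcongr
        simpa using ENNReal.rpow_le_rpow_of_exponent_ge (ENNReal.inv_le_one.2 hK1) (hq x)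
    _ ≤ K⁻¹ * K := by
        rw [lintegral_const_mul' _ _ (ENNReal.inv_ne_top.2 hK0)]
        gcongr
    _ = 1 := ENNReal.inv_mul_cancel hK0 hK

lemma modular_mul_le_one {q : Qpn p n → ℝ} (hq : ∀ x, 1 ≤ q x) {f : Qpn p n → ℝ} {η K : ℝ}
    (hη : 0 < η) (hK : 1 ≤ K) (h : modular q f η ≤ ENNReal.ofReal K) :
    modular q f (K * η) ≤ 1 := by
  have hK0 : 0 < K := zero_lt_one.trans_le hK
  have hq0 : ∀ x, 0 ≤ q x := fun x => zero_le_one.trans (hq x)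
  rw [modular_eq_lintegral hq0 f hη] at h
  rw [modular_eq_lintegral hq0 f (mul_pos hK0 hη)]
  refine le_trans (le_of_eq (lintegral_congr fun x => ?_)) (lintegral_div_rpow_le_one hq
    (ENNReal.one_le_ofReal.2 hK) ENNReal.ofReal_ne_top h)
  rw [ENNReal.ofReal_mul hK0.le, div_eq_mul_inv, div_eq_mul_inv, div_eq_mul_inv, mul_assoc,
    ENNReal.mul_inv (Or.inl (by simpa using hK0)) (Or.inl ENNReal.ofReal_ne_top), mul_comm (_⁻¹)]

lemma MemLvar.exists_modular_le_one {q f : Qpn p n → ℝ} (hq : ∀ x, 1 ≤ q x) (h : MemLvar q f) :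
    ∃ η : ℝ, 0 < η ∧ modular q f η ≤ 1 := by
  obtain ⟨_, η, hη, hfin⟩ := h
  refine ⟨max 1 (modular q f η).toReal * η, by positivity,
    modular_mul_le_one hq hη (le_max_left _ _) ?_⟩
  rw [← ENNReal.ofReal_toReal hfin.ne]
  exact ENNReal.ofReal_le_ofReal (by simp)

lemma modular_indicator_one {q : Qpn p n → ℝ} (hq : ∀ x, 0 < q x) {B : Set (Qpn p n)}
    (hB : MeasurableSet B) {η : ℝ} (hη : 0 < η) :
    modular q (B.indicator fun _ => 1) η = ∫⁻ x in B, (ENNReal.ofReal η)⁻¹ ^ q x ∂(haar p n) := by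
  rw [modular_eq_lintegral (fun x => (hq x).le) _ hη, ← lintegral_indicator hB]
  refine lintegral_congr fun x => ?_
  by_cases hx : x ∈ B
  · simp [hx]
  · simp [hx, hq x]

lemma memLvar_indicator_pball {q : Qpn p n → ℝ} (hq : ∀ x, 0 < q x) (γ : ℤ) (a : Qpn p n) :
    MemLvar q ((pball γ a).indicator fun _ => 1) := by
  refine ⟨(measurable_const.indicator (measurableSet_pball γ a)).aestronglyMeasurable, 1, one_pos,
    ?_⟩
  rw [modular_indicator_one hq (measurableSet_pball γ a) one_pos]
  simp [haar_pball, (ballVol_ne_top p n γ).lt_top]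

-- Young's inequality with the conjugate exponents `1 / (r σ)` and `q / r`.
lemma half_mul_rpow_mul_rpow_le {σ r q : ℝ} (hσ : 0 ≤ σ) (hr : 1 ≤ r) (hq : 0 < q)
    (hrel : 1 / q = 1 / r - σ) (w u : ℝ≥0∞) :
    (2⁻¹ * (w ^ σ * u)) ^ r ≤ 2⁻¹ * (w + u ^ q) := by
  have hr0 : 0 < r := zero_lt_one.trans_le hr
  set M := max w (u ^ q)
  have hwM : w ^ σ ≤ M ^ σ := ENNReal.rpow_le_rpow (le_max_left _ _) hσ
  have huM : u ≤ M ^ (1 / q) := by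
    rw [one_div, ENNReal.le_rpow_inv_iff hq]
    exact le_max_right _ _
  have hexp : (σ + 1 / q) * r = 1 := by
    rw [hrel, add_sub_cancel, one_div_mul_cancel hr0.ne']
  have hhalf : (2⁻¹ : ℝ≥0∞) ^ r ≤ 2⁻¹ := by
    simpa using ENNReal.rpow_le_rpow_of_exponent_ge
      (ENNReal.inv_le_one.2 one_le_two : (2⁻¹ : ℝ≥0∞) ≤ 1) hr
  calc (2⁻¹ * (w ^ σ * u)) ^ r ≤ 2⁻¹ * (M ^ σ * M ^ (1 / q)) ^ r := by
        rw [ENNReal.mul_rpow_of_nonneg _ _ hr0.le]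
        gcongr
    _ = 2⁻¹ * M := by
        rw [← ENNReal.rpow_add_of_nonneg _ _ hσ (by positivity), ← ENNReal.rpow_mul, hexp,
          ENNReal.rpow_one]
    _ ≤ 2⁻¹ * (w + u ^ q) := by
        gcongr
        exact max_le le_self_add le_add_self

lemma AdmissiblePair.luxNorm_indicator_le {s : ℝ} (hs : 0 ≤ s) {r q : Qpn p n → ℝ}
    (h : AdmissiblePair s r q) (γ : ℤ) (a : Qpn p n) :
    luxNorm r ((pball γ a).indicator fun _ => 1) ≤
      2 * ballVol p n γ ^ (s / n) * luxNorm q ((pball γ a).indicator fun _ => 1) := by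
  have hr1 := h.r_mem_P.one_lt_apply
  have hr0 : ∀ x, 0 < r x := fun x => zero_lt_one.trans (hr1 x)
  have hq0 : ∀ x, 0 < q x := fun x => zero_lt_one.trans (h.q_mem_Clog.memP.one_lt_apply x)
  have hB := measurableSet_pball γ a
  have hV0 := ballVol_ne_zero p n γ
  have hVt := ballVol_ne_top p n γ
  have hσ : 0 ≤ s / n := by positivity
  set V := ballVol p n γ with hV
  have hVσ0 : V ^ (s / n) ≠ 0 := ballVol_rpow_ne_zero p n γ _
  have hVσt : V ^ (s / n) ≠ ∞ := ballVol_rpow_ne_top p n γ _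
  have hc : ENNReal.ofReal (2 * V ^ (s / n)).toReal = 2 * V ^ (s / n) :=
    ENNReal.ofReal_toReal (ENNReal.mul_ne_top (by simp) hVσt)
  have hc0 : 0 < (2 * V ^ (s / n)).toReal :=
    ENNReal.toReal_pos (mul_ne_zero two_ne_zero hVσ0) (ENNReal.mul_ne_top (by simp) hVσt)
  rw [← hc]
  refine luxNorm_le_mul hc0 fun η hη hmod => ?_
  rw [modular_indicator_one hq0 hB hη] at hmod
  rw [modular_indicator_one hr0 hB (mul_pos hc0 hη), ENNReal.ofReal_mul hc0.le, hc]
  set u : ℝ≥0∞ := (ENNReal.ofReal η)⁻¹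
  have hinv : (2 * V ^ (s / n) * ENNReal.ofReal η)⁻¹ = 2⁻¹ * ((V⁻¹) ^ (s / n) * u) := by
    rw [mul_assoc, ENNReal.mul_inv (Or.inl (by simp)) (Or.inl (by simp)),
      ENNReal.mul_inv (Or.inl hVσ0) (Or.inl hVσt), ENNReal.inv_rpow]
  calc ∫⁻ x in pball γ a, (2 * V ^ (s / n) * ENNReal.ofReal η)⁻¹ ^ r x ∂(haar p n)
      ≤ ∫⁻ x in pball γ a, 2⁻¹ * (V⁻¹ + u ^ q x) ∂(haar p n) := by
        rw [hinv]
        exact lintegral_mono fun x =>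
          half_mul_rpow_mul_rpow_le hσ (hr1 x).le (hq0 x) (h.rel x) V⁻¹ u
    _ ≤ 2⁻¹ * (1 + 1) := by
        rw [lintegral_const_mul' _ _ (by simp), lintegral_add_left measurable_const,
          setLIntegral_const, haar_pball, ← hV, ENNReal.inv_mul_cancel hV0 hVt]
        gcongr
    _ = 1 := by rw [one_add_one_eq_two, ENNReal.inv_mul_cancel (by simp) (by simp)]

lemma memClog_const {c : ℝ} (hc : 1 < c) : MemClog (fun _ : Qpn p n => c) := by
  have hhaar : haar p n ≠ 0 := NeZero.ne _
  have hball : ∀ (γ : ℤ) (x : Qpn p n), (haar p n).restrict (pball γ x) ≠ 0 := fun γ x =>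
    ae_neBot.1 (neBot_ae_pball γ x)
  refine ⟨⟨measurable_const, ?_, ?_, ?_⟩, ⟨1, one_pos, ?_⟩, ⟨1, one_pos, ?_⟩⟩
  · rwa [essInf_const c hhaar]
  · intro x
    rw [essInf_const c hhaar]
  · intro x
    rw [essSup_const c hhaar]
  · intro γ x
    rw [essInf_const c (hball γ x), essSup_const c (hball γ x), sub_self, mul_zero]
    exact zero_le_one
  · intro x y
    rw [sub_self, abs_zero]
    have := one_le_logb_prime_add (p := p) (le_min (norm_nonneg x) (norm_nonneg y))
    positivity

variable (p n) in
lemma exists_admissiblePair {s : ℝ} (hs : 0 < s) (hsn : s < n) :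
    ∃ r q : Qpn p n → ℝ, AdmissiblePair s r q := by
  have hn : (0 : ℝ) < n := hs.trans hsn
  obtain ⟨c, hc1, hcs⟩ := exists_between ((one_lt_div hs).2 hsn)
  have hc0 : 0 < c := zero_lt_one.trans hc1
  have hpos : 0 < 1 / c - s / n := by
    rw [sub_pos, ← one_div_div (n : ℝ) s]
    exact one_div_lt_one_div_of_lt hc0 hcs
  have hlt : 1 / c - s / n < 1 :=
    (sub_lt_self _ (div_pos hs hn)).trans ((div_lt_one hc0).2 hc1)
  refine ⟨fun _ => c, fun _ => 1 / (1 / c - s / n), memClog_const hc1,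
    memClog_const ((one_lt_div hpos).2 hlt), (memClog_const hc1).memP, ?_, fun _ => ?_⟩
  · rwa [essSup_const c (NeZero.ne _)]
  · rw [one_div_one_div]

/-! ### Commutators with Lipschitz functions -/

lemma ballAvg_const_mul {c : ℝ≥0∞} (hc : c ≠ ∞) (γ : ℤ) (F : Qpn p n → ℝ≥0∞) (x : Qpn p n) :
    ballAvg γ (fun y => c * F y) x = c * ballAvg γ F x := by
  rw [ballAvg, ballAvg, lintegral_const_mul' _ _ hc, mul_div_assoc]

lemma hlMax_const_mul {c : ℝ≥0∞} (hc : c ≠ ∞) (F : Qpn p n → ℝ≥0∞) (x : Qpn p n) :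
    hlMax (fun y => c * F y) x = c * hlMax F x := by
  simp only [hlMax, ballAvg_const_mul hc, ENNReal.mul_iSup]

lemma fracMaxE_const_mul {c : ℝ≥0∞} (hc : c ≠ ∞) (s : ℝ) (F : Qpn p n → ℝ≥0∞) (x : Qpn p n) :
    fracMaxE s (fun y => c * F y) x = c * fracMaxE s F x := by
  simp only [fracMaxE, ballAvg_const_mul hc, ENNReal.mul_iSup, mul_left_comm]

lemma fracMaxE_congr_ae {F G : Qpn p n → ℝ≥0∞} (h : F =ᵐ[haar p n] G) (s : ℝ) (x : Qpn p n) :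
    fracMaxE s F x = fracMaxE s G x :=
  iSup_congr fun γ => by rw [ballAvg_congr_ae h]

lemma fracMax_mul_congr_ae {b b' : Qpn p n → ℝ} (h : b =ᵐ[haar p n] b') (s : ℝ)
    (f : Qpn p n → ℝ) (x : Qpn p n) :
    fracMax s (fun y => b y * f y) x = fracMax s (fun y => b' y * f y) x := by
  rw [fracMax_eq_fracMaxE, fracMax_eq_fracMaxE]
  exact fracMaxE_congr_ae (h.mono fun y hy => congrArg (‖· * f y‖ₑ) hy) s x

lemma commutator_congr_ae {s : ℝ} {b b' f : Qpn p n → ℝ} (h : b =ᵐ[haar p n] b') :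
    commutator s b f =ᵐ[haar p n] commutator s b' f := by
  filter_upwards [h] with x hx
  rw [commutator, commutator, hx, fracMax_mul_congr_ae h]

lemma measurable_commutator {s : ℝ} {b : Qpn p n → ℝ} (hb : Measurable b) (f : Qpn p n → ℝ) :
    Measurable (commutator s b f) := by
  have hmax (g : Qpn p n → ℝ) : Measurable fun x => (fracMax s g x).toReal := by
    simp only [fracMax_eq_fracMaxE]
    exact (measurable_fracMaxE s _).ennreal_toReal
  exact (hb.mul (hmax f)).sub (hmax _)

variable (p) in
lemma ballVol_rpow_div (hn : 0 < n) (γ : ℤ) (β : ℝ) :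
    ballVol p n γ ^ (β / n) = ENNReal.ofReal (((p : ℝ) ^ γ) ^ β) := by
  have hn' : (n : ℝ) ≠ 0 := by exact_mod_cast hn.ne'
  have hexp : n * γ * (β / n) = γ * β := by field_simp
  rw [ballVol, ← ENNReal.rpow_mul, hexp, ← Real.rpow_intCast,
    ← Real.rpow_mul (prime_real_pos p).le, ← ENNReal.ofReal_rpow_of_pos (prime_real_pos p),
    ENNReal.ofReal_natCast]

variable (p n) in
lemma ballVol_rpow_add (γ : ℤ) (α β : ℝ) :
    ballVol p n γ ^ ((α + β) / n) = ballVol p n γ ^ (α / n) * ballVol p n γ ^ (β / n) := by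
  rw [add_div, ENNReal.rpow_add _ _ (ballVol_ne_zero p n γ) (ballVol_ne_top p n γ)]

lemma enorm_sub_le_lipNorm {β : ℝ} (hβ : 0 ≤ β) (b : Qpn p n → ℝ) {γ : ℤ} {x y : Qpn p n}
    (h : y ∈ pball γ x) : ‖b x - b y‖ₑ ≤ lipNorm β b * ballVol p n γ ^ (β / n) := by
  rcases eq_or_ne x y with rfl | hne
  · simp
  have hn : 0 < n := Nat.pos_of_ne_zero fun hn => by
    subst hn
    exact hne (Subsingleton.elim x y)
  have hpos : 0 < ‖x - y‖ := norm_pos_iff.2 (sub_ne_zero.2 hne)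
  have hlip : ENNReal.ofReal (|b x - b y| / ‖x - y‖ ^ β) ≤ lipNorm β b :=
    le_iSup_of_le x (le_iSup_of_le y (le_iSup_of_le hne le_rfl))
  have hdist : ‖x - y‖ ≤ (p : ℝ) ^ γ := mem_pball.1 (mem_pball_comm.1 h)
  calc ‖b x - b y‖ₑ = ENNReal.ofReal (|b x - b y| / ‖x - y‖ ^ β) *
        ENNReal.ofReal (‖x - y‖ ^ β) := by
        rw [← ENNReal.ofReal_mul (by positivity), div_mul_cancel₀ _ (by positivity),
          Real.enorm_eq_ofReal_abs]
    _ ≤ lipNorm β b * ballVol p n γ ^ (β / n) := by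
        rw [ballVol_rpow_div p hn]
        gcongr

lemma enorm_le_add_lipNorm {β : ℝ} (hβ : 0 ≤ β) (b : Qpn p n → ℝ) {γ : ℤ} {x y : Qpn p n}
    (h : y ∈ pball γ x) : ‖b x‖ₑ ≤ ‖b y‖ₑ + lipNorm β b * ballVol p n γ ^ (β / n) :=
  calc ‖b x‖ₑ = ‖b y + (b x - b y)‖ₑ := by rw [add_sub_cancel]
    _ ≤ ‖b y‖ₑ + ‖b x - b y‖ₑ := enorm_add_le _ _
    _ ≤ ‖b y‖ₑ + lipNorm β b * ballVol p n γ ^ (β / n) := by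
        gcongr
        exact enorm_sub_le_lipNorm hβ b h

lemma fracMaxE_mul_le {α β : ℝ} (hβ : 0 ≤ β) {b : Qpn p n → ℝ} (hb : lipNorm β b ≠ ∞)
    (F : Qpn p n → ℝ≥0∞) (x : Qpn p n) :
    fracMaxE α (fun y => ‖b y‖ₑ * F y) x ≤
      ‖b x‖ₑ * fracMaxE α F x + lipNorm β b * fracMaxE (α + β) F x := by
  refine iSup_le fun γ => ?_
  set L := lipNorm β b
  set V := ballVol p n γ with hV
  have hc : ‖b x‖ₑ + L * V ^ (β / n) ≠ ∞ :=
    ENNReal.add_ne_top.2 ⟨enorm_ne_top, ENNReal.mul_ne_top hb (ballVol_rpow_ne_top p n γ _)⟩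
  have havg : ballAvg γ (fun y => ‖b y‖ₑ * F y) x ≤
      (‖b x‖ₑ + L * V ^ (β / n)) * ballAvg γ F x := by
    rw [← ballAvg_const_mul hc]
    refine ballAvg_mono_ae ?_
    filter_upwards [ae_restrict_mem (measurableSet_pball γ x)] with y hy
    gcongr
    exact enorm_le_add_lipNorm hβ b (mem_pball_comm.1 hy)
  calc V ^ (α / n) * ballAvg γ (fun y => ‖b y‖ₑ * F y) x
      ≤ V ^ (α / n) * ((‖b x‖ₑ + L * V ^ (β / n)) * ballAvg γ F x) := by gcongr
    _ = ‖b x‖ₑ * (V ^ (α / n) * ballAvg γ F x) + L * (V ^ ((α + β) / n) * ballAvg γ F x) := by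
        rw [hV, ballVol_rpow_add]
        ring
    _ ≤ ‖b x‖ₑ * fracMaxE α F x + L * fracMaxE (α + β) F x := by
        gcongr
        · exact le_fracMaxE α γ F x
        · exact le_fracMaxE (α + β) γ F x

lemma mul_fracMaxE_le {α β : ℝ} (hβ : 0 ≤ β) {b : Qpn p n → ℝ} (hb : lipNorm β b ≠ ∞)
    {F : Qpn p n → ℝ≥0∞} (hF : AEMeasurable F (haar p n)) (x : Qpn p n) :
    ‖b x‖ₑ * fracMaxE α F x ≤
      fracMaxE α (fun y => ‖b y‖ₑ * F y) x + lipNorm β b * fracMaxE (α + β) F x := by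
  rw [fracMaxE, ENNReal.mul_iSup]
  refine iSup_le fun γ => ?_
  set L := lipNorm β b
  set V := ballVol p n γ with hV
  have havg : ‖b x‖ₑ * ballAvg γ F x ≤
      L * V ^ (β / n) * ballAvg γ F x + ballAvg γ (fun y => ‖b y‖ₑ * F y) x := by
    rw [← ballAvg_const_mul (ENNReal.mul_ne_top hb (ballVol_rpow_ne_top p n γ _)),
      ← ballAvg_const_mul enorm_ne_top, ← ballAvg_add (hF.const_mul _)]
    refine ballAvg_mono_ae ?_
    filter_upwards [ae_restrict_mem (measurableSet_pball γ x)] with y hy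
    rw [← add_mul, add_comm]
    gcongr
    exact enorm_le_add_lipNorm hβ b hy
  calc ‖b x‖ₑ * (V ^ (α / n) * ballAvg γ F x) = V ^ (α / n) * (‖b x‖ₑ * ballAvg γ F x) := by ring
    _ ≤ V ^ (α / n) * (L * V ^ (β / n) * ballAvg γ F x +
          ballAvg γ (fun y => ‖b y‖ₑ * F y) x) := by gcongr
    _ = V ^ (α / n) * ballAvg γ (fun y => ‖b y‖ₑ * F y) x +
          L * (V ^ ((α + β) / n) * ballAvg γ F x) := by
        rw [hV, ballVol_rpow_add]
        ring
    _ ≤ fracMaxE α (fun y => ‖b y‖ₑ * F y) x + L * fracMaxE (α + β) F x := by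
        gcongr
        · exact le_fracMaxE α γ _ x
        · exact le_fracMaxE (α + β) γ F x

lemma enorm_mul_toReal_sub_toReal_le {t : ℝ} (ht : 0 ≤ t) {A A' R : ℝ≥0∞} (hA : A ≠ ∞)
    (hA' : A' ≠ ∞) (hle : A' ≤ ‖t‖ₑ * A + R) (hge : ‖t‖ₑ * A ≤ A' + R) :
    ‖t * A.toReal - A'.toReal‖ₑ ≤ R := by
  rcases eq_or_ne R ∞ with rfl | hR
  · exact le_top
  lift A to ℝ≥0 using hA
  lift A' to ℝ≥0 using hA'
  lift R to ℝ≥0 using hR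
  lift t to ℝ≥0 using ht
  have hnorm : ‖(t : ℝ)‖ₑ = t := by simp [enorm_eq_nnnorm]
  rw [hnorm] at hle hge
  norm_cast at hle hge
  rw [Real.enorm_eq_ofReal_abs, ENNReal.ofReal_le_coe, ENNReal.coe_toReal, ENNReal.coe_toReal,
    abs_le]
  rw [← NNReal.coe_le_coe] at hle hge
  push_cast at hle hge
  constructor <;> linarith

lemma enorm_commutator_le {α β : ℝ} (hβ : 0 ≤ β) {b f : Qpn p n → ℝ} (hb : lipNorm β b ≠ ∞)
    (hf : AEStronglyMeasurable f (haar p n)) {x : Qpn p n} (hbx : 0 ≤ b x)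
    (hfin : fracMax α f x < ∞) (hfin' : fracMax α (fun y => b y * f y) x < ∞) :
    ‖commutator α b f x‖ₑ ≤ lipNorm β b * fracMaxE (α + β) (fun y => ‖f y‖ₑ) x := by
  refine enorm_mul_toReal_sub_toReal_le hbx hfin.ne hfin'.ne ?_ ?_ <;>
    simp only [fracMax_eq_fracMaxE, enorm_mul]
  · exact fracMaxE_mul_le hβ hb _ x
  · exact mul_fracMaxE_le hβ hb hf.enorm x

lemma fracMaxE_le_add_hlMax {α β : ℝ} (hα : 0 ≤ α) (hβ : 0 ≤ β) (F : Qpn p n → ℝ≥0∞)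
    (x : Qpn p n) : fracMaxE α F x ≤ fracMaxE (α + β) F x + hlMax F x := by
  refine iSup_le fun γ => ?_
  rcases le_total 0 γ with hγ | hγ
  · have hV : 1 ≤ ballVol p n γ := ballVol_zero p n ▸ ballVol_mono p n hγ
    refine le_add_right (le_trans ?_ (le_fracMaxE (α + β) γ F x))
    gcongr
    exact le_add_of_nonneg_right hβ
  · have hV : ballVol p n γ ≤ 1 := ballVol_zero p n ▸ ballVol_mono p n hγ
    exact le_add_left <|
      (mul_le_of_le_one_left zero_le (ENNReal.rpow_le_one hV (by positivity))).trans
        (ballAvg_le_hlMax γ F x)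

lemma MemLvar.ae_hlMax_lt_top (hn : 0 < n) {r f : Qpn p n → ℝ} (hr : ∀ x, 1 ≤ r x)
    (hrm : Measurable r) (hf : MemLvar r f) :
    ∀ᵐ x ∂(haar p n), hlMax (fun y => ‖f y‖ₑ) x < ∞ := by
  obtain ⟨hfm, η, hη, hmod⟩ := hf
  have hη0 : ENNReal.ofReal η ≠ 0 := by simpa using hη
  rw [modular_eq_lintegral (fun x => zero_le_one.trans (hr x)) f hη] at hmod
  have hle : (fun y => ‖f y‖ₑ) ≤
      fun y => ENNReal.ofReal η * (1 + (‖f y‖ₑ / ENNReal.ofReal η) ^ r y) := by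
    intro y
    rw [← ENNReal.div_le_iff' hη0 ENNReal.ofReal_ne_top]
    exact le_one_add_rpow _ (hr y)
  filter_upwards [PadicVar.ae_hlMax_lt_top hn
    ((hfm.enorm.div_const _).pow hrm.aemeasurable) hmod.ne] with x hx
  refine (hlMax_mono hle x).trans_lt ?_
  rw [hlMax_const_mul ENNReal.ofReal_ne_top]
  exact ENNReal.mul_lt_top ENNReal.ofReal_lt_top
    ((hlMax_add_const_le 1 x).trans_lt (ENNReal.add_lt_top.2 ⟨ENNReal.one_lt_top, hx⟩))

lemma AdmissiblePair.exists_lintegral_fracMaxE_div_le (hn : 0 < n) {s : ℝ} (hs : 0 ≤ s)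
    {r q : Qpn p n → ℝ} (h : AdmissiblePair s r q) :
    ∃ K : ℝ≥0∞, K ≠ ∞ ∧ ∀ f : Qpn p n → ℝ, AEStronglyMeasurable f (haar p n) →
      ∀ η, 0 < η → modular r f η ≤ 1 →
        ∫⁻ x, (fracMaxE s (fun y => ‖f y‖ₑ) x / ENNReal.ofReal η) ^ q x ∂(haar p n) ≤ K := by
  obtain ⟨K, hK, hmax⟩ := h.exists_lintegral_fracMaxE_le hn hs
  refine ⟨K, hK, fun f hf η hη hmod => ?_⟩
  have hη' : (ENNReal.ofReal η)⁻¹ ≠ ∞ := ENNReal.inv_ne_top.2 (by simpa using hη)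
  rw [modular_eq_lintegral (fun x => (zero_lt_one.trans (h.r_mem_P.one_lt_apply x)).le) f hη]
    at hmod
  simp only [ENNReal.div_eq_inv_mul] at hmod ⊢
  simpa only [fracMaxE_const_mul hη'] using hmax _ (hf.enorm.const_mul _) hmod

lemma AdmissiblePair.ae_fracMaxE_lt_top (hn : 0 < n) {s : ℝ} (hs : 0 ≤ s)
    {r q f : Qpn p n → ℝ} (h : AdmissiblePair s r q) (hf : MemLvar r f) :
    ∀ᵐ x ∂(haar p n), fracMaxE s (fun y => ‖f y‖ₑ) x < ∞ := by
  obtain ⟨K, hK, hmax⟩ := h.exists_lintegral_fracMaxE_div_le hn hs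
  obtain ⟨η, hη, hmod⟩ :=
    hf.exists_modular_le_one fun x => (h.r_mem_P.one_lt_apply x).le
  have hqP := h.q_mem_Clog.memP
  have hpow := ae_lt_top (((measurable_fracMaxE s fun y => ‖f y‖ₑ).div_const _).pow hqP.measurable)
    ((hmax f hf.1 η hη hmod).trans_lt hK.lt_top).ne
  filter_upwards [hpow] with x hx
  have hq : 0 < q x := zero_lt_one.trans (hqP.one_lt_apply x)
  rw [ENNReal.rpow_lt_top_iff_of_pos hq] at hx
  exact lt_top_iff_ne_top.2 fun htop =>
    hx.ne (htop ▸ ENNReal.top_div_of_ne_top ENNReal.ofReal_ne_top)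

lemma AdmissiblePair.ae_fracMax_lt_top (hn : 0 < n) {α β : ℝ} (hα : 0 ≤ α) (hβ : 0 ≤ β)
    {r q f : Qpn p n → ℝ} (h : AdmissiblePair (α + β) r q) (hf : MemLvar r f) :
    ∀ᵐ x ∂(haar p n), fracMax α f x < ∞ := by
  filter_upwards [h.ae_fracMaxE_lt_top hn (add_nonneg hα hβ) hf,
    hf.ae_hlMax_lt_top hn (fun x => (h.r_mem_P.one_lt_apply x).le) h.r_mem_P.measurable]
    with x hfrac hhl
  rw [fracMax_eq_fracMaxE]
  exact (fracMaxE_le_add_hlMax hα hβ _ x).trans_lt (ENNReal.add_lt_top.2 ⟨hfrac, hhl⟩)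

lemma AdmissiblePair.ae_fracMax_mul_lt_top (hn : 0 < n) {α β : ℝ} (hα : 0 ≤ α) (hβ : 0 ≤ β)
    {b r q f : Qpn p n → ℝ} (hb : lipNorm β b ≠ ∞) (h : AdmissiblePair (α + β) r q)
    (hf : MemLvar r f) : ∀ᵐ x ∂(haar p n), fracMax α (fun y => b y * f y) x < ∞ := by
  filter_upwards [h.ae_fracMax_lt_top hn hα hβ hf,
    h.ae_fracMaxE_lt_top hn (add_nonneg hα hβ) hf] with x hα_fin hs_fin
  rw [fracMax_eq_fracMaxE] at hα_fin ⊢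
  simp only [enorm_mul]
  exact (fracMaxE_mul_le hβ hb _ x).trans_lt (ENNReal.add_lt_top.2
    ⟨ENNReal.mul_lt_top enorm_lt_top hα_fin, ENNReal.mul_lt_top hb.lt_top hs_fin⟩)

lemma modular_mul_le_of_enorm_le {q g : Qpn p n → ℝ} (hq : ∀ x, 0 ≤ q x) {G : Qpn p n → ℝ≥0∞}
    {c η : ℝ} (hc : 0 < c) (hη : 0 < η)
    (h : ∀ᵐ x ∂(haar p n), ‖g x‖ₑ ≤ ENNReal.ofReal c * G x) :
    modular q g (c * η) ≤ ∫⁻ x, (G x / ENNReal.ofReal η) ^ q x ∂(haar p n) := by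
  rw [modular_eq_lintegral hq g (mul_pos hc hη)]
  refine lintegral_mono_ae ?_
  filter_upwards [h] with x hx
  refine ENNReal.rpow_le_rpow ?_ (hq x)
  rw [ENNReal.ofReal_mul hc.le]
  calc ‖g x‖ₑ / (ENNReal.ofReal c * ENNReal.ofReal η)
      ≤ ENNReal.ofReal c * G x / (ENNReal.ofReal c * ENNReal.ofReal η) := by gcongr
    _ = G x / ENNReal.ofReal η :=
        ENNReal.mul_div_mul_left _ _ (by simpa using hc) ENNReal.ofReal_ne_top

theorem commutatorBounded_of_memLip {α β : ℝ} (hn : 0 < n) (hα : 0 ≤ α) (hβ : 0 ≤ β)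
    {b b₀ r q : Qpn p n → ℝ} (hbb : b =ᵐ[haar p n] b₀) (hb : MemLip β b₀) (hb0 : ∀ x, 0 ≤ b₀ x)
    (h : AdmissiblePair (α + β) r q) : CommutatorBounded α b r q := by
  obtain ⟨K, hK, hmax⟩ := h.exists_lintegral_fracMaxE_div_le hn (add_nonneg hα hβ)
  have hq1 : ∀ x, 1 ≤ q x := fun x => (h.q_mem_Clog.memP.one_lt_apply x).le
  let c : ℝ := (lipNorm β b₀).toReal + 1
  let K' : ℝ := K.toReal + 1
  have hc0 : 0 < c := by positivity
  have hK'1 : 1 ≤ K' := le_add_of_nonneg_left ENNReal.toReal_nonneg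
  have hC0 : 0 < K' * c := by positivity
  have hLc : lipNorm β b₀ ≤ ENNReal.ofReal c :=
    (ENNReal.le_ofReal_iff_toReal_le hb.2.ne hc0.le).2 (le_add_of_nonneg_right zero_le_one)
  have hKK' : K ≤ ENNReal.ofReal K' :=
    (ENNReal.le_ofReal_iff_toReal_le hK (by positivity)).2 (le_add_of_nonneg_right zero_le_one)
  refine ⟨(K' * c).toNNReal, fun f hf => ?_⟩
  have hfin := h.ae_fracMax_lt_top hn hα hβ hf
  have hfin' := h.ae_fracMax_mul_lt_top hn hα hβ hb.2.ne hf
  have hcomm : ∀ᵐ x ∂(haar p n), ‖commutator α b f x‖ₑ ≤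
      ENNReal.ofReal c * fracMaxE (α + β) (fun y => ‖f y‖ₑ) x := by
    filter_upwards [hfin, hfin', commutator_congr_ae hbb] with x hx hx' heq
    rw [heq]
    exact (enorm_commutator_le hβ hb.2.ne hf.1 (hb0 x) hx hx').trans (by gcongr)
  have hbound : ∀ η, 0 < η → modular r f η ≤ 1 →
      modular q (commutator α b f) (K' * c * η) ≤ 1 := fun η hη hmod => by
    rw [mul_assoc]
    exact modular_mul_le_one hq1 (by positivity) hK'1
      ((modular_mul_le_of_enorm_le (fun x => zero_le_one.trans (hq1 x)) hc0 hη hcomm).trans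
        ((hmax f hf.1 η hη hmod).trans hKK'))
  obtain ⟨η, hη, hmod⟩ := hf.exists_modular_le_one fun x => (h.r_mem_P.one_lt_apply x).le
  refine ⟨?_, ⟨?_, K' * c * η, by positivity, (hbound η hη hmod).trans_lt ENNReal.one_lt_top⟩,
    luxNorm_le_mul hC0 hbound⟩
  · filter_upwards [hfin, hfin'] with x hx hx'
    exact ⟨hx, by rwa [fracMax_mul_congr_ae hbb]⟩
  · exact (measurable_commutator hb.1 f).aestronglyMeasurable.congr (commutator_congr_ae hbb).symm

/-! ### Testing on characteristic functions of balls -/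

lemma fracMaxOn_eq_iSup (s : ℝ) (S : Set (Qpn p n)) (f : Qpn p n → ℝ) (x : Qpn p n) :
    fracMaxOn s S f x = ⨆ (γ : ℤ) (_ : pball γ x ⊆ S),
      ballVol p n γ ^ (s / n) * ballAvg γ (fun y => ‖f y‖ₑ) x :=
  iSup_congr fun γ => iSup_congr fun _ => setLIntegral_div_rpow_eq s γ _ x

lemma le_fracMaxOn (s : ℝ) {S : Set (Qpn p n)} (f : Qpn p n → ℝ) {γ : ℤ} {x : Qpn p n}
    (h : pball γ x ⊆ S) :
    ballVol p n γ ^ (s / n) * ballAvg γ (fun y => ‖f y‖ₑ) x ≤ fracMaxOn s S f x := by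
  rw [fracMaxOn_eq_iSup]
  exact le_iSup₂_of_le γ h le_rfl

lemma ballAvg_indicator_of_subset {γ : ℤ} {x : Qpn p n} {S : Set (Qpn p n)} (h : pball γ x ⊆ S)
    (F : Qpn p n → ℝ≥0∞) : ballAvg γ (S.indicator F) x = ballAvg γ F x := by
  rw [ballAvg, ballAvg, setLIntegral_congr_fun (measurableSet_pball γ x) fun y hy =>
    Set.indicator_of_mem (h hy) F]

lemma ballVol_rpow_mul_ballAvg_indicator_le {s : ℝ} (hs : s ≤ n) {γ γ' : ℤ} (h : γ ≤ γ')
    (F : Qpn p n → ℝ≥0∞) (x : Qpn p n) :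
    ballVol p n γ' ^ (s / n) * ballAvg γ' ((pball γ x).indicator F) x ≤
      ballVol p n γ ^ (s / n) * ballAvg γ F x := by
  rw [← setLIntegral_div_rpow_eq, ← setLIntegral_div_rpow_eq]
  refine ENNReal.div_le_div ?_ (ENNReal.rpow_le_rpow (measure_mono (pball_mono h x))
    (sub_nonneg.2 (div_le_one_of_le₀ hs n.cast_nonneg)))
  exact (setLIntegral_le_lintegral _ _).trans_eq (lintegral_indicator (measurableSet_pball γ x) F)

lemma fracMax_indicator_eq_fracMaxOn {s : ℝ} (hs : s ≤ n) (g : Qpn p n → ℝ) {γ : ℤ}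
    {a x : Qpn p n} (hx : x ∈ pball γ a) :
    fracMax s ((pball γ a).indicator g) x = fracMaxOn s (pball γ a) g x := by
  rw [← pball_eq_of_mem hx, fracMax_eq_fracMaxE]
  simp only [enorm_indicator_eq_indicator_enorm]
  apply le_antisymm
  · refine iSup_le fun γ' => ?_
    rcases le_total γ' γ with h | h
    · rw [ballAvg_indicator_of_subset (pball_mono h x)]
      exact le_fracMaxOn s g (pball_mono h x)
    · exact (ballVol_rpow_mul_ballAvg_indicator_le hs h _ x).trans (le_fracMaxOn s g le_rfl)
  · rw [fracMaxOn_eq_iSup]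
    refine iSup₂_le fun γ' h => ?_
    rw [← ballAvg_indicator_of_subset h]
    exact le_fracMaxE s γ' _ x

lemma fracMax_indicator_one {s : ℝ} (hs0 : 0 ≤ s) (hs : s ≤ n) {γ : ℤ} {a x : Qpn p n}
    (hx : x ∈ pball γ a) :
    fracMax s ((pball γ a).indicator fun _ => 1) x = ballVol p n γ ^ (s / n) := by
  rw [fracMax_indicator_eq_fracMaxOn hs _ hx, ← pball_eq_of_mem hx, fracMaxOn_eq_iSup]
  simp only [ballAvg_const, enorm_one, mul_one]
  refine le_antisymm (iSup₂_le fun γ' h => ?_) (le_iSup₂_of_le γ le_rfl le_rfl)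
  gcongr
  rw [← haar_pball γ' x, ← haar_pball γ x]
  exact measure_mono h

lemma oscFun_eq_indicator_commutator {α : ℝ} (hα0 : 0 ≤ α) (hα : α ≤ n) (b : Qpn p n → ℝ) (γ : ℤ)
    (a : Qpn p n) :
    oscFun α b (pball γ a) = (pball γ a).indicator fun x =>
      (ballVol p n γ).toReal ^ (-α / n) * commutator α b ((pball γ a).indicator fun _ => 1) x := by
  have hV : 0 < (ballVol p n γ).toReal :=
    ENNReal.toReal_pos (ballVol_ne_zero p n γ) (ballVol_ne_top p n γ)
  have hmul : (fun y => b y * (pball γ a).indicator (fun _ => 1) y) = (pball γ a).indicator b := by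
    simp only [← Set.indicator_mul_right, mul_one]
  refine Set.indicator_congr fun x hx => ?_
  rw [commutator, hmul, fracMax_indicator_one hα0 hα hx, fracMax_indicator_eq_fracMaxOn hα b hx,
    haar_pball, mul_sub, mul_left_comm, ← ENNReal.toReal_rpow, ← Real.rpow_add hV, neg_div,
    neg_add_cancel, Real.rpow_zero, mul_one]

lemma luxNorm_oscFun_le {α : ℝ} (hα0 : 0 ≤ α) (hα : α ≤ n) {q : Qpn p n → ℝ} (hq : ∀ x, 0 ≤ q x)
    (b : Qpn p n → ℝ) (γ : ℤ) (a : Qpn p n) :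
    luxNorm q (oscFun α b (pball γ a)) ≤ ballVol p n γ ^ (-α / n) *
      luxNorm q (commutator α b ((pball γ a).indicator fun _ => 1)) := by
  have hV : 0 < (ballVol p n γ).toReal :=
    ENNReal.toReal_pos (ballVol_ne_zero p n γ) (ballVol_ne_top p n γ)
  have hw : 0 < (ballVol p n γ).toReal ^ (-α / n) := Real.rpow_pos_of_pos hV _
  rw [← ENNReal.ofReal_toReal (ballVol_ne_top p n γ), ENNReal.ofReal_rpow_of_pos hV]
  refine luxNorm_le_mul hw fun η hη hmod => le_trans ?_ hmod
  rw [modular_eq_lintegral hq _ hη]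
  refine modular_mul_le_of_enorm_le hq hw hη (Eventually.of_forall fun x => ?_)
  rw [oscFun_eq_indicator_commutator hα0 hα, enorm_indicator_eq_indicator_enorm]
  refine (Set.indicator_le_self _ _ x).trans_eq ?_
  rw [enorm_mul, Real.enorm_of_nonneg hw.le]

theorem oscSup_lt_top_of_commutatorBounded {α β : ℝ} (hα : 0 ≤ α) (hαn : α ≤ n)
    (hαβ : 0 ≤ α + β) {b r q : Qpn p n → ℝ} (h : AdmissiblePair (α + β) r q)
    (hC : CommutatorBounded α b r q) : oscSup α β b q < ∞ := by
  obtain ⟨C, hC⟩ := hC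
  have hr0 : ∀ x, 0 < r x := fun x => zero_lt_one.trans (h.r_mem_P.one_lt_apply x)
  have hq0 : ∀ x, 0 ≤ q x := fun x => (zero_lt_one.trans (h.q_mem_Clog.memP.one_lt_apply x)).le
  refine lt_of_le_of_lt (b := 2 * (C : ℝ≥0∞)) (iSup₂_le fun γ a => ?_)
    (ENNReal.mul_lt_top (by simp) ENNReal.coe_lt_top)
  rw [haar_pball]
  set V := ballVol p n γ with hV
  set N := luxNorm q ((pball γ a).indicator fun _ => 1)
  have hcancel : V ^ (-α / n) * V ^ ((α + β) / n) = V ^ (β / n) := by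
    rw [hV, ← ballVol_rpow_add, neg_add_cancel_left]
  have hosc : luxNorm q (oscFun α b (pball γ a)) ≤ 2 * C * V ^ (β / n) * N := by
    calc luxNorm q (oscFun α b (pball γ a))
        ≤ V ^ (-α / n) * luxNorm q (commutator α b ((pball γ a).indicator fun _ => 1)) :=
          luxNorm_oscFun_le hα hαn hq0 b γ a
      _ ≤ V ^ (-α / n) * (C * luxNorm r ((pball γ a).indicator fun _ => 1)) := by
          gcongr
          exact (hC _ (memLvar_indicator_pball hr0 γ a)).2.2
      _ ≤ V ^ (-α / n) * (C * (2 * V ^ ((α + β) / n) * N)) := by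
          gcongr
          exact h.luxNorm_indicator_le hαβ γ a
      _ = 2 * C * (V ^ (-α / n) * V ^ ((α + β) / n)) * N := by ring
      _ = 2 * C * V ^ (β / n) * N := by rw [hcancel]
  calc 1 / V ^ (β / n) * (luxNorm q (oscFun α b (pball γ a)) / N)
      ≤ 1 / V ^ (β / n) * (2 * C * V ^ (β / n)) := by
        gcongr
        exact ENNReal.div_le_of_le_mul hosc
    _ = 2 * C := by
        rw [one_div, mul_left_comm, ENNReal.inv_mul_cancel (ballVol_rpow_ne_zero p n γ _)
          (ballVol_rpow_ne_top p n γ _), mul_one]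

/-! ### Means over balls and norms of characteristic functions -/

/-- A weight `w` comparable, up to the factor `K`, to `1 / ‖χ_B‖_{q(·)}` on the ball `B = B_γ(a)`:
the modular of `w χ_B` is at most `K`, and `K w` bounds the mean over `B` of every function whose
modular is at most `1`. -/
structure IsBallWeight (q : Qpn p n → ℝ) (K : ℝ≥0∞) (γ : ℤ) (a : Qpn p n) (w : ℝ≥0∞) : Prop where
  ne_zero : w ≠ 0
  ne_top : w ≠ ∞
  ballAvg_le : ∀ G : Qpn p n → ℝ≥0∞, AEMeasurable G (haar p n) →
    ∫⁻ x, G x ^ q x ∂(haar p n) ≤ 1 → ballAvg γ G a ≤ K * w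
  setLIntegral_rpow_le : ∫⁻ x in pball γ a, w ^ q x ∂(haar p n) ≤ K

lemma IsBallWeight.mono {q : Qpn p n → ℝ} {K K' : ℝ≥0∞} {γ : ℤ} {a : Qpn p n} {w : ℝ≥0∞}
    (h : IsBallWeight q K γ a w) (hK : K ≤ K') : IsBallWeight q K' γ a w :=
  ⟨h.ne_zero, h.ne_top, fun G hG hG1 => (h.ballAvg_le G hG hG1).trans (by gcongr),
    h.setLIntegral_rpow_le.trans hK⟩

variable (p n) in
lemma inv_ballVol_rpow_ne_zero (γ : ℤ) (s : ℝ) : (ballVol p n γ)⁻¹ ^ s ≠ 0 := by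
  rw [ENNReal.inv_rpow]
  exact ENNReal.inv_ne_zero.2 (ballVol_rpow_ne_top p n γ s)

variable (p n) in
lemma inv_ballVol_rpow_ne_top (γ : ℤ) (s : ℝ) : (ballVol p n γ)⁻¹ ^ s ≠ ∞ := by
  rw [ENNReal.inv_rpow, ← ENNReal.rpow_neg]
  exact ballVol_rpow_ne_top p n γ (-s)

lemma ballAvg_le_two_mul_inv_ballVol_rpow {q : Qpn p n → ℝ} {e : ℝ} (he : 1 ≤ e) {γ : ℤ}
    (hγ : γ ≤ 0) {a : Qpn p n} (heq : ∀ᵐ y ∂((haar p n).restrict (pball γ a)), e ≤ q y)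
    {G : Qpn p n → ℝ≥0∞} (hG : AEMeasurable G (haar p n))
    (hG1 : ∫⁻ x, G x ^ q x ∂(haar p n) ≤ 1) :
    ballAvg γ G a ≤ 2 * (ballVol p n γ)⁻¹ ^ (1 / e) := by
  have he0 : 0 < e := zero_lt_one.trans_le he
  have hV : 1 ≤ (ballVol p n γ)⁻¹ := by
    rw [ENNReal.one_le_inv, ← ballVol_zero p n]
    exact ballVol_mono p n hγ
  have hpow : ballAvg γ G a ^ e ≤ 2 * (ballVol p n γ)⁻¹ := by
    calc ballAvg γ G a ^ e ≤ ballAvg γ (fun y => G y ^ e) a := ballAvg_rpow_le hG he γ a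
      _ ≤ ballAvg γ (fun y => 1 + G y ^ q y) a := by
          refine ballAvg_mono_ae ?_
          filter_upwards [heq] with y hy
          exact rpow_le_one_add_rpow _ he0.le hy
      _ ≤ 1 + 1 / ballVol p n γ := by
          rw [ballAvg_add aemeasurable_const, ballAvg_const]
          gcongr
          exact (ballAvg_le_lintegral_div γ _ a).trans (by gcongr)
      _ ≤ (ballVol p n γ)⁻¹ + (ballVol p n γ)⁻¹ := by
          rw [one_div]
          gcongr
      _ = 2 * (ballVol p n γ)⁻¹ := (two_mul _).symm
  calc ballAvg γ G a ≤ (2 * (ballVol p n γ)⁻¹) ^ (1 / e) := by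
        rwa [one_div, ENNReal.le_rpow_inv_iff he0]
    _ = 2 ^ (1 / e) * (ballVol p n γ)⁻¹ ^ (1 / e) :=
        ENNReal.mul_rpow_of_nonneg _ _ (by positivity)
    _ ≤ 2 * (ballVol p n γ)⁻¹ ^ (1 / e) := by
        gcongr
        simpa only [ENNReal.rpow_one] using
          ENNReal.rpow_le_rpow_of_exponent_le one_le_two ((div_le_one he0).2 he)

lemma setLIntegral_inv_ballVol_neg_rpow_le {q : Qpn p n → ℝ} {e C : ℝ} (he : 1 ≤ e) {k : ℕ}
    {a : Qpn p n} (h : ∀ᵐ y ∂((haar p n).restrict (pball (-(k : ℤ)) a)),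
      e ≤ q y ∧ k * (q y - e) ≤ C) :
    ∫⁻ x in pball (-(k : ℤ)) a, ((ballVol p n (-(k : ℤ)))⁻¹ ^ (1 / e)) ^ q x ∂(haar p n) ≤
      (p : ℝ≥0∞) ^ (n * C) := by
  set V := ballVol p n (-(k : ℤ)) with hV
  have hV0 : V ≠ 0 := ballVol_ne_zero p n _
  have hVt : V ≠ ∞ := ballVol_ne_top p n _
  calc ∫⁻ x in pball (-(k : ℤ)) a, (V⁻¹ ^ (1 / e)) ^ q x ∂(haar p n)
      ≤ ∫⁻ _ in pball (-(k : ℤ)) a, V⁻¹ * (p : ℝ≥0∞) ^ (n * C) ∂(haar p n) := by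
        refine lintegral_mono_ae ?_
        filter_upwards [h] with y ⟨hey, hy⟩
        have hexp : 1 / e * q y = 1 + (q y - e) / e := by field_simp; ring
        rw [← ENNReal.rpow_mul, hexp, ENNReal.rpow_add _ _ (ENNReal.inv_ne_zero.2 hVt)
          (ENNReal.inv_ne_top.2 hV0), ENNReal.rpow_one]
        gcongr
        refine inv_ballVol_neg_rpow_le (le_trans ?_ hy)
        gcongr
        exact div_le_self (sub_nonneg.2 hey) he
    _ = (p : ℝ≥0∞) ^ (n * C) := by
        rw [setLIntegral_const, haar_pball, ← hV, mul_right_comm, ENNReal.inv_mul_cancel hV0 hVt,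
          one_mul]

-- `w = |B|^{-1/q₋(B)}`
lemma MemClog.exists_isBallWeight_of_nonpos {q : Qpn p n → ℝ} (hq : MemClog q) :
    ∃ K : ℝ≥0∞, K ≠ ∞ ∧ ∀ γ ≤ (0 : ℤ), ∀ a : Qpn p n, ∃ w, IsBallWeight q K γ a w := by
  obtain ⟨C, hloc⟩ := hq.exists_ae_pball_sub_ballInf_le
  have hpow : (p : ℝ≥0∞) ^ (n * C) ≠ ∞ :=
    ENNReal.rpow_ne_top_of_ne_zero (prime_ne_zero p) (ENNReal.natCast_ne_top p)
  refine ⟨2 + (p : ℝ≥0∞) ^ (n * C), ENNReal.add_ne_top.2 ⟨by simp, hpow⟩, fun γ hγ a => ?_⟩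
  obtain ⟨k, rfl⟩ := Int.exists_eq_neg_ofNat hγ
  have he : 1 ≤ ballInf q (-(k : ℤ)) a :=
    (hq.memP.one_lt.trans_le (hq.memP.essInf_le_ballInf _ a)).le
  refine ⟨_, inv_ballVol_rpow_ne_zero p n _ _, inv_ballVol_rpow_ne_top p n _ _,
    fun G hG hG1 => ?_, (setLIntegral_inv_ballVol_neg_rpow_le he (hloc k a)).trans le_add_self⟩
  refine (ballAvg_le_two_mul_inv_ballVol_rpow he hγ ((hloc k a).mono fun y hy => hy.1)
    hG hG1).trans ?_
  gcongr
  exact le_self_add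

/-- The constant by which a bounded function's modular changes when an exponent is replaced by its
limit at infinity, as in `lintegral_rpow_le_of_le_one`. -/
noncomputable def logLimitConst (p : ℕ) [Fact p.Prime] (n : ℕ) (C : ℝ) : ℝ≥0∞ :=
  ENNReal.ofReal ((p : ℝ) ^ ((n + 1) * C)) + ∫⁻ x : Qpn p n, decay x ∂(haar p n)

variable (p n) in
lemma logLimitConst_ne_top (C : ℝ) : logLimitConst p n C ≠ ∞ :=
  ENNReal.add_ne_top.2 ⟨ENNReal.ofReal_ne_top, lintegral_decay_ne_top p n⟩

lemma ballAvg_le_mul_inv_ballVol_rpow {q : Qpn p n → ℝ} (hqm : Measurable q) (hq : ∀ x, 1 ≤ q x)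
    {q₀ C : ℝ} (hq₀ : 1 ≤ q₀) (hlim : HasLogLimit q q₀ C) {γ : ℤ} (hγ : 0 ≤ γ) (a : Qpn p n)
    {G : Qpn p n → ℝ≥0∞} (hG : AEMeasurable G (haar p n))
    (hG1 : ∫⁻ x, G x ^ q x ∂(haar p n) ≤ 1) :
    ballAvg γ G a ≤ (logLimitConst p n C ^ (1 / q₀) + 1) * (ballVol p n γ)⁻¹ ^ (1 / q₀) := by
  have hq₀0 : 0 < q₀ := zero_lt_one.trans_le hq₀
  set V := ballVol p n γ
  set D := logLimitConst p n C with hD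
  have hV1 : V⁻¹ ≤ 1 := by
    rw [ENNReal.inv_le_one, ← ballVol_zero p n]
    exact ballVol_mono p n hγ
  have hmeas : AEMeasurable (fun y => min (G y) 1) (haar p n) := hG.min aemeasurable_const
  have hsplit : G ≤ fun y => min (G y) 1 + G y ^ q y := by
    intro y
    rcases le_total (G y) 1 with h | h
    · exact le_add_right (min_eq_left h).ge
    · exact le_add_left (by simpa using ENNReal.rpow_le_rpow_of_exponent_le h (hq y))
  have hsmall : ∫⁻ x, min (G x) 1 ^ q₀ ∂(haar p n) ≤ D := by
    refine (lintegral_rpow_le_of_le_one hq₀ hqm hlim hmeas fun x => min_le_right _ _).trans ?_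
    rw [hD, logLimitConst]
    gcongr
    refine mul_le_of_le_one_right zero_le (le_trans (lintegral_mono fun x => ?_) hG1)
    exact ENNReal.rpow_le_rpow (min_le_left _ _) (zero_le_one.trans (hq x))
  have hsmall_avg : ballAvg γ (fun y => min (G y) 1) a ≤ D ^ (1 / q₀) * V⁻¹ ^ (1 / q₀) := by
    rw [← ENNReal.mul_rpow_of_nonneg _ _ (by positivity), one_div, ENNReal.le_rpow_inv_iff hq₀0,
      ← div_eq_mul_inv, ENNReal.le_div_iff_mul_le (Or.inl (ballVol_ne_zero p n γ))
        (Or.inl (ballVol_ne_top p n γ)), mul_comm]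
    exact (ballVol_mul_ballAvg_rpow_le hmeas hq₀ γ a).trans hsmall
  have hlarge_avg : ballAvg γ (fun y => G y ^ q y) a ≤ V⁻¹ ^ (1 / q₀) := by
    calc ballAvg γ (fun y => G y ^ q y) a ≤ 1 / V :=
          (ballAvg_le_lintegral_div γ _ a).trans (by gcongr)
      _ = V⁻¹ ^ (1 : ℝ) := by rw [one_div, ENNReal.rpow_one]
      _ ≤ V⁻¹ ^ (1 / q₀) := ENNReal.rpow_le_rpow_of_exponent_ge hV1 ((div_le_one hq₀0).2 hq₀)
  calc ballAvg γ G a ≤ ballAvg γ (fun y => min (G y) 1 + G y ^ q y) a := ballAvg_mono hsplit γ a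
    _ ≤ D ^ (1 / q₀) * V⁻¹ ^ (1 / q₀) + V⁻¹ ^ (1 / q₀) := by
        rw [ballAvg_add hmeas]
        gcongr
    _ = (D ^ (1 / q₀) + 1) * V⁻¹ ^ (1 / q₀) := by ring

lemma setLIntegral_inv_ballVol_rpow_le {q : Qpn p n → ℝ} (hq : ∀ x, 1 ≤ q x) {q₀ C : ℝ}
    (hq₀ : 0 < q₀) (hlim : HasLogLimit q q₀ C) {γ : ℤ} (hγ : 0 ≤ γ) (a : Qpn p n) :
    ∫⁻ x in pball γ a, ((ballVol p n γ)⁻¹ ^ (1 / q₀)) ^ q x ∂(haar p n) ≤ logLimitConst p n C := by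
  set V := ballVol p n γ with hV
  set P := ENNReal.ofReal ((p : ℝ) ^ ((n + 1) * C))
  have hw1 : V⁻¹ ^ (1 / q₀) ≤ 1 := by
    refine ENNReal.rpow_le_one ?_ (by positivity)
    rw [ENNReal.inv_le_one, ← ballVol_zero p n]
    exact ballVol_mono p n hγ
  have hwq : (V⁻¹ ^ (1 / q₀)) ^ q₀ = V⁻¹ := by
    rw [← ENNReal.rpow_mul, one_div_mul_cancel hq₀.ne', ENNReal.rpow_one]
  calc ∫⁻ x in pball γ a, (V⁻¹ ^ (1 / q₀)) ^ q x ∂(haar p n)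
      ≤ ∫⁻ x in pball γ a, (P * V⁻¹ + decay x) ∂(haar p n) := by
        refine lintegral_mono fun x => ?_
        nth_rw 2 [← hwq]
        exact rpow_le_rpow_add_decay hw1 (hq x) (hlim x)
    _ = P + ∫⁻ x in pball γ a, decay x ∂(haar p n) := by
        rw [lintegral_add_left measurable_const, setLIntegral_const, haar_pball, ← hV, mul_assoc,
          ENNReal.inv_mul_cancel (ballVol_ne_zero p n γ) (ballVol_ne_top p n γ), mul_one]
    _ ≤ logLimitConst p n C := by
        rw [logLimitConst]
        gcongr
        exact Measure.restrict_le_self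

-- `w = |B|^{-1/q₀}` with `q₀` the limit of the exponent at infinity
lemma MemClog.exists_isBallWeight_of_nonneg (hn : 0 < n) {q : Qpn p n → ℝ} (hq : MemClog q) :
    ∃ K : ℝ≥0∞, K ≠ ∞ ∧ ∀ γ ≥ (0 : ℤ), ∀ a : Qpn p n, ∃ w, IsBallWeight q K γ a w := by
  obtain ⟨q₀, C, hlim⟩ := hq.infty.exists_hasLogLimit hn
  have := cobounded_neBot (p := p) hn
  have hq1 : ∀ x, 1 ≤ q x := fun x => (hq.memP.one_lt_apply x).le
  have hq₀ : 1 ≤ q₀ := ge_of_tendsto' hlim.tendsto hq1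
  have hD := logLimitConst_ne_top p n C
  have hDq : logLimitConst p n C ^ (1 / q₀) ≠ ∞ :=
    ENNReal.rpow_ne_top_of_nonneg (by positivity) hD
  refine ⟨logLimitConst p n C ^ (1 / q₀) + 1 + logLimitConst p n C,
    ENNReal.add_ne_top.2 ⟨ENNReal.add_ne_top.2 ⟨hDq, ENNReal.one_ne_top⟩, hD⟩, fun γ hγ a => ?_⟩
  refine ⟨_, inv_ballVol_rpow_ne_zero p n _ _, inv_ballVol_rpow_ne_top p n _ _,
    fun G hG hG1 => ?_, (setLIntegral_inv_ballVol_rpow_le hq1 (zero_lt_one.trans_le hq₀) hlim hγ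
      a).trans le_add_self⟩
  refine (ballAvg_le_mul_inv_ballVol_rpow hq.memP.measurable hq1 hq₀ hlim hγ a hG hG1).trans ?_
  gcongr ?_ * _
  exact le_self_add

lemma MemClog.exists_isBallWeight (hn : 0 < n) {q : Qpn p n → ℝ} (hq : MemClog q) :
    ∃ K : ℝ≥0∞, 1 ≤ K ∧ K ≠ ∞ ∧ ∀ (γ : ℤ) (a : Qpn p n), ∃ w, IsBallWeight q K γ a w := by
  obtain ⟨K₁, hK₁, hsmall⟩ := hq.exists_isBallWeight_of_nonpos
  obtain ⟨K₂, hK₂, hlarge⟩ := hq.exists_isBallWeight_of_nonneg hn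
  refine ⟨1 + (K₁ + K₂), le_self_add, by simp [hK₁, hK₂], fun γ a => ?_⟩
  rcases le_total γ 0 with hγ | hγ
  · obtain ⟨w, hw⟩ := hsmall γ hγ a
    exact ⟨w, hw.mono (le_add_left le_self_add)⟩
  · obtain ⟨w, hw⟩ := hlarge γ hγ a
    exact ⟨w, hw.mono (le_add_left le_add_self)⟩

lemma IsBallWeight.luxNorm_indicator_le {q : Qpn p n → ℝ} (hq : ∀ x, 1 ≤ q x) {K : ℝ≥0∞}
    (hK1 : 1 ≤ K) (hK : K ≠ ∞) {γ : ℤ} {a : Qpn p n} {w : ℝ≥0∞} (h : IsBallWeight q K γ a w) :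
    luxNorm q ((pball γ a).indicator fun _ => 1) ≤ K * w⁻¹ := by
  have hK0 : K ≠ 0 := (zero_lt_one.trans_le hK1).ne'
  have hKw : K * w⁻¹ ≠ ∞ := ENNReal.mul_ne_top hK (ENNReal.inv_ne_top.2 h.ne_zero)
  have hpos : 0 < (K * w⁻¹).toReal :=
    ENNReal.toReal_pos (mul_ne_zero hK0 (ENNReal.inv_ne_zero.2 h.ne_top)) hKw
  have hinv : (K * w⁻¹)⁻¹ = w / K := by
    rw [ENNReal.mul_inv (Or.inl hK0) (Or.inl hK), inv_inv, div_eq_mul_inv, mul_comm]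
  rw [← ENNReal.ofReal_toReal hKw]
  refine luxNorm_le hpos ?_
  rw [modular_indicator_one (fun x => zero_lt_one.trans_le (hq x)) (measurableSet_pball γ a) hpos,
    ENNReal.ofReal_toReal hKw, hinv]
  exact lintegral_div_rpow_le_one hq hK1 hK h.setLIntegral_rpow_le

lemma IsBallWeight.ballAvg_enorm_le {q : Qpn p n → ℝ} (hq : ∀ x, 0 ≤ q x) {K : ℝ≥0∞}
    (hK0 : K ≠ 0) (hK : K ≠ ∞) {γ : ℤ} {a : Qpn p n} {w : ℝ≥0∞} (h : IsBallWeight q K γ a w)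
    {g : Qpn p n → ℝ} (hg : AEStronglyMeasurable g (haar p n)) :
    ballAvg γ (fun y => ‖g y‖ₑ) a ≤ K * w * luxNorm q g := by
  have hKw0 : K * w ≠ 0 := mul_ne_zero hK0 h.ne_zero
  have hKw : K * w ≠ ∞ := ENNReal.mul_ne_top hK h.ne_top
  rw [← ENNReal.div_le_iff' hKw0 hKw]
  refine le_iInf₂ fun η ⟨hη, hmod⟩ => ?_
  have hη0 : ENNReal.ofReal η ≠ 0 := by simpa using hη
  rw [modular_eq_lintegral hq g hη] at hmod
  have hmean := h.ballAvg_le _ (hg.enorm.div_const _) hmod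
  simp only [ENNReal.div_eq_inv_mul, ballAvg_const_mul (ENNReal.inv_ne_top.2 hη0)] at hmean
  rwa [ENNReal.div_le_iff hKw0 hKw, ← ENNReal.div_le_iff' hη0 ENNReal.ofReal_ne_top,
    ENNReal.div_eq_inv_mul]

lemma MemClog.exists_ballAvg_mul_luxNorm_le (hn : 0 < n) {q : Qpn p n → ℝ} (hq : MemClog q) :
    ∃ K : ℝ≥0∞, K ≠ ∞ ∧ ∀ (γ : ℤ) (a : Qpn p n) (g : Qpn p n → ℝ),
      AEStronglyMeasurable g (haar p n) →
      ballAvg γ (fun y => ‖g y‖ₑ) a * luxNorm q ((pball γ a).indicator fun _ => 1) ≤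
        K * luxNorm q g := by
  obtain ⟨K, hK1, hK, hweight⟩ := hq.exists_isBallWeight hn
  have hq1 : ∀ x, 1 ≤ q x := fun x => (hq.memP.one_lt_apply x).le
  refine ⟨K * K, ENNReal.mul_ne_top hK hK, fun γ a g hg => ?_⟩
  obtain ⟨w, hw⟩ := hweight γ a
  calc ballAvg γ (fun y => ‖g y‖ₑ) a * luxNorm q ((pball γ a).indicator fun _ => 1)
      ≤ (K * w * luxNorm q g) * (K * w⁻¹) := by
        gcongr
        · exact hw.ballAvg_enorm_le (fun x => zero_le_one.trans (hq1 x))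
            (zero_lt_one.trans_le hK1).ne' hK hg
        · exact hw.luxNorm_indicator_le hq1 hK1 hK
    _ = K * K * luxNorm q g * (w * w⁻¹) := by ring
    _ = K * K * luxNorm q g := by rw [ENNReal.mul_inv_cancel hw.ne_zero hw.ne_top, mul_one]

lemma luxNorm_indicator_pball_ne_top {q : Qpn p n → ℝ} (hq : ∀ x, 1 ≤ q x) (γ : ℤ)
    (a : Qpn p n) : luxNorm q ((pball γ a).indicator fun _ => 1) ≠ ∞ := by
  obtain ⟨η, hη, hmod⟩ :=
    (memLvar_indicator_pball (fun x => zero_lt_one.trans_le (hq x)) γ a).exists_modular_le_one hq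
  exact ((luxNorm_le hη hmod).trans_lt ENNReal.ofReal_lt_top).ne

lemma luxNorm_indicator_pball_ne_zero {q : Qpn p n → ℝ} (hq : ∀ x, 1 ≤ q x) (γ : ℤ)
    (a : Qpn p n) : luxNorm q ((pball γ a).indicator fun _ => 1) ≠ 0 := by
  have hpos : 0 < min 1 (ballVol p n γ) :=
    lt_min one_pos (pos_iff_ne_zero.2 (ballVol_ne_zero p n γ))
  refine (hpos.trans_le (le_iInf₂ fun η ⟨hη, hmod⟩ => ?_)).ne'
  rw [modular_indicator_one (fun x => zero_lt_one.trans_le (hq x)) (measurableSet_pball γ a) hη]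
    at hmod
  rcases le_total 1 (ENNReal.ofReal η) with h | h
  · exact min_le_of_left_le h
  · refine min_le_of_right_le ?_
    have hη0 : ENNReal.ofReal η ≠ 0 := by simpa using hη
    have hmass : ∫⁻ _ in pball γ a, (ENNReal.ofReal η)⁻¹ ∂(haar p n) ≤ 1 := by
      refine (lintegral_mono fun x => ?_).trans hmod
      simpa only [ENNReal.rpow_one] using
        ENNReal.rpow_le_rpow_of_exponent_le (ENNReal.one_le_inv.2 h) (hq x)
    rwa [setLIntegral_const, haar_pball, ← ENNReal.div_eq_inv_mul,
      ENNReal.div_le_iff hη0 ENNReal.ofReal_ne_top, one_mul] at hmass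

/-! ### The Campanato condition -/

/-- The mean of `|b|` over the ball `B_γ(a)`, as a real number; the junk value `0` does not arise
for locally integrable `b`. -/
noncomputable def ballMean (b : Qpn p n → ℝ) (γ : ℤ) (a : Qpn p n) : ℝ :=
  (ballAvg γ (fun y => ‖b y‖ₑ) a).toReal

lemma ballMean_nonneg (b : Qpn p n → ℝ) (γ : ℤ) (a : Qpn p n) : 0 ≤ ballMean b γ a :=
  ENNReal.toReal_nonneg

lemma ballAvg_enorm_lt_top {b : Qpn p n → ℝ} (hb : LocallyIntegrable b (haar p n)) (γ : ℤ)
    (a : Qpn p n) : ballAvg γ (fun y => ‖b y‖ₑ) a < ∞ :=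
  ENNReal.div_lt_top (hb.integrableOn_isCompact (isCompact_pball γ a)).2.ne (ballVol_ne_zero p n γ)

lemma ofReal_ballMean {b : Qpn p n → ℝ} (hb : LocallyIntegrable b (haar p n)) (γ : ℤ)
    (a : Qpn p n) : ENNReal.ofReal (ballMean b γ a) = ballAvg γ (fun y => ‖b y‖ₑ) a :=
  ENNReal.ofReal_toReal (ballAvg_enorm_lt_top hb γ a).ne

lemma measurable_ballMean (b : Qpn p n → ℝ) (γ : ℤ) : Measurable (ballMean b γ) :=
  (measurable_ballAvg γ _).ennreal_toReal

lemma ballMean_eq_of_mem (b : Qpn p n → ℝ) {γ : ℤ} {x y : Qpn p n} (h : y ∈ pball γ x) :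
    ballMean b γ y = ballMean b γ x := by
  rw [ballMean, ballMean, ballAvg_eq_of_mem le_rfl _ h]

/-- The Campanato condition with exponent `β` and constant `M`. The oscillation is measured around
the means of `|b|` rather than those of `b`, so that it forces `b ≥ 0` as well. -/
def CampanatoBound (β M : ℝ) (b : Qpn p n → ℝ) : Prop :=
  ∀ (γ : ℤ) (a : Qpn p n),
    ballAvg γ (fun y => ‖b y - ballMean b γ a‖ₑ) a ≤ ENNReal.ofReal (M * ((p : ℝ) ^ γ) ^ β)

lemma ae_fracMaxOn_lt_top (hn : 0 < n) {α : ℝ} (hα : 0 ≤ α) {b : Qpn p n → ℝ}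
    (hb : LocallyIntegrable b (haar p n)) (γ : ℤ) (a : Qpn p n) :
    ∀ᵐ y ∂(haar p n), fracMaxOn α (pball γ a) b y < ∞ := by
  have hB := measurableSet_pball γ a
  have hfinite : ∫⁻ y, (pball γ a).indicator (fun z => ‖b z‖ₑ) y ∂(haar p n) ≠ ∞ := by
    rw [lintegral_indicator hB]
    exact (hb.integrableOn_isCompact (isCompact_pball γ a)).2.ne
  filter_upwards [ae_hlMax_lt_top hn (hb.aestronglyMeasurable.enorm.indicator hB) hfinite] with y hy
  have hα' : 0 ≤ α / n := by positivity
  refine lt_of_le_of_lt ?_ (ENNReal.mul_lt_top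
    (ENNReal.rpow_lt_top_of_nonneg hα' (ballVol_ne_top p n γ)) hy)
  rw [fracMaxOn_eq_iSup]
  refine iSup₂_le fun γ' h => ?_
  rw [← ballAvg_indicator_of_subset h]
  gcongr
  · rw [← haar_pball γ' y, ← haar_pball γ a]
    exact measure_mono h
  · exact ballAvg_le_hlMax γ' _ y

lemma aestronglyMeasurable_oscFun {α : ℝ} (hα : α ≤ n) {b : Qpn p n → ℝ}
    (hb : AEStronglyMeasurable b (haar p n)) (γ : ℤ) (a : Qpn p n) :
    AEStronglyMeasurable (oscFun α b (pball γ a)) (haar p n) := by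
  have heq : oscFun α b (pball γ a) = (pball γ a).indicator fun y => b y -
      (haar p n (pball γ a)).toReal ^ (-α / n) *
        (fracMaxE α (fun z => ‖(pball γ a).indicator b z‖ₑ) y).toReal := by
    refine Set.indicator_congr fun y hy => ?_
    rw [← fracMax_eq_fracMaxE, fracMax_indicator_eq_fracMaxOn hα b hy]
  rw [heq]
  refine AEStronglyMeasurable.indicator (hb.sub ?_) (measurableSet_pball γ a)
  exact ((measurable_fracMaxE α _).ennreal_toReal.const_mul _).aestronglyMeasurable

lemma ballMean_le_mul_fracMaxOn (α : ℝ) (b : Qpn p n → ℝ) {γ : ℤ} {a y : Qpn p n}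
    (hy : y ∈ pball γ a) (hfin : fracMaxOn α (pball γ a) b y < ∞) :
    ballMean b γ a ≤
      (ballVol p n γ).toReal ^ (-α / n) * (fracMaxOn α (pball γ a) b y).toReal := by
  have hV : 0 < (ballVol p n γ).toReal :=
    ENNReal.toReal_pos (ballVol_ne_zero p n γ) (ballVol_ne_top p n γ)
  have hle := ENNReal.toReal_mono hfin.ne (le_fracMaxOn α b (pball_eq_of_mem hy).le)
  rw [ballAvg_eq_of_mem le_rfl _ hy, ENNReal.toReal_mul, ← ENNReal.toReal_rpow] at hle
  calc ballMean b γ a = (ballVol p n γ).toReal ^ (-α / n) *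
        ((ballVol p n γ).toReal ^ (α / n) * ballMean b γ a) := by
        rw [← mul_assoc, ← Real.rpow_add hV, neg_div, neg_add_cancel, Real.rpow_zero, one_mul]
    _ ≤ _ := mul_le_mul_of_nonneg_left hle (Real.rpow_pos_of_pos hV _).le

lemma ofReal_ballMean_sub_le_enorm_oscFun (hn : 0 < n) {α : ℝ} (hα : 0 ≤ α) {b : Qpn p n → ℝ}
    (hb : LocallyIntegrable b (haar p n)) (γ : ℤ) (a : Qpn p n) :
    ∀ᵐ y ∂((haar p n).restrict (pball γ a)),
      ENNReal.ofReal (ballMean b γ a - b y) ≤ ‖oscFun α b (pball γ a) y‖ₑ := by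
  filter_upwards [ae_restrict_of_ae (ae_fracMaxOn_lt_top hn hα hb γ a),
    ae_restrict_mem (measurableSet_pball γ a)] with y hfin hy
  rw [oscFun, Set.indicator_of_mem hy, haar_pball, Real.enorm_eq_ofReal_abs]
  refine ENNReal.ofReal_le_ofReal (le_trans ?_ (neg_le_abs _))
  rw [neg_sub]
  exact sub_le_sub_right (ballMean_le_mul_fracMaxOn α b hy hfin) _

lemma enorm_sub_le_ofReal_sub_add (t c : ℝ) :
    ‖t - c‖ₑ ≤ ENNReal.ofReal (t - c) + ENNReal.ofReal (c - t) := by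
  rw [Real.enorm_eq_ofReal_abs]
  rcases abs_choice (t - c) with h | h
  · rw [h]
    exact le_self_add
  · rw [h, neg_sub]
    exact le_add_self

lemma ofReal_sub_add_ofReal_le (t : ℝ) {c : ℝ} (hc : 0 ≤ c) :
    ENNReal.ofReal (t - c) + ENNReal.ofReal c ≤ ‖t‖ₑ + ENNReal.ofReal (c - t) := by
  rw [Real.enorm_eq_ofReal_abs]
  rcases le_total c t with h | h
  · rw [← ENNReal.ofReal_add (sub_nonneg.2 h) hc, sub_add_cancel]
    exact le_add_right (ENNReal.ofReal_le_ofReal (le_abs_self t))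
  · rw [ENNReal.ofReal_of_nonpos (sub_nonpos.2 h), zero_add,
      ← ENNReal.ofReal_add (abs_nonneg t) (sub_nonneg.2 h)]
    exact ENNReal.ofReal_le_ofReal (by linarith [le_abs_self t])

-- Since `b ≤ |b|`, the mean of `b - ⟨|b|⟩` is nonpositive, so its positive part has the smaller
-- mean.
lemma ballAvg_sub_ballMean_le {b : Qpn p n → ℝ} (hb : LocallyIntegrable b (haar p n)) (γ : ℤ)
    (a : Qpn p n) :
    ballAvg γ (fun y => ‖b y - ballMean b γ a‖ₑ) a ≤
      2 * ballAvg γ (fun y => ENNReal.ofReal (ballMean b γ a - b y)) a := by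
  set c := ballMean b γ a with hc
  have hbm : AEMeasurable b (haar p n) := hb.aestronglyMeasurable.aemeasurable
  have hpos : AEMeasurable (fun y => ENNReal.ofReal (b y - c)) (haar p n) :=
    (hbm.sub aemeasurable_const).ennreal_ofReal
  have hpos_le : ballAvg γ (fun y => ENNReal.ofReal (b y - c)) a ≤
      ballAvg γ (fun y => ENNReal.ofReal (c - b y)) a := by
    have havg := ballAvg_mono (fun y => ofReal_sub_add_ofReal_le (b y)
      (hc ▸ ballMean_nonneg b γ a)) γ a
    rw [ballAvg_add hpos, ballAvg_add hbm.enorm, ballAvg_const, hc, ofReal_ballMean hb, ← hc,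
      add_comm] at havg
    exact (ENNReal.add_le_add_iff_left (ballAvg_enorm_lt_top hb γ a).ne).1 havg
  calc ballAvg γ (fun y => ‖b y - c‖ₑ) a
      ≤ ballAvg γ (fun y => ENNReal.ofReal (b y - c) + ENNReal.ofReal (c - b y)) a :=
        ballAvg_mono (fun y => enorm_sub_le_ofReal_sub_add (b y) c) γ a
    _ ≤ 2 * ballAvg γ (fun y => ENNReal.ofReal (c - b y)) a := by
        rw [ballAvg_add hpos, two_mul]
        gcongr

lemma luxNorm_oscFun_le_oscSup_mul (α β : ℝ) (b : Qpn p n → ℝ) {q : Qpn p n → ℝ}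
    (hq : ∀ x, 1 ≤ q x) (γ : ℤ) (a : Qpn p n) :
    luxNorm q (oscFun α b (pball γ a)) ≤ oscSup α β b q * ballVol p n γ ^ (β / n) *
      luxNorm q ((pball γ a).indicator fun _ => 1) := by
  rw [← ENNReal.div_le_iff_le_mul (Or.inl (luxNorm_indicator_pball_ne_zero hq γ a))
      (Or.inl (luxNorm_indicator_pball_ne_top hq γ a)),
    ← ENNReal.div_le_iff_le_mul (Or.inl (ballVol_rpow_ne_zero p n γ _))
      (Or.inl (ballVol_rpow_ne_top p n γ _)),
    ENNReal.div_eq_inv_mul, ← one_div, ← haar_pball γ a]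
  exact le_iSup₂ (f := fun (γ : ℤ) (a : Qpn p n) => 1 / (haar p n (pball γ a)) ^ (β / n) *
    (luxNorm q (oscFun α b (pball γ a)) / luxNorm q ((pball γ a).indicator fun _ => 1))) γ a

lemma MemClog.exists_campanatoBound (hn : 0 < n) {α β : ℝ} (hα : 0 ≤ α) (hαn : α ≤ n)
    {b q : Qpn p n → ℝ} (hb : LocallyIntegrable b (haar p n)) (hq : MemClog q)
    (hosc : oscSup α β b q < ∞) : ∃ M : ℝ, 0 ≤ M ∧ CampanatoBound β M b := by
  obtain ⟨K, hK, hmean⟩ := hq.exists_ballAvg_mul_luxNorm_le hn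
  have hq1 : ∀ x, 1 ≤ q x := fun x => (hq.memP.one_lt_apply x).le
  refine ⟨(2 * (K * oscSup α β b q)).toReal, ENNReal.toReal_nonneg, fun γ a => ?_⟩
  have hosc_avg : ballAvg γ (fun y => ‖oscFun α b (pball γ a) y‖ₑ) a ≤
      K * oscSup α β b q * ballVol p n γ ^ (β / n) := by
    refine (ENNReal.mul_le_mul_iff_left (luxNorm_indicator_pball_ne_zero hq1 γ a)
      (luxNorm_indicator_pball_ne_top hq1 γ a)).1 ((hmean γ a _
        (aestronglyMeasurable_oscFun hαn hb.aestronglyMeasurable γ a)).trans ?_)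
    rw [mul_assoc, mul_assoc, ← mul_assoc (oscSup α β b q)]
    gcongr
    exact luxNorm_oscFun_le_oscSup_mul α β b hq1 γ a
  rw [ENNReal.ofReal_mul ENNReal.toReal_nonneg, ENNReal.ofReal_toReal
    (ENNReal.mul_ne_top (by simp) (ENNReal.mul_ne_top hK hosc.ne)), ← ballVol_rpow_div p hn]
  calc ballAvg γ (fun y => ‖b y - ballMean b γ a‖ₑ) a
      ≤ 2 * ballAvg γ (fun y => ENNReal.ofReal (ballMean b γ a - b y)) a :=
        ballAvg_sub_ballMean_le hb γ a
    _ ≤ 2 * (K * oscSup α β b q * ballVol p n γ ^ (β / n)) := by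
        gcongr
        exact (ballAvg_mono_ae (ofReal_ballMean_sub_le_enorm_oscFun hn hα hb γ a)).trans hosc_avg
    _ = 2 * (K * oscSup α β b q) * ballVol p n γ ^ (β / n) := by ring

/-! ### Campanato's theorem -/

lemma abs_ballMean_sub_le {b : Qpn p n → ℝ} (hb : LocallyIntegrable b (haar p n)) {γ : ℤ}
    {a : Qpn p n} {c R : ℝ} (hc : 0 ≤ c) (hR : 0 ≤ R)
    (h : ballAvg γ (fun y => ‖b y - c‖ₑ) a ≤ ENNReal.ofReal R) : |ballMean b γ a - c| ≤ R := by
  have hbm : AEMeasurable b (haar p n) := hb.aestronglyMeasurable.aemeasurable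
  have hce : ‖c‖ₑ = ENNReal.ofReal c := Real.enorm_of_nonneg hc
  have hupper : ballAvg γ (fun y => ‖b y‖ₑ) a ≤ ENNReal.ofReal c + ENNReal.ofReal R := by
    have hpt : ∀ y, ‖b y‖ₑ ≤ ENNReal.ofReal c + ‖b y - c‖ₑ := fun y => by
      simpa only [hce, add_sub_cancel] using enorm_add_le c (b y - c)
    refine (ballAvg_mono hpt γ a).trans ?_
    rw [ballAvg_add aemeasurable_const, ballAvg_const]
    gcongr
  have hlower : ENNReal.ofReal c ≤ ballAvg γ (fun y => ‖b y‖ₑ) a + ENNReal.ofReal R := by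
    have hpt : ∀ y, ENNReal.ofReal c ≤ ‖b y‖ₑ + ‖b y - c‖ₑ := fun y => by
      simpa only [hce, sub_sub_cancel] using enorm_sub_le (a := b y) (b := b y - c)
    rw [← ballAvg_const (p := p) (n := n) (ENNReal.ofReal c) γ a]
    refine (ballAvg_mono hpt γ a).trans ?_
    rw [ballAvg_add hbm.enorm]
    gcongr
  have hmean := ballMean_nonneg b γ a
  rw [← ofReal_ballMean hb, ← ENNReal.ofReal_add hc hR,
    ENNReal.ofReal_le_ofReal_iff (by positivity)] at hupper
  rw [← ofReal_ballMean hb, ← ENNReal.ofReal_add hmean hR,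
    ENNReal.ofReal_le_ofReal_iff (by positivity)] at hlower
  rw [abs_le]
  constructor <;> linarith

lemma ballAvg_pred_le (γ : ℤ) (F : Qpn p n → ℝ≥0∞) (a : Qpn p n) :
    ballAvg (γ - 1) F a ≤ ENNReal.ofReal ((p : ℝ) ^ n) * ballAvg γ F a := by
  have hvol := ballVol_succ (p := p) (n := n) (γ - 1)
  rw [sub_add_cancel, ENNReal.rpow_natCast] at hvol
  rw [ENNReal.ofReal_pow (prime_real_pos p).le, ENNReal.ofReal_natCast, ballAvg, ballAvg, hvol,
    ← mul_div_assoc, ENNReal.mul_div_mul_left _ _ (pow_ne_zero n (prime_ne_zero p))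
      (ENNReal.pow_ne_top (ENNReal.natCast_ne_top p))]
  gcongr
  exact pball_mono (sub_one_lt γ).le a

lemma zpow_sub_natCast_rpow (p : ℕ) [Fact p.Prime] (γ : ℤ) (k : ℕ) (β : ℝ) :
    ((p : ℝ) ^ (γ - (k : ℤ))) ^ β = ((p : ℝ) ^ γ) ^ β * ((p : ℝ) ^ (-β)) ^ k := by
  have hp := prime_real_pos p
  rw [zpow_sub₀ hp.ne', zpow_natCast, Real.div_rpow (by positivity) (by positivity),
    Real.rpow_neg hp.le, inv_pow, ← div_eq_mul_inv, Real.rpow_pow_comm hp.le]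

namespace CampanatoBound

lemma abs_ballMean_pred_sub_le {β M : ℝ} (hM : 0 ≤ M) {b : Qpn p n → ℝ}
    (h : CampanatoBound β M b) (hb : LocallyIntegrable b (haar p n)) (γ : ℤ) (x : Qpn p n) :
    |ballMean b (γ - 1) x - ballMean b γ x| ≤ (p : ℝ) ^ n * (M * ((p : ℝ) ^ γ) ^ β) := by
  refine abs_ballMean_sub_le hb (ballMean_nonneg b γ x) (by positivity) ?_
  refine (ballAvg_pred_le γ _ x).trans ?_
  rw [ENNReal.ofReal_mul (by positivity)]
  gcongr
  exact h γ x

lemma dist_ballMean_le {β M : ℝ} (hM : 0 ≤ M) {b : Qpn p n → ℝ} (h : CampanatoBound β M b)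
    (hb : LocallyIntegrable b (haar p n)) (γ : ℤ) (x : Qpn p n) (k : ℕ) :
    dist (ballMean b (γ - k) x) (ballMean b (γ - (k + 1 : ℕ)) x) ≤
      (p : ℝ) ^ n * M * ((p : ℝ) ^ γ) ^ β * ((p : ℝ) ^ (-β)) ^ k := by
  have hstep := h.abs_ballMean_pred_sub_le hM hb (γ - k) x
  rw [zpow_sub_natCast_rpow] at hstep
  rw [dist_comm, Real.dist_eq, Nat.cast_succ, ← sub_sub]
  exact hstep.trans_eq (by ring)

lemma exists_limit {β M : ℝ} (hβ : 0 < β) (hM : 0 ≤ M) {b : Qpn p n → ℝ}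
    (h : CampanatoBound β M b) (hb : LocallyIntegrable b (haar p n)) :
    ∃ (b₀ : Qpn p n → ℝ) (R : ℝ), 0 ≤ R ∧ Measurable b₀ ∧ (∀ x, 0 ≤ b₀ x) ∧
      ∀ (γ : ℤ) (x : Qpn p n), |ballMean b γ x - b₀ x| ≤ R * ((p : ℝ) ^ γ) ^ β := by
  have hρ : (p : ℝ) ^ (-β) < 1 :=
    Real.rpow_lt_one_of_one_lt_of_neg (one_lt_prime_real p) (neg_lt_zero.2 hβ)
  have hconv : ∀ x, ∃ l, Tendsto (fun k : ℕ => ballMean b (0 - (k : ℤ)) x) atTop (𝓝 l) := fun x =>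
    cauchySeq_tendsto_of_complete (cauchySeq_of_le_geometric _ _ hρ (h.dist_ballMean_le hM hb 0 x))
  choose b₀ hb₀ using hconv
  have hb₀_shift : ∀ (γ : ℤ) (x : Qpn p n),
      Tendsto (fun k : ℕ => ballMean b (γ - (k : ℤ)) x) atTop (𝓝 (b₀ x)) := by
    intro γ x
    rw [← tendsto_add_atTop_iff_nat γ.toNat]
    refine ((tendsto_add_atTop_iff_nat (-γ).toNat).2 (hb₀ x)).congr fun k => ?_
    congr 1
    lia
  refine ⟨b₀, (p : ℝ) ^ n * M / (1 - (p : ℝ) ^ (-β)), div_nonneg (by positivity)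
    (sub_nonneg.2 hρ.le), ?_, fun x => ?_, fun γ x => ?_⟩
  · exact measurable_of_tendsto_metrizable (fun k : ℕ => measurable_ballMean b (0 - (k : ℤ)))
      (tendsto_pi_nhds.2 hb₀)
  · exact ge_of_tendsto' (hb₀ x) fun k => ballMean_nonneg b _ x
  · have hdist := dist_le_of_le_geometric_of_tendsto₀ _ _ hρ (h.dist_ballMean_le hM hb γ x)
      (hb₀_shift γ x)
    rw [Real.dist_eq, Nat.cast_zero, sub_zero] at hdist
    exact hdist.trans_eq (by ring)

end CampanatoBound

lemma ae_eq_zero_of_ballAvg_le {g : Qpn p n → ℝ≥0∞} (hg : AEMeasurable g (haar p n))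
    {ε : ℤ → ℝ≥0∞} (hε : Tendsto ε atBot (𝓝 0)) (h : ∀ γ a, ballAvg γ g a ≤ ε γ) :
    g =ᵐ[haar p n] 0 := by
  refine ae_of_forall_ae_pball 0 fun a => ?_
  have hle : ∀ γ ≤ (0 : ℤ), ∫⁻ x in pball 0 a, g x ∂(haar p n) ≤ ε γ := by
    intro γ hγ
    calc ∫⁻ x in pball 0 a, g x ∂(haar p n) = ∫⁻ x in pball 0 a, ballAvg γ g x ∂(haar p n) :=
          (setLIntegral_ballAvg hg (measurableSet_pball 0 a) fun x hx =>
            pball_eq_of_mem hx ▸ pball_mono hγ x).symm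
      _ ≤ ∫⁻ _ in pball 0 a, ε γ ∂(haar p n) := lintegral_mono fun x => h γ x
      _ = ε γ := by rw [setLIntegral_const, haar_pball, ballVol_zero, mul_one]
  have hzero : ∫⁻ x in pball 0 a, g x ∂(haar p n) = 0 :=
    le_antisymm (ge_of_tendsto hε ((eventually_le_atBot 0).mono hle)) zero_le
  exact (lintegral_eq_zero_iff' hg.restrict).1 hzero

lemma tendsto_ofReal_mul_zpow_rpow_atBot (p : ℕ) [Fact p.Prime] {β : ℝ} (hβ : 0 < β) (M : ℝ) :
    Tendsto (fun γ : ℤ => ENNReal.ofReal (M * ((p : ℝ) ^ γ) ^ β)) atBot (𝓝 0) := by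
  have hpow : Tendsto (fun γ : ℤ => (p : ℝ) ^ γ) atBot (𝓝 0) := by
    have hrpow := (tendsto_rpow_atBot_of_base_gt_one (p : ℝ) (one_lt_prime_real p)).comp
      (tendsto_intCast_atBot_iff.2 tendsto_id)
    simpa only [Function.comp_def, id, Real.rpow_intCast] using hrpow
  have hlim := (hpow.rpow_const (Or.inr hβ.le)).const_mul M
  rw [Real.zero_rpow hβ.ne', mul_zero] at hlim
  simpa only [ENNReal.ofReal_zero] using ENNReal.tendsto_ofReal hlim

lemma CampanatoBound.ae_eq_of_abs_ballMean_sub_le {β M : ℝ} (hβ : 0 < β) (hM : 0 ≤ M)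
    {b : Qpn p n → ℝ} (h : CampanatoBound β M b) (hb : AEMeasurable b (haar p n))
    {b₀ : Qpn p n → ℝ} (hm : AEMeasurable b₀ (haar p n)) {R : ℝ} (hR : 0 ≤ R)
    (hlim : ∀ γ x, |ballMean b γ x - b₀ x| ≤ R * ((p : ℝ) ^ γ) ^ β) : b =ᵐ[haar p n] b₀ := by
  have hzero : (fun y => ‖b y - b₀ y‖ₑ) =ᵐ[haar p n] 0 := by
    refine ae_eq_zero_of_ballAvg_le (hb.sub hm).enorm
      (tendsto_ofReal_mul_zpow_rpow_atBot p hβ (M + R)) fun γ a => ?_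
    have hpt : ∀ᵐ y ∂((haar p n).restrict (pball γ a)), ‖b y - b₀ y‖ₑ ≤
        ‖b y - ballMean b γ a‖ₑ + ENNReal.ofReal (R * ((p : ℝ) ^ γ) ^ β) := by
      filter_upwards [ae_restrict_mem (measurableSet_pball γ a)] with y hy
      calc ‖b y - b₀ y‖ₑ = ‖(b y - ballMean b γ a) + (ballMean b γ y - b₀ y)‖ₑ := by
            rw [ballMean_eq_of_mem b hy, sub_add_sub_cancel]
        _ ≤ ‖b y - ballMean b γ a‖ₑ + ‖ballMean b γ y - b₀ y‖ₑ := enorm_add_le _ _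
        _ ≤ _ := by
            gcongr
            rw [Real.enorm_eq_ofReal_abs]
            exact ENNReal.ofReal_le_ofReal (hlim γ y)
    calc ballAvg γ (fun y => ‖b y - b₀ y‖ₑ) a
        ≤ ballAvg γ (fun y => ‖b y - ballMean b γ a‖ₑ) a +
            ENNReal.ofReal (R * ((p : ℝ) ^ γ) ^ β) := by
          refine (ballAvg_mono_ae hpt).trans_eq ?_
          rw [ballAvg_add (F := fun y => ‖b y - ballMean b γ a‖ₑ)
            (hb.sub aemeasurable_const).enorm, ballAvg_const]
      _ ≤ ENNReal.ofReal (M * ((p : ℝ) ^ γ) ^ β) + ENNReal.ofReal (R * ((p : ℝ) ^ γ) ^ β) := by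
          gcongr
          exact h γ a
      _ = ENNReal.ofReal ((M + R) * ((p : ℝ) ^ γ) ^ β) := by
          rw [add_mul, ENNReal.ofReal_add (by positivity) (by positivity)]
  filter_upwards [hzero] with x hx
  exact sub_eq_zero.1 (enorm_eq_zero.1 hx)

lemma memLip_of_abs_ballMean_sub_le {β : ℝ} (hβ : 0 ≤ β) {b b₀ : Qpn p n → ℝ}
    (hm : Measurable b₀) {R : ℝ} (hR : 0 ≤ R)
    (hlim : ∀ γ x, |ballMean b γ x - b₀ x| ≤ R * ((p : ℝ) ^ γ) ^ β) : MemLip β b₀ := by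
  refine ⟨hm, lt_of_le_of_lt (iSup_le fun x => iSup₂_le fun y hne => ?_)
    (ENNReal.ofReal_lt_top (r := 2 * R * (p : ℝ) ^ β))⟩
  have hp := prime_real_pos p
  have hpos : 0 < ‖x - y‖ := norm_pos_iff.2 (sub_ne_zero.2 hne)
  obtain ⟨γ, hγlt, hγle⟩ := exists_mem_Ioc_zpow hpos (one_lt_prime_real p)
  have hradius : ((p : ℝ) ^ (γ + 1)) ^ β ≤ (p : ℝ) ^ β * ‖x - y‖ ^ β := by
    rw [← Real.mul_rpow hp.le hpos.le, zpow_add_one₀ hp.ne', mul_comm]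
    gcongr
  have hmean : ballMean b (γ + 1) x = ballMean b (γ + 1) y :=
    ballMean_eq_of_mem b (mem_pball.2 hγle)
  refine ENNReal.ofReal_le_ofReal ((div_le_iff₀ (Real.rpow_pos_of_pos hpos β)).2 ?_)
  calc |b₀ x - b₀ y| ≤ |b₀ x - ballMean b (γ + 1) x| + |ballMean b (γ + 1) x - b₀ y| :=
        abs_sub_le _ _ _
    _ = |ballMean b (γ + 1) x - b₀ x| + |ballMean b (γ + 1) y - b₀ y| := by
        rw [abs_sub_comm (b₀ x), hmean]
    _ ≤ R * ((p : ℝ) ^ (γ + 1)) ^ β + R * ((p : ℝ) ^ (γ + 1)) ^ β :=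
        add_le_add (hlim _ x) (hlim _ y)
    _ = 2 * R * ((p : ℝ) ^ (γ + 1)) ^ β := by ring
    _ ≤ 2 * R * ((p : ℝ) ^ β * ‖x - y‖ ^ β) := by gcongr
    _ = 2 * R * (p : ℝ) ^ β * ‖x - y‖ ^ β := by ring

theorem exists_memLip_of_oscSup_lt_top (hn : 0 < n) {α β : ℝ} (hα : 0 ≤ α) (hαn : α ≤ n)
    (hβ : 0 < β) {b q : Qpn p n → ℝ} (hb : LocallyIntegrable b (haar p n)) (hq : MemClog q)
    (hosc : oscSup α β b q < ∞) :
    ∃ b₀ : Qpn p n → ℝ, b =ᵐ[haar p n] b₀ ∧ MemLip β b₀ ∧ ∀ x, 0 ≤ b₀ x := by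
  obtain ⟨M, hM, hcamp⟩ := hq.exists_campanatoBound hn hα hαn hb hosc
  obtain ⟨b₀, R, hR, hm, hb₀, hlim⟩ := hcamp.exists_limit hβ hM hb
  exact ⟨b₀, hcamp.ae_eq_of_abs_ballMean_sub_le hβ hM hb.aestronglyMeasurable.aemeasurable
    hm.aemeasurable hR hlim, memLip_of_abs_ballMean_sub_le hβ.le hm hR hlim, hb₀⟩

end PadicVar

theorem theorem1_general (p : ℕ) [Fact p.Prime] (n : ℕ) (α β : ℝ)
    (hβ : 0 < β) (hα : 0 ≤ α) (hαβ : α + β < n)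
    (b : PadicVar.Qpn p n → ℝ) (hb : LocallyIntegrable b (PadicVar.haar p n)) :
    List.TFAE [
      ∃ b₀ : PadicVar.Qpn p n → ℝ,
        b =ᵐ[PadicVar.haar p n] b₀ ∧ PadicVar.MemLip β b₀ ∧ ∀ x, 0 ≤ b₀ x,
      ∀ r q : PadicVar.Qpn p n → ℝ, PadicVar.AdmissiblePair (α + β) r q →
        PadicVar.CommutatorBounded α b r q,
      ∃ r q : PadicVar.Qpn p n → ℝ, PadicVar.AdmissiblePair (α + β) r q ∧
        PadicVar.CommutatorBounded α b r q,
      ∃ r q : PadicVar.Qpn p n → ℝ, PadicVar.AdmissiblePair (α + β) r q ∧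
        PadicVar.oscSup α β b q < ∞,
      ∀ r q : PadicVar.Qpn p n → ℝ, PadicVar.AdmissiblePair (α + β) r q →
        PadicVar.oscSup α β b q < ∞] := by
  have hs : 0 < α + β := add_pos_of_nonneg_of_pos hα hβ
  have hn : 0 < n := by exact_mod_cast hs.trans hαβ
  have hαn : α ≤ n := (le_add_of_nonneg_right hβ.le).trans hαβ.le
  obtain ⟨r₀, q₀, hpair⟩ := PadicVar.exists_admissiblePair p n hs hαβ
  tfae_have 1 → 2 := fun ⟨_, hbb, hlip, h0⟩ _ _ h =>
    PadicVar.commutatorBounded_of_memLip hn hα hβ.le hbb hlip h0 h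
  tfae_have 2 → 3 := fun h => ⟨r₀, q₀, hpair, h r₀ q₀ hpair⟩
  tfae_have 3 → 4 := fun ⟨r, q, h, hC⟩ =>
    ⟨r, q, h, PadicVar.oscSup_lt_top_of_commutatorBounded hα hαn hs.le h hC⟩
  tfae_have 4 → 1 := fun ⟨_, _, h, hosc⟩ =>
    PadicVar.exists_memLip_of_oscSup_lt_top hn hα hαn hβ hb h.q_mem_Clog hosc
  tfae_have 2 → 5 := fun h r q hrq =>
    PadicVar.oscSup_lt_top_of_commutatorBounded hα hαn hs.le hrq (h r q hrq)
  tfae_have 5 → 4 := fun h => ⟨r₀, q₀, hpair, h r₀ q₀ hpair⟩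
  tfae_finish

theorem theorem1 (p : ℕ) [Fact p.Prime] (n : ℕ) (α β : ℝ)
    (hβ0 : 0 < β) (hβ1 : β < 1) (hα : 0 < α) (hαβ : α + β < n)
    (b : PadicVar.Qpn p n → ℝ) (hb : LocallyIntegrable b (PadicVar.haar p n)) :
    List.TFAE [
      -- `b ∈ Λ_β` and `b ≥ 0`, as an element of `L¹_loc` (functions modulo null sets)
      ∃ b₀ : PadicVar.Qpn p n → ℝ, b =ᵐ[PadicVar.haar p n] b₀ ∧ PadicVar.MemLip β b₀ ∧ ∀ x, 0 ≤ b₀ x,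
      ∀ r q : PadicVar.Qpn p n → ℝ, PadicVar.AdmissiblePair (α + β) r q →
        PadicVar.CommutatorBounded α b r q,
      ∃ r q : PadicVar.Qpn p n → ℝ, PadicVar.AdmissiblePair (α + β) r q ∧
        PadicVar.CommutatorBounded α b r q,
      ∃ r q : PadicVar.Qpn p n → ℝ, PadicVar.AdmissiblePair (α + β) r q ∧
        PadicVar.oscSup α β b q < ∞,
      ∀ r q : PadicVar.Qpn p n → ℝ, PadicVar.AdmissiblePair (α + β) r q →
        PadicVar.oscSup α β b q < ∞] :=
  theorem1_general p n α β hβ0 hα.le hαβ b hb
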